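/- Let $F$ be a CM field with complex conjugation $x \mapsto \bar x$, let $\mathcal K \subset F$ be an imaginary quadratic subfield, let $D$ be a central simple $F$-algebra of dimension $n^2$ with an involution $*$ that restricts to complex conjugation on $F$, and let $G/\mathbb Q$ be the group of unitary similitudes of $D$, so that $G(R) = \{g \in (D \otimes_{\mathbb Q} R)^\times : g g^* \in R^\times\}$. Let $K \subset G(\mathbb A_f)$ be a compact open subgroup and $S$ a finite set of primes such that $K = K_S \prod_{\ell \notin S} K_\ell$ with $K_S \subset G(\mathbb A_{f,S})$, and such that for all $\ell \notin S$ the field $F$ is unramified at $\ell$, the algebra $D$ splits at all places above $\ell$, and $K_\ell \subset G(\mathbb Q_\ell)$ is hyperspecial. Then $G(\mathcal K \otimes \mathbb Q_\ell)$ is identified with $G^+(\mathbb Q_\ell) = (\mathcal K \otimes \mathbb Q_\ell)^\times \times \mathrm{GL}_n(F \otimes \mathbb Q_\ell)$ for $\ell \notin S$. For integers $m \geq 1$ and $0 \leq r \leq n$ let $T^{+}_{r,m,\ell}$ be the characteristic function of the double coset $G^+(\mathbb Z_\ell)\,\bigl(1, \mathrm{diag}(m, \ldots, m, 1, \ldots,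 1)\bigr)\,G^+(\mathbb Z_\ell)$, with $r$ entries $m$, where $G^+(\mathbb Z_\ell) = (\mathcal O_{\mathcal K} \otimes \mathbb Z_\ell)^\times \times \mathrm{GL}_n(\mathcal O_F \otimes \mathbb Z_\ell)$. Let $T_{r,m,\ell}$ be its image under the base change morphism $\mathcal H(G^+(\mathbb Q_\ell) /\!/ G^+(\mathbb Z_\ell)) \to \mathcal H(G(\mathbb Q_\ell) /\!/ K_\ell)$ (the unital morphism which the Satake transforms turn into the map of group algebras of cocharacters induced by the norm map of tori $T(\mathcal K \otimes \mathbb Q_\ell) \to T(\mathbb Q_\ell)$), and put $T_{r,m} = \mathbf 1_{K_S} \otimes \bigotimes_{\ell \notin S} T_{r,m,\ell}$, a bi-$K$-invariant function on $G(\mathbb A_f)$. Let $\deg(T_{r,m}) = \int_{G(\mathbb A_f)} T_{r,m}$ be the trace of $T_{r,m}$ on the trivial representation, where $K$ has volume $1$, and let $N(T_{r,m}) = \prod_{\ell \notin S} N_\ell(T_{r,m,\ell})$, where $N_\ell(T_{r,m,\ell}) = \sum_\nu |c_{\ell,\nu}|$ is the sum of the absolute values of the coefficients of the Satake transform $\sum_\nu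 c_{\ell,\nu} [\nu]$ of $T_{r,m,\ell}$, with $\nu$ ranging over the cocharacters of a maximal split torus of $G_{\mathbb Q_\ell}$. Then there exists a constant $C > 0$ such that for every $\varepsilon > 0$ there exists an integer $M > 0$ such that for all square-free integers $m > M$ and all integers $r$ with $1 \leq r \leq n-1$ $$\left| \frac{N(T_{r,m})}{\deg(T_{r,m})} \right| < C\, m^{\varepsilon - [F:\mathbb Q] \frac{r(n-r)}{2}}.$$ -/

import Mathlib

open scoped TensorProduct
open NumberField

noncomputable section

namespace Equidist

/-! ### Hecke algebras and Satake transforms of general groups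

`G` is a group with a compact open subgroup `K`, and `Haar measure` is normalised so that `K` has
volume one. All integrals of right `K`-invariant functions are then sums over cosets, so that no
topology on `G` is needed here. -/

section General

variable {G : Type*} [Group G]

/-- The Hecke algebra `ℋ(G // K)`, as a vector space: the `K`-bi-invariant complex functions on `G`
that are supported on finitely many double cosets of `K` (that is, with compact support). -/
def heckeAlgebra (K : Subgroup G) : Submodule ℂ (G → ℂ) where
  carrier := {f | (∀ k₁ ∈ K, ∀ k₂ ∈ K, ∀ g, f (k₁ * g * k₂) = f g) ∧
    ∃ s : Finset G, ∀ g, f g ≠ 0 → ∃ x ∈ s, ∃ k₁ ∈ K, ∃ k₂ ∈ K, g = k₁ * x * k₂}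
  zero_mem' := ⟨fun _ _ _ _ _ => rfl, ∅, fun _ h => absurd rfl h⟩
  add_mem' := by
    classical
    rintro f₁ f₂ ⟨h₁, s₁, hs₁⟩ ⟨h₂, s₂, hs₂⟩
    refine ⟨fun k₁ hk₁ k₂ hk₂ g => ?_, s₁ ∪ s₂, fun g hg => ?_⟩
    · simp only [Pi.add_apply, h₁ k₁ hk₁ k₂ hk₂ g, h₂ k₁ hk₁ k₂ hk₂ g]
    · by_cases h : f₁ g = 0
      · have h' : f₂ g ≠ 0 := fun h' => hg (by simp [h, h'])
        obtain ⟨x, hx, H⟩ := hs₂ g h'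
        exact ⟨x, Finset.mem_union_right _ hx, H⟩
      · obtain ⟨x, hx, H⟩ := hs₁ g h
        exact ⟨x, Finset.mem_union_left _ hx, H⟩
  smul_mem' := by
    rintro c f ⟨h, s, hs⟩
    refine ⟨fun k₁ hk₁ k₂ hk₂ g => ?_, s, fun g hg => hs g fun h0 => hg ?_⟩
    · simp only [Pi.smul_apply, h k₁ hk₁ k₂ hk₂ g]
    · simp [h0]

open Classical in
/-- The characteristic function of the double coset of `x`. -/
def charDoubleCoset (K : Subgroup G) (x : G) : heckeAlgebra K :=
  ⟨fun g => if ∃ k₁ ∈ K, ∃ k₂ ∈ K, g = k₁ * x * k₂ then 1 else 0, by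
    refine ⟨fun k₁ hk₁ k₂ hk₂ g => ?_, {x}, fun g hg => ?_⟩
    · have : (∃ a ∈ K, ∃ b ∈ K, k₁ * g * k₂ = a * x * b) ↔ ∃ a ∈ K, ∃ b ∈ K, g = a * x * b := by
        constructor
        · rintro ⟨a, ha, b, hb, h⟩
          refine ⟨k₁⁻¹ * a, K.mul_mem (K.inv_mem hk₁) ha, b * k₂⁻¹,
            K.mul_mem hb (K.inv_mem hk₂), ?_⟩
          have : g = k₁⁻¹ * (k₁ * g * k₂) * k₂⁻¹ := by group
          rw [this, h]; group
        · rintro ⟨a, ha, b, hb, rfl⟩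
          exact ⟨k₁ * a, K.mul_mem hk₁ ha, b * k₂, K.mul_mem hb hk₂, by group⟩
      simp only [this]
    · by_contra h
      exact hg (if_neg fun h' => h ⟨x, Finset.mem_singleton_self x, h'⟩)⟩

/-- The unit `𝟙_K` of the Hecke algebra. -/
def heckeUnit (K : Subgroup G) : heckeAlgebra K := charDoubleCoset K 1

/-- The degree of a Hecke operator `f`: its trace `∫_G f` on the trivial representation, for the
Haar measure giving volume one to `K`. -/
def heckeDegree (K : Subgroup G) (f : G → ℂ) : ℂ := ∑ᶠ q : G ⧸ K, f q.out

variable {A : Type*} [CommGroup A]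

/-- The value at `a` of the Satake transform of a `K`-bi-invariant function `f`,
`δ(a)^{1/2} ∫_N f(a n) dn`, where `N ∩ K` has volume one. Here `N` is the unipotent radical of a
Borel subgroup `T N`, the map `ι : A → G` is the embedding of the maximal torus `T`, and `δ` is the
modulus character. -/
def satakeCoeff (K N : Subgroup G) (ι : A →* G) (δ : A → ℝ) (f : G → ℂ) (a : A) : ℂ :=
  (Real.sqrt (δ a) : ℂ) * ∑ᶠ u : N ⧸ K.subgroupOf N, f (ι a * (u.out : N))

/-- The group `T / (T ∩ K)`. When `T` is the centraliser of a maximal split torus `T'` in an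
unramified `ℓ`-adic group and `K` is hyperspecial (and in good position), then `ν ↦ ν(ℓ)` identifies
the group `X_*(T')` of cocharacters with `T / (T ∩ K)`. -/
def CocharLattice (K : Subgroup G) (ι : A →* G) : Type _ := A ⧸ K.comap ι

instance (K : Subgroup G) (ι : A →* G) : CommGroup (CocharLattice K ι) :=
  inferInstanceAs (CommGroup (A ⧸ K.comap ι))

/-- The class in `T / (T ∩ K)` of an element of `T`. -/
def CocharLattice.mk (K : Subgroup G) (ι : A →* G) : A →* CocharLattice K ι :=
  QuotientGroup.mk' (K.comap ι)

/-- The Satake transform, with values in the group algebra of `X_*(T') = T / (T ∩ K)`. -/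
def satake (K N : Subgroup G) (ι : A →* G) (δ : A → ℝ) (f : G → ℂ) :
    MonoidAlgebra ℂ (CocharLattice K ι) :=
  ∑ᶠ q : CocharLattice K ι,
    MonoidAlgebra.single q (satakeCoeff K N ι δ f (Quotient.out (s := QuotientGroup.leftRel _) q))

/-- The sum of the absolute values of the coefficients of an element of a group algebra. -/
def coeffNorm {X : Type*} (P : MonoidAlgebra ℂ X) : ℝ := P.coeff.sum fun _ c => ‖c‖

/-- The group of similitudes of a `k`-algebra with an anti-endomorphism `s`:
the units `g` such that `g * s g` is a scalar in `kˣ`. -/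
def similitudes {k R : Type*} [Field k] [Ring R] [Algebra k R] (s : R →ₐ[k] Rᵐᵒᵖ) :
    Subgroup Rˣ where
  carrier := {g | ∃ c : kˣ, (g : R) * (s g).unop = algebraMap k R c}
  one_mem' := ⟨1, by simp⟩
  mul_mem' := by
    rintro g h ⟨c, hc⟩ ⟨d, hd⟩
    refine ⟨c * d, ?_⟩
    have : ((g * h : Rˣ) : R) * (s ((g * h : Rˣ) : R)).unop
        = (g : R) * ((h : R) * (s (h : R)).unop) * (s (g : R)).unop := by
      simp [map_mul, mul_assoc]
    rw [this, hd, ← Algebra.commutes, mul_assoc, hc, ← map_mul, mul_comm, Units.val_mul]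
  inv_mem' := by
    rintro g ⟨c, hc⟩
    refine ⟨c⁻¹, ?_⟩
    have h1 : (s (g : R)).unop = ((g⁻¹ : Rˣ) : R) * algebraMap k R c := by
      rw [← hc, ← mul_assoc, Units.inv_mul, one_mul]
    have h2 : (s (g : R)).unop * (s ((g⁻¹ : Rˣ) : R)).unop
        * (algebraMap k R (c⁻¹ : kˣ) * (g : R)) = algebraMap k R (c⁻¹ : kˣ) * (g : R) := by
      rw [← MulOpposite.unop_mul, ← map_mul, Units.inv_mul, map_one, MulOpposite.unop_one, one_mul]
    have h3 : (s ((g⁻¹ : Rˣ) : R)).unop * (s (g : R)).unop = 1 := by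
      rw [← MulOpposite.unop_mul, ← map_mul, Units.mul_inv, map_one, MulOpposite.unop_one]
    have h4 : (s ((g⁻¹ : Rˣ) : R)).unop = algebraMap k R (c⁻¹ : kˣ) * (g : R) := by
      have h5 : (s (g : R)).unop * (algebraMap k R (c⁻¹ : kˣ) * (g : R)) = 1 := by
        rw [h1, mul_assoc, ← mul_assoc (algebraMap k R (c : k)), ← map_mul, Units.mul_inv, map_one,
          one_mul, Units.inv_mul]
      calc (s ((g⁻¹ : Rˣ) : R)).unop
          = (s ((g⁻¹ : Rˣ) : R)).unop * ((s (g : R)).unop * (algebraMap k R (c⁻¹ : kˣ) * (g : R))) := by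
            rw [h5, mul_one]
        _ = algebraMap k R (c⁻¹ : kˣ) * (g : R) := by rw [← mul_assoc, h3, one_mul]
    rw [h4, ← mul_assoc, ← Algebra.commutes, mul_assoc, Units.inv_mul, mul_one]

end General

/-! ### Number fields at a prime `ℓ` -/

section Local

instance factPrimes (ℓ : Nat.Primes) : Fact (ℓ : ℕ).Prime := ⟨ℓ.2⟩

variable (ℓ : ℕ) [Fact ℓ.Prime]

/-- The `ℚ_ℓ`-algebra `E_ℓ = ℚ_ℓ ⊗ E`, for a number field `E`. -/
def LocField (E : Type*) [Field E] [NumberField E] : Type _ := ℚ_[ℓ] ⊗[ℚ] E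

instance (E : Type*) [Field E] [NumberField E] : CommRing (LocField ℓ E) :=
  inferInstanceAs (CommRing (ℚ_[ℓ] ⊗[ℚ] E))

instance (E : Type*) [Field E] [NumberField E] : Nontrivial (LocField ℓ E) :=
  inferInstanceAs (Nontrivial (ℚ_[ℓ] ⊗[ℚ] E))

instance (E : Type*) [Field E] [NumberField E] : Algebra ℚ_[ℓ] (LocField ℓ E) :=
  inferInstanceAs (Algebra ℚ_[ℓ] (ℚ_[ℓ] ⊗[ℚ] E))

instance (E : Type*) [Field E] [NumberField E] : Algebra ℤ_[ℓ] (LocField ℓ E) :=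
  inferInstanceAs (Algebra ℤ_[ℓ] (ℚ_[ℓ] ⊗[ℚ] E))

instance (E : Type*) [Field E] [NumberField E] : IsScalarTower ℤ_[ℓ] ℚ_[ℓ] (LocField ℓ E) :=
  inferInstanceAs (IsScalarTower ℤ_[ℓ] ℚ_[ℓ] (ℚ_[ℓ] ⊗[ℚ] E))

/-- The map `E → E_ℓ`. -/
def toLoc (E : Type*) [Field E] [NumberField E] : E →+* LocField ℓ E :=
  (Algebra.TensorProduct.includeRight : E →ₐ[ℚ] ℚ_[ℓ] ⊗[ℚ] E).toRingHom

variable {ℓ} in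
lemma LocField.induction {E : Type*} [Field E] [NumberField E] {P : LocField ℓ E → Prop}
    (h : ∀ (a : ℚ_[ℓ]) (x : E), P (algebraMap ℚ_[ℓ] (LocField ℓ E) a * toLoc ℓ E x))
    (hadd : ∀ x y, P x → P y → P (x + y)) (x : LocField ℓ E) : P x := by
  induction x using TensorProduct.induction_on with
  | zero =>
    have h0 := h 0 0
    rw [map_zero, zero_mul] at h0
    exact h0
  | tmul a x =>
    have : (a ⊗ₜ[ℚ] x : ℚ_[ℓ] ⊗[ℚ] E) = (a ⊗ₜ[ℚ] 1) * (1 ⊗ₜ[ℚ] x) := by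
      rw [Algebra.TensorProduct.tmul_mul_tmul, mul_one, one_mul]
    exact this ▸ h a x
  | add x y hx hy => exact hadd x y hx hy

lemma toLoc_rat (E : Type*) [Field E] [NumberField E] (q : ℚ) :
    toLoc ℓ E (algebraMap ℚ E q) = algebraMap ℚ_[ℓ] (LocField ℓ E) (algebraMap ℚ ℚ_[ℓ] q) :=
  RingHom.congr_fun (Subsingleton.elim ((toLoc ℓ E).comp (algebraMap ℚ E))
    ((algebraMap ℚ_[ℓ] (LocField ℓ E)).comp (algebraMap ℚ ℚ_[ℓ]))) q

/-- The map `E_ℓ → E'_ℓ` induced by a homomorphism `E → E'` of number fields. -/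
def locMap {E E' : Type*} [Field E] [NumberField E] [Field E'] [NumberField E'] (f : E →+* E') :
    LocField ℓ E →ₐ[ℚ_[ℓ]] LocField ℓ E' :=
  (Algebra.TensorProduct.map (AlgHom.id ℚ_[ℓ] ℚ_[ℓ]) f.toRatAlgHom :
    ℚ_[ℓ] ⊗[ℚ] E →ₐ[ℚ_[ℓ]] ℚ_[ℓ] ⊗[ℚ] E')

@[simp] lemma locMap_toLoc {E E' : Type*} [Field E] [NumberField E] [Field E'] [NumberField E']
    (f : E →+* E') (x : E) : locMap ℓ f (toLoc ℓ E x) = toLoc ℓ E' (f x) := rfl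

/-- The order `ℤ_ℓ ⊗ 𝓞 E` of `E_ℓ`. -/
def locInt (E : Type*) [Field E] [NumberField E] : Subalgebra ℤ_[ℓ] (LocField ℓ E) :=
  Algebra.adjoin ℤ_[ℓ] (Set.range fun x : 𝓞 E => toLoc ℓ E (x : E))

lemma locMap_mem {E E' : Type*} [Field E] [NumberField E] [Field E'] [NumberField E']
    (f : E →+* E') {x : LocField ℓ E} (hx : x ∈ locInt ℓ E) : locMap ℓ f x ∈ locInt ℓ E' := by
  induction hx using Algebra.adjoin_induction with
  | mem x hx =>
    obtain ⟨y, rfl⟩ := hx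
    rw [locMap_toLoc]
    exact Algebra.subset_adjoin ⟨⟨f (y : E), y.2.map f.toIntAlgHom⟩, rfl⟩
  | algebraMap z =>
    rw [IsScalarTower.algebraMap_apply ℤ_[ℓ] ℚ_[ℓ] (LocField ℓ E), AlgHom.commutes,
      ← IsScalarTower.algebraMap_apply ℤ_[ℓ] ℚ_[ℓ] (LocField ℓ E')]
    exact Subalgebra.algebraMap_mem _ z
  | add x y _ _ hx hy => rw [map_add]; exact Subalgebra.add_mem _ hx hy
  | mul x y _ _ hx hy => rw [map_mul]; exact Subalgebra.mul_mem _ hx hy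

/-- The units of `ℤ_ℓ ⊗ 𝓞 E`, as a subgroup of those of `E_ℓ`. -/
def locIntUnits (E : Type*) [Field E] [NumberField E] : Subgroup (LocField ℓ E)ˣ :=
  (locInt ℓ E).toSubmonoid.units

/-- The subgroup `GL_n(ℤ_ℓ ⊗ 𝓞 F)` of `GL_n(F_ℓ)`. -/
def glInt (F : Type*) [Field F] [NumberField F] (n : ℕ) :
    Subgroup (Matrix (Fin n) (Fin n) (LocField ℓ F))ˣ :=
  (Subring.matrix (n := Fin n) (locInt ℓ F).toSubring).toSubmonoid.units

end Local

section Matrices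

variable (n : ℕ) (R : Type*) [CommRing R]

/-- The unipotent upper triangular matrices. -/
def unipotent : Subgroup (Matrix (Fin n) (Fin n) R)ˣ :=
  Submonoid.units
    { carrier := {B | (∀ i j, j < i → B i j = 0) ∧ ∀ i, B i i = 1}
      one_mem' := ⟨fun _ _ h => Matrix.one_apply_ne h.ne', fun _ => Matrix.one_apply_eq _⟩
      mul_mem' := by
        rintro B C ⟨hB, hB'⟩ ⟨hC, hC'⟩
        refine ⟨fun i j hij => ?_, fun i => ?_⟩
        · rw [Matrix.mul_apply]
          refine Finset.sum_eq_zero fun k _ => ?_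
          rcases lt_or_ge k i with h | h
          · rw [hB i k h, zero_mul]
          · rw [hC k j (lt_of_lt_of_le hij h), mul_zero]
        · rw [Matrix.mul_apply, Finset.sum_eq_single i, hB', hC', one_mul]
          · intro k _ hk
            rcases lt_or_gt_of_ne hk with h | h
            · rw [hB i k h, zero_mul]
            · rw [hC k i h, mul_zero]
          · simp }

/-- The embedding of the diagonal torus in `GL_n`. -/
def diagUnits : (Fin n → Rˣ) →* (Matrix (Fin n) (Fin n) R)ˣ :=
  (Units.map (Matrix.diagonalRingHom (Fin n) R).toMonoidHom).comp
    (MulEquiv.piUnits (M := fun _ : Fin n => R)).symm.toMonoidHom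

variable {n R}

lemma diagUnits_val (t : Fin n → Rˣ) :
    ((diagUnits n R t : (Matrix (Fin n) (Fin n) R)ˣ) : Matrix (Fin n) (Fin n) R)
      = Matrix.diagonal fun i => (t i : R) := rfl

variable (n R) in
/-- The Lie algebra of the group of unipotent upper triangular matrices. -/
def lieUnipotent (k : Type*) [Field k] [Algebra k R] : Submodule k (Matrix (Fin n) (Fin n) R) where
  carrier := {X | ∀ i j, j ≤ i → X i j = 0}
  zero_mem' := fun _ _ _ => rfl
  add_mem' := fun hX hY i j h => by simp [hX i j h, hY i j h]
  smul_mem' := fun c X hX i j h => by simp [hX i j h]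

/-- Conjugation of matrices by the diagonal matrix `t`. -/
def adDiag (k : Type*) [Field k] [Algebra k R] (t : Fin n → Rˣ) :
    Matrix (Fin n) (Fin n) R →ₗ[k] Matrix (Fin n) (Fin n) R where
  toFun X := Matrix.of fun i j => (t i : R) * X i j * ((t j)⁻¹ : Rˣ)
  map_add' X Y := by ext i j; simp [mul_add, add_mul]
  map_smul' c X := by ext i j; simp

lemma adDiag_mem (k : Type*) [Field k] [Algebra k R] (t : Fin n → Rˣ) :
    ∀ X ∈ lieUnipotent n R k, adDiag k t X ∈ lieUnipotent n R k := fun X hX i j h => by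
  simp [adDiag, hX i j h]

end Matrices

/-! ### The local groups: the quasi-split similitude group and `G⁺` -/

section Unitary

variable (ℓ : ℕ) [Fact ℓ.Prime] (n : ℕ)
variable (F : Type*) [Field F] [NumberField F] [IsCMField F]

/-- Complex conjugation on `F_ℓ`. -/
def locConj : LocField ℓ F →ₐ[ℚ_[ℓ]] LocField ℓ F :=
  locMap ℓ (IsCMField.complexConj F).toRingEquiv.toRingHom

@[simp] lemma locConj_toLoc (x : F) :
    locConj ℓ F (toLoc ℓ F x) = toLoc ℓ F (IsCMField.complexConj F x) := rfl

lemma locConj_locConj (x : LocField ℓ F) : locConj ℓ F (locConj ℓ F x) = x := by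
  induction x using LocField.induction with
  | h a x => simp
  | hadd x y hx hy => rw [map_add, map_add, hx, hy]

/-- The involution of `M_n(F_ℓ)` that is adjoint to the Hermitian form with antidiagonal Gram
matrix: it sends `(X_{ij})` to `(conj X_{n+1-j, n+1-i})`. -/
def dagger : Matrix (Fin n) (Fin n) (LocField ℓ F) →ₐ[ℚ_[ℓ]] (Matrix (Fin n) (Fin n) (LocField ℓ F))ᵐᵒᵖ :=
  (Matrix.transposeAlgEquiv (Fin n) ℚ_[ℓ] (LocField ℓ F)).toAlgHom.comp
    ((locConj ℓ F).mapMatrix.comp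
      (Matrix.reindexAlgEquiv ℚ_[ℓ] (LocField ℓ F) (Fin.revPerm (n := n))).toAlgHom)

lemma dagger_apply (X : Matrix (Fin n) (Fin n) (LocField ℓ F)) (i j : Fin n) :
    (dagger ℓ n F X).unop i j = locConj ℓ F (X j.rev i.rev) := rfl

/-- The `ℚ_ℓ`-points of the quasi-split group of unitary similitudes in `n` variables over `F_ℓ`,
with similitude factor in `ℚ_ℓˣ`. -/
def GU : Subgroup (Matrix (Fin n) (Fin n) (LocField ℓ F))ˣ := similitudes (dagger ℓ n F)

/-- The standard hyperspecial subgroup of `GU`, of the matrices in `GL_n(ℤ_ℓ ⊗ 𝓞 F)`. -/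
def GUint : Subgroup (GU ℓ n F) := (glInt ℓ F n).subgroupOf (GU ℓ n F)

/-- The unipotent radical of the upper triangular Borel subgroup of `GU`. -/
def GUunip : Subgroup (GU ℓ n F) := (unipotent n (LocField ℓ F)).subgroupOf (GU ℓ n F)

/-- The diagonal torus of `GU`: the `(t_i)` with `t_i * conj t_{n+1-i} = c ∈ ℚ_ℓˣ` for all `i`. -/
def GUtorus : Subgroup (Fin n → (LocField ℓ F)ˣ) where
  carrier := {t | ∃ c : ℚ_[ℓ]ˣ, ∀ i, (t i : LocField ℓ F) * locConj ℓ F (t i.rev : LocField ℓ F)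
    = algebraMap ℚ_[ℓ] (LocField ℓ F) c}
  one_mem' := ⟨1, fun i => by simp⟩
  mul_mem' := by
    rintro t u ⟨c, hc⟩ ⟨d, hd⟩
    refine ⟨c * d, fun i => ?_⟩
    rw [Units.val_mul, map_mul, ← hc i, ← hd i]
    simp only [Pi.mul_apply, Units.val_mul, map_mul]
    ring
  inv_mem' := by
    rintro t ⟨c, hc⟩
    refine ⟨c⁻¹, fun i => ?_⟩
    have h1 : (t i : LocField ℓ F) * (((t i)⁻¹ : (LocField ℓ F)ˣ) : LocField ℓ F) = 1 := Units.mul_inv _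
    have h2 : locConj ℓ F (t i.rev : LocField ℓ F)
        * locConj ℓ F (((t i.rev)⁻¹ : (LocField ℓ F)ˣ) : LocField ℓ F) = 1 := by
      rw [← map_mul, Units.mul_inv, map_one]
    have h3 : algebraMap ℚ_[ℓ] (LocField ℓ F) (c : ℚ_[ℓ])
        * algebraMap ℚ_[ℓ] (LocField ℓ F) ((c⁻¹ : ℚ_[ℓ]ˣ) : ℚ_[ℓ]) = 1 := by
      rw [← map_mul, Units.mul_inv, map_one]
    have h4 := hc i
    simp only [Pi.inv_apply]
    calc _ = (((t i)⁻¹ : (LocField ℓ F)ˣ) : LocField ℓ F)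
          * locConj ℓ F (((t i.rev)⁻¹ : (LocField ℓ F)ˣ) : LocField ℓ F)
          * (algebraMap ℚ_[ℓ] (LocField ℓ F) (c : ℚ_[ℓ])
            * algebraMap ℚ_[ℓ] (LocField ℓ F) ((c⁻¹ : ℚ_[ℓ]ˣ) : ℚ_[ℓ])) := by rw [h3, mul_one]
      _ = ((t i : LocField ℓ F) * (((t i)⁻¹ : (LocField ℓ F)ˣ) : LocField ℓ F))
          * (locConj ℓ F (t i.rev : LocField ℓ F)
            * locConj ℓ F (((t i.rev)⁻¹ : (LocField ℓ F)ˣ) : LocField ℓ F))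
          * algebraMap ℚ_[ℓ] (LocField ℓ F) ((c⁻¹ : ℚ_[ℓ]ˣ) : ℚ_[ℓ]) := by rw [← h4]; ring
      _ = _ := by rw [h1, h2, one_mul, one_mul]

/-- The embedding of the diagonal torus in `GU`. -/
def GUdiag : GUtorus ℓ n F →* GU ℓ n F :=
  ((diagUnits n (LocField ℓ F)).comp (GUtorus ℓ n F).subtype).codRestrict (GU ℓ n F) (by
    rintro ⟨t, c, hc⟩
    refine ⟨c, ?_⟩
    ext i j
    rw [MonoidHom.comp_apply, Subgroup.coe_subtype, diagUnits_val, Matrix.diagonal_mul,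
      dagger_apply, Matrix.algebraMap_matrix_apply]
    by_cases h : i = j
    · subst h
      simp [hc i]
    · have h' : j.rev ≠ i.rev := fun h' => h (Fin.rev_injective h').symm
      simp [Matrix.diagonal_apply_ne _ h', h])

/-- The Lie algebra of `GUunip`: the strictly upper triangular `X` with `X + X† = 0`. -/
def lieGU : Submodule ℚ_[ℓ] (Matrix (Fin n) (Fin n) (LocField ℓ F)) where
  carrier := {X | X ∈ lieUnipotent n (LocField ℓ F) ℚ_[ℓ] ∧ X + (dagger ℓ n F X).unop = 0}
  zero_mem' := ⟨Submodule.zero_mem _, by simp⟩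
  add_mem' := by
    rintro X Y ⟨hX, hX'⟩ ⟨hY, hY'⟩
    refine ⟨Submodule.add_mem _ hX hY, ?_⟩
    rw [map_add, MulOpposite.unop_add, add_add_add_comm, hX', hY', add_zero]
  smul_mem' := by
    rintro c X ⟨hX, hX'⟩
    refine ⟨Submodule.smul_mem _ c hX, ?_⟩
    rw [map_smul, MulOpposite.unop_smul, ← smul_add, hX', smul_zero]

lemma adDiag_mem_lieGU (t : GUtorus ℓ n F) :
    ∀ X ∈ lieGU ℓ n F, adDiag ℚ_[ℓ] t.1 X ∈ lieGU ℓ n F := by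
  obtain ⟨t, c, hc⟩ := t
  rintro X ⟨hX, hX'⟩
  refine ⟨adDiag_mem _ t X hX, ?_⟩
  ext i j
  have hX'' : X i j + locConj ℓ F (X j.rev i.rev) = 0 := congrFun (congrFun hX' i) j
  have hi := hc i
  have hj := hc j
  have h1 : (t j : LocField ℓ F) * (((t j)⁻¹ : (LocField ℓ F)ˣ) : LocField ℓ F) = 1 := Units.mul_inv _
  have h2 : locConj ℓ F (t i.rev : LocField ℓ F)
      * locConj ℓ F (((t i.rev)⁻¹ : (LocField ℓ F)ˣ) : LocField ℓ F) = 1 := by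
    rw [← map_mul, Units.mul_inv, map_one]
  rw [Matrix.add_apply, dagger_apply]
  simp only [adDiag, LinearMap.coe_mk, AddHom.coe_mk, Matrix.of_apply, map_mul, Matrix.zero_apply]
  have h3 : locConj ℓ F (t j.rev : LocField ℓ F)
      * locConj ℓ F (((t i.rev)⁻¹ : (LocField ℓ F)ˣ) : LocField ℓ F)
      = (t i : LocField ℓ F) * (((t j)⁻¹ : (LocField ℓ F)ˣ) : LocField ℓ F) := by
    linear_combination
      (-(locConj ℓ F (t j.rev : LocField ℓ F)
          * locConj ℓ F (((t i.rev)⁻¹ : (LocField ℓ F)ˣ) : LocField ℓ F))) * h1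
        + (t i : LocField ℓ F) * (((t j)⁻¹ : (LocField ℓ F)ˣ) : LocField ℓ F) * h2
        + (((t j)⁻¹ : (LocField ℓ F)ˣ) : LocField ℓ F)
          * locConj ℓ F (((t i.rev)⁻¹ : (LocField ℓ F)ˣ) : LocField ℓ F) * (hj - hi)
  linear_combination (t i : LocField ℓ F) * (((t j)⁻¹ : (LocField ℓ F)ˣ) : LocField ℓ F) * hX''
    + locConj ℓ F (X j.rev i.rev) * h3

/-- The modulus character `|det (Ad t | Lie N)|` of the Borel subgroup of `GU`. -/
def GUmodulus (t : GUtorus ℓ n F) : ℝ :=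
  ‖LinearMap.det ((adDiag ℚ_[ℓ] t.1).restrict (adDiag_mem_lieGU ℓ n F t))‖

/-- The Satake transform on `ℋ(GU // GUint)`. -/
def satakeGU (f : heckeAlgebra (GUint ℓ n F)) :
    MonoidAlgebra ℂ (CocharLattice (GUint ℓ n F) (GUdiag ℓ n F)) :=
  satake (GUint ℓ n F) (GUunip ℓ n F) (GUdiag ℓ n F) (GUmodulus ℓ n F) f.1

end Unitary

section BaseChange

variable (ℓ : ℕ) [Fact ℓ.Prime] (n : ℕ)
variable (F : Type*) [Field F] [NumberField F]
variable (𝒦 : Type*) [Field 𝒦] [NumberField 𝒦] [Algebra 𝒦 F]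

/-- The `ℚ_ℓ`-points `𝒦_ℓˣ × GL_n(F_ℓ)` of `G⁺`. -/
abbrev GPlus : Type _ := (LocField ℓ 𝒦)ˣ × (Matrix (Fin n) (Fin n) (LocField ℓ F))ˣ

/-- The hyperspecial subgroup `G⁺(ℤ_ℓ)`. -/
def GPlusInt : Subgroup (GPlus ℓ n F 𝒦) := (locIntUnits ℓ 𝒦).prod (glInt ℓ F n)

/-- The unipotent radical of the upper triangular Borel subgroup of `G⁺`. -/
def GPlusUnip : Subgroup (GPlus ℓ n F 𝒦) := (⊥ : Subgroup (LocField ℓ 𝒦)ˣ).prod (unipotent n (LocField ℓ F))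

/-- The diagonal torus of `G⁺`. -/
abbrev GPlusTorus : Type _ := (LocField ℓ 𝒦)ˣ × (Fin n → (LocField ℓ F)ˣ)

/-- The embedding of the diagonal torus in `G⁺`. -/
def GPlusDiag : GPlusTorus ℓ n F 𝒦 →* GPlus ℓ n F 𝒦 :=
  (MonoidHom.id _).prodMap (diagUnits n (LocField ℓ F))

/-- The modulus character `|det (Ad t | Lie N)|` of the Borel subgroup of `G⁺`. -/
def GPlusModulus (t : GPlusTorus ℓ n F 𝒦) : ℝ :=
  ‖LinearMap.det ((adDiag ℚ_[ℓ] t.2).restrict (adDiag_mem (R := LocField ℓ F) ℚ_[ℓ] t.2))‖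

/-- The Satake transform on `ℋ(G⁺(ℚ_ℓ) // G⁺(ℤ_ℓ))`. -/
def satakePlus (f : heckeAlgebra (GPlusInt ℓ n F 𝒦)) :
    MonoidAlgebra ℂ (CocharLattice (GPlusInt ℓ n F 𝒦) (GPlusDiag ℓ n F 𝒦)) :=
  satake (GPlusInt ℓ n F 𝒦) (GPlusUnip ℓ n F 𝒦) (GPlusDiag ℓ n F 𝒦) (GPlusModulus ℓ n F 𝒦) f.1

open Classical in
/-- The local component at `ℓ` of `T_{r,m}^+`: the characteristic function of
`G⁺(ℤ_ℓ) · (1, diag(m, …, m, 1, …, 1)) · G⁺(ℤ_ℓ)`, with `r` entries `m` (and zero for `m = 0`,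
when this diagonal matrix is not invertible). -/
def heckePlus (r m : ℕ) : heckeAlgebra (GPlusInt ℓ n F 𝒦) :=
  if hm : IsUnit (m : LocField ℓ F) then
    charDoubleCoset (GPlusInt ℓ n F 𝒦)
      (1, diagUnits n (LocField ℓ F) fun i => if (i : ℕ) < r then hm.unit else 1)
  else 0

/-- The map `𝒦_ℓ → F_ℓ`. -/
def locEmb : LocField ℓ 𝒦 →ₐ[ℚ_[ℓ]] LocField ℓ F := locMap ℓ (algebraMap 𝒦 F)

@[simp] lemma locEmb_toLoc (x : 𝒦) :
    locEmb ℓ F 𝒦 (toLoc ℓ 𝒦 x) = toLoc ℓ F (algebraMap 𝒦 F x) := rfl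

lemma mem_of_diagUnits_mem {t : Fin n → (LocField ℓ F)ˣ}
    (h : diagUnits n (LocField ℓ F) t ∈ glInt ℓ F n) (i : Fin n) :
    (t i : LocField ℓ F) ∈ locInt ℓ F ∧ (((t i)⁻¹ : (LocField ℓ F)ˣ) : LocField ℓ F) ∈ locInt ℓ F := by
  obtain ⟨h1, h2⟩ := h
  have h1' := h1 i i
  have h2' := h2 i i
  have e1 : (diagUnits n (LocField ℓ F) t).val i i = (t i : LocField ℓ F) := by
    rw [diagUnits_val, Matrix.diagonal_apply_eq]
  have e2 : ((diagUnits n (LocField ℓ F) t)⁻¹).val i i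
      = (((t i)⁻¹ : (LocField ℓ F)ˣ) : LocField ℓ F) := by
    rw [← map_inv, diagUnits_val, Matrix.diagonal_apply_eq, Pi.inv_apply]
  exact ⟨e1 ▸ h1', e2 ▸ h2'⟩

lemma diagUnits_mem {t : Fin n → (LocField ℓ F)ˣ}
    (h : ∀ i, (t i : LocField ℓ F) ∈ locInt ℓ F ∧
      (((t i)⁻¹ : (LocField ℓ F)ˣ) : LocField ℓ F) ∈ locInt ℓ F) :
    diagUnits n (LocField ℓ F) t ∈ glInt ℓ F n := by
  have key : ∀ d : Fin n → LocField ℓ F, (∀ i, d i ∈ locInt ℓ F) →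
      ∀ i j, Matrix.diagonal d i j ∈ (locInt ℓ F).toSubring := fun d hd i j => by
    by_cases hij : i = j
    · subst hij
      rw [Matrix.diagonal_apply_eq]; exact hd i
    · rw [Matrix.diagonal_apply_ne _ hij]; exact Subring.zero_mem _
  refine ⟨key _ fun i => (h i).1, ?_⟩
  have := key _ fun i => (h i).2
  rw [← diagUnits_val (fun i => (t i)⁻¹)] at this
  exact this

variable [IsCMField F]

variable [IsTotallyComplex 𝒦] [Algebra.IsQuadraticExtension ℚ 𝒦]

/-- An imaginary quadratic subfield of `F` is spanned by `1` and an element `x` whose trace and norm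
are `s` and `p`. -/
lemma exists_quadratic_generator : ∃ (x : 𝒦) (s p : ℚ), (∀ y : 𝒦, ∃ a b : ℚ, y = a • 1 + b • x) ∧
    algebraMap 𝒦 F x + IsCMField.complexConj F (algebraMap 𝒦 F x) = algebraMap ℚ F s ∧
    algebraMap 𝒦 F x * IsCMField.complexConj F (algebraMap 𝒦 F x) = algebraMap ℚ F p := by
  have hfr : Module.finrank ℚ 𝒦 = 2 := Algebra.IsQuadraticExtension.finrank_eq_two ℚ 𝒦
  obtain ⟨x, hx⟩ : ∃ x : 𝒦, x ∉ (⊥ : Subalgebra ℚ 𝒦) := by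
    by_contra! h
    have : (⊥ : Subalgebra ℚ 𝒦) = ⊤ := eq_top_iff.2 fun y _ => h y
    have h1 := Subalgebra.bot_eq_top_iff_finrank_eq_one.1 this
    omega
  have hli : LinearIndependent ℚ ![(1 : 𝒦), x] := by
    rw [LinearIndependent.pair_iff' one_ne_zero]
    intro a ha
    exact hx (Algebra.mem_bot.2 ⟨a, by rw [Algebra.algebraMap_eq_smul_one]; exact ha⟩)
  have hspan : ∀ y : 𝒦, ∃ a b : ℚ, y = a • 1 + b • x := by
    intro y
    have h := hli.span_eq_top_of_card_eq_finrank (by simp [hfr])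
    have hy : y ∈ Submodule.span ℚ (Set.range ![(1 : 𝒦), x]) := by rw [h]; trivial
    simp only [Matrix.range_cons, Matrix.range_empty, Set.union_empty, Set.union_singleton,
      Set.pair_comm] at hy
    obtain ⟨a, b, hab⟩ := Submodule.mem_span_pair.1 hy
    exact ⟨a, b, hab.symm⟩
  obtain ⟨p, s, hps⟩ := hspan (x * x)
  set z := algebraMap 𝒦 F x with hz
  set w := IsCMField.complexConj F z with hw
  have e1 : z * z = algebraMap ℚ F p + algebraMap ℚ F s * z := by
    rw [hz, ← map_mul, hps]
    simp [Algebra.smul_def, map_add, map_mul]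
  have e2 : w * w = algebraMap ℚ F p + algebraMap ℚ F s * w := by
    have := congrArg (IsCMField.complexConj F) e1
    simpa [hw] using this
  have hne : z ≠ w := by
    intro h
    obtain ⟨φ⟩ : Nonempty (F →+* ℂ) := inferInstance
    refine IsTotallyComplex.complexEmbedding_not_isReal (φ.comp (algebraMap 𝒦 F)) ?_
    rw [ComplexEmbedding.isReal_iff]
    ext y
    obtain ⟨a, b, rfl⟩ := hspan y
    have hr : (starRingEnd ℂ) (φ z) = φ z := by
      rw [← IsCMField.complexEmbedding_complexConj, ← hw, ← h]
    simp [ComplexEmbedding.conjugate_coe_eq, Algebra.smul_def, map_add, map_mul, ← hz, hr]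
  have hs : z + w = algebraMap ℚ F s := by
    have : (z - w) * (z + w - algebraMap ℚ F s) = 0 := by linear_combination e1 - e2
    rcases mul_eq_zero.1 this with h | h
    · exact absurd (sub_eq_zero.1 h) hne
    · exact sub_eq_zero.1 h
  refine ⟨x, s, -p, hspan, hs, ?_⟩
  rw [map_neg]
  linear_combination z * hs - e1

/-- The norm of an element of `𝒦_ℓ` is in `ℚ_ℓ`. -/
lemma exists_locNorm (c : LocField ℓ 𝒦) : ∃ q : ℚ_[ℓ],
    locEmb ℓ F 𝒦 c * locConj ℓ F (locEmb ℓ F 𝒦 c) = algebraMap ℚ_[ℓ] (LocField ℓ F) q := by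
  obtain ⟨x, s, p, hspan, hs, hp⟩ := exists_quadratic_generator F 𝒦
  have hc : ∃ a b : ℚ_[ℓ], c = algebraMap ℚ_[ℓ] (LocField ℓ 𝒦) a
      + algebraMap ℚ_[ℓ] (LocField ℓ 𝒦) b * toLoc ℓ 𝒦 x := by
    induction c using LocField.induction with
    | h q y =>
      obtain ⟨u, v, rfl⟩ := hspan y
      refine ⟨q * algebraMap ℚ ℚ_[ℓ] u, q * algebraMap ℚ ℚ_[ℓ] v, ?_⟩
      rw [map_add, Algebra.smul_def, Algebra.smul_def, map_mul, map_mul, toLoc_rat, toLoc_rat,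
        map_mul, map_mul, map_one]
      ring
    | hadd c d hc hd =>
      obtain ⟨a, b, rfl⟩ := hc
      obtain ⟨a', b', rfl⟩ := hd
      exact ⟨a + a', b + b', by rw [map_add, map_add]; ring⟩
  obtain ⟨a, b, rfl⟩ := hc
  refine ⟨a * a + a * b * algebraMap ℚ ℚ_[ℓ] s + b * b * algebraMap ℚ ℚ_[ℓ] p, ?_⟩
  have hs' := congrArg (toLoc ℓ F) hs
  have hp' := congrArg (toLoc ℓ F) hp
  rw [map_add, toLoc_rat] at hs'
  rw [map_mul, toLoc_rat] at hp'
  simp only [map_add, map_mul, AlgHom.commutes, locEmb_toLoc, locConj_toLoc]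
  rw [← hs', ← hp']
  ring

/-- The norm map `T(𝒦_ℓ) → T(ℚ_ℓ)`, `t ↦ t * σ t`, of the diagonal torus `T` of `GU`. Here
`T(𝒦_ℓ)` is identified with the diagonal torus of `G⁺(ℚ_ℓ) = GU(𝒦_ℓ)` in such a way that the
nontrivial automorphism `σ` of `𝒦` sends `(c, a)` to `(conj c, conj c * (a†)⁻¹)`. So
`(c, a)` is sent to `conj c * a * (a†)⁻¹`, with similitude factor `c * conj c`. -/
def torusNorm : GPlusTorus ℓ n F 𝒦 →* GUtorus ℓ n F where
  toFun t := ⟨fun i => Units.map (locConj ℓ F).toRingHom.toMonoidHom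
      (Units.map (locEmb ℓ F 𝒦).toRingHom.toMonoidHom t.1) * t.2 i
      * (Units.map (locConj ℓ F).toRingHom.toMonoidHom (t.2 i.rev))⁻¹, by
    obtain ⟨c, a⟩ := t
    obtain ⟨q, hq⟩ := exists_locNorm ℓ F 𝒦 (c : LocField ℓ 𝒦)
    obtain ⟨q', hq'⟩ := exists_locNorm ℓ F 𝒦 ((c⁻¹ : (LocField ℓ 𝒦)ˣ) : LocField ℓ 𝒦)
    have hqq : q * q' = 1 := by
      apply (algebraMap ℚ_[ℓ] (LocField ℓ F)).injective
      rw [map_mul, ← hq, ← hq', mul_mul_mul_comm, ← map_mul, ← map_mul, ← map_mul, Units.mul_inv]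
      simp
    refine ⟨⟨q, q', hqq, by rw [mul_comm, hqq]⟩, fun i => ?_⟩
    have h1 : (a i : LocField ℓ F) * (((a i)⁻¹ : (LocField ℓ F)ˣ) : LocField ℓ F) = 1 := Units.mul_inv _
    have h2 : locConj ℓ F (((a i.rev)⁻¹ : (LocField ℓ F)ˣ) : LocField ℓ F)
        * locConj ℓ F (a i.rev : LocField ℓ F) = 1 := by
      rw [← map_mul, Units.inv_mul, map_one]
    simp only [Units.val_mul, Units.coe_map, ← map_inv, Fin.rev_rev]
    simp only [AlgHom.toRingHom_eq_coe, RingHom.toMonoidHom_eq_coe, MonoidHom.coe_coe,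
      RingHom.coe_coe, map_mul, locConj_locConj, ← hq]
    linear_combination
      locEmb ℓ F 𝒦 (c : LocField ℓ 𝒦) * locConj ℓ F (locEmb ℓ F 𝒦 (c : LocField ℓ 𝒦)) * (h1
        + (a i : LocField ℓ F) * (((a i)⁻¹ : (LocField ℓ F)ˣ) : LocField ℓ F) * h2)⟩
  map_one' := by ext i; simp
  map_mul' t u := by
    ext i
    simp only [Prod.fst_mul, Prod.snd_mul, map_mul, Pi.mul_apply, mul_inv, Subgroup.coe_mul,
      Units.val_mul]
    ring

lemma torusNorm_mem : (GPlusInt ℓ n F 𝒦).comap (GPlusDiag ℓ n F 𝒦)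
    ≤ ((GUint ℓ n F).comap (GUdiag ℓ n F)).comap (torusNorm ℓ n F 𝒦) := by
  rintro ⟨c, a⟩ ⟨hc, ha⟩
  have ha' := mem_of_diagUnits_mem ℓ n F ha
  refine diagUnits_mem ℓ n F fun i => ⟨?_, ?_⟩
  · exact Subalgebra.mul_mem _ (Subalgebra.mul_mem _
      (locMap_mem ℓ _ (locMap_mem ℓ _ hc.1)) (ha' i).1) (locMap_mem ℓ _ (ha' i.rev).2)
  · have e : ((torusNorm ℓ n F 𝒦 (c, a)).1 i)⁻¹
        = Units.map (locConj ℓ F).toRingHom.toMonoidHom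
            (Units.map (locEmb ℓ F 𝒦).toRingHom.toMonoidHom c⁻¹) * (a i)⁻¹
          * Units.map (locConj ℓ F).toRingHom.toMonoidHom (a i.rev) := by
      change (_ * _ * _)⁻¹ = _
      rw [mul_inv, mul_inv, inv_inv, map_inv, map_inv]
    change (((torusNorm ℓ n F 𝒦 (c, a)).1 i)⁻¹).val ∈ _
    rw [e]
    exact Subalgebra.mul_mem _ (Subalgebra.mul_mem _
      (locMap_mem ℓ _ (locMap_mem ℓ _ hc.2)) (ha' i).2) (locMap_mem ℓ _ (ha' i.rev).1)

/-- The map induced by `torusNorm` on cocharacters. -/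
def cocharNorm : CocharLattice (GPlusInt ℓ n F 𝒦) (GPlusDiag ℓ n F 𝒦) →*
    CocharLattice (GUint ℓ n F) (GUdiag ℓ n F) :=
  QuotientGroup.map _ _ (torusNorm ℓ n F 𝒦) (torusNorm_mem ℓ n F 𝒦)

/-- The base change morphism on unramified Hecke algebras is characterised by the property that the
Satake transform turns it into the morphism of group algebras that is induced by the norm map of
tori; equivalently, it is dual to the base change of unramified representations, an unramified
character of the torus `T(ℚ_ℓ)` being lifted to `T(𝒦_ℓ)` by composition with the norm. -/
structure IsBaseChange
    (B : heckeAlgebra (GPlusInt ℓ n F 𝒦) →ₗ[ℂ] heckeAlgebra (GUint ℓ n F)) : Prop where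
  map_unit : B (heckeUnit _) = heckeUnit _
  satake_eq : ∀ f, satakeGU ℓ n F (B f)
    = MonoidAlgebra.mapDomain (cocharNorm ℓ n F 𝒦) (satakePlus ℓ n F 𝒦 f)

/-- The linear map `f ↦ f(1) • 𝟙_K`. -/
def trivialChange : heckeAlgebra (GPlusInt ℓ n F 𝒦) →ₗ[ℂ] heckeAlgebra (GUint ℓ n F) where
  toFun f := f.1 1 • heckeUnit _
  map_add' f g := by rw [← add_smul]; rfl
  map_smul' c f := by rw [RingHom.id_apply, smul_smul]; rfl

open Classical in
/-- The base change morphism `BC : ℋ(G⁺(ℚ_ℓ) // G⁺(ℤ_ℓ)) → ℋ(GU // GUint)`. For a prime `ℓ` that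
is unramified in `F` there is exactly one map as in `IsBaseChange`, by the Satake isomorphism, and
this is it; the other branch only gives a value at the ramified primes, where it is not used. -/
def baseChange : heckeAlgebra (GPlusInt ℓ n F 𝒦) →ₗ[ℂ] heckeAlgebra (GUint ℓ n F) :=
  if h : ∃ B, IsBaseChange ℓ n F 𝒦 B then h.choose else trivialChange ℓ n F 𝒦

/-- The local component at `ℓ` of `T_{r,m}`, on the group `GU`: the base change of that of
`T_{r,m}^+`. -/
def heckeLocal (r m : ℕ) : heckeAlgebra (GUint ℓ n F) :=
  baseChange ℓ n F 𝒦 (heckePlus ℓ n F 𝒦 r m)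

end BaseChange

/-! ### The group `G` of unitary similitudes of `D` and its Hecke operators -/

section Global

section LocAlg

variable (ℓ : ℕ) [Fact ℓ.Prime] (D : Type*) [Ring D] [Algebra ℚ D]

/-- The `ℚ_ℓ`-algebra `D_ℓ = ℚ_ℓ ⊗ D`. -/
def LocAlg : Type _ := ℚ_[ℓ] ⊗[ℚ] D

instance : Ring (LocAlg ℓ D) := inferInstanceAs (Ring (ℚ_[ℓ] ⊗[ℚ] D))

instance : Algebra ℚ_[ℓ] (LocAlg ℓ D) := inferInstanceAs (Algebra ℚ_[ℓ] (ℚ_[ℓ] ⊗[ℚ] D))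

instance : Module ℤ_[ℓ] (LocAlg ℓ D) := inferInstanceAs (Module ℤ_[ℓ] (ℚ_[ℓ] ⊗[ℚ] D))

instance : TopologicalSpace (LocAlg ℓ D) := moduleTopology ℚ_[ℓ] (LocAlg ℓ D)

/-- The map `D → D_ℓ`. -/
def toLocAlg : D →+* LocAlg ℓ D :=
  (Algebra.TensorProduct.includeRight : D →ₐ[ℚ] ℚ_[ℓ] ⊗[ℚ] D).toRingHom

variable [StarRing D]

/-- The `ℚ_ℓ`-linear extension to `D_ℓ` of the involution of `D`. -/
def locStar : LocAlg ℓ D →ₐ[ℚ_[ℓ]] (LocAlg ℓ D)ᵐᵒᵖ :=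
  (Algebra.TensorProduct.lift (Algebra.ofId ℚ_[ℓ] (ℚ_[ℓ] ⊗[ℚ] D)ᵐᵒᵖ)
    ((AlgHom.op (Algebra.TensorProduct.includeRight : D →ₐ[ℚ] ℚ_[ℓ] ⊗[ℚ] D)).comp
      (starRingEquiv : D ≃+* Dᵐᵒᵖ).toRingHom.toRatAlgHom)
    (fun a _ => Algebra.commutes a _) : ℚ_[ℓ] ⊗[ℚ] D →ₐ[ℚ_[ℓ]] (ℚ_[ℓ] ⊗[ℚ] D)ᵐᵒᵖ)

lemma locStar_toLocAlg (d : D) :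
    (locStar ℓ D (toLocAlg ℓ D d)).unop = toLocAlg ℓ D (star d) := by
  have h := Algebra.TensorProduct.lift_tmul (Algebra.ofId ℚ_[ℓ] (ℚ_[ℓ] ⊗[ℚ] D)ᵐᵒᵖ)
    ((AlgHom.op (Algebra.TensorProduct.includeRight : D →ₐ[ℚ] ℚ_[ℓ] ⊗[ℚ] D)).comp
      (starRingEquiv : D ≃+* Dᵐᵒᵖ).toRingHom.toRatAlgHom)
    (fun a _ => Algebra.commutes a _) 1 d
  rw [map_one, one_mul] at h
  exact congrArg MulOpposite.unop h

/-- The group `G(ℚ_ℓ)`, of the `g ∈ D_ℓˣ` with `g g* ∈ ℚ_ℓˣ`. -/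
def GLoc : Subgroup (LocAlg ℓ D)ˣ := similitudes (locStar ℓ D)

/-- The `ℤ_ℓ`-lattice in `D_ℓ` spanned by a fixed `ℚ`-basis of `D`. -/
def baseLattice : Submodule ℤ_[ℓ] (LocAlg ℓ D) :=
  Submodule.span ℤ_[ℓ] (Set.range fun i => toLocAlg ℓ D (Module.Basis.ofVectorSpace ℚ D i))

/-- The stabiliser of the lattice `baseLattice` in `G(ℚ_ℓ)`. -/
def GLocInt : Subgroup (GLoc ℓ D) where
  carrier := {g | ∀ x ∈ baseLattice ℓ D, (g.1 : LocAlg ℓ D) * x ∈ baseLattice ℓ D ∧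
    ((g.1⁻¹ : (LocAlg ℓ D)ˣ) : LocAlg ℓ D) * x ∈ baseLattice ℓ D}
  one_mem' := fun x hx => by simpa using hx
  mul_mem' := by
    intro g h hg hh x hx
    constructor
    · simpa [mul_assoc] using (hg _ (hh x hx).1).1
    · simpa [mul_assoc] using (hh _ (hg x hx).2).2
  inv_mem' := by
    intro g hg x hx
    exact ⟨(hg x hx).2, by simpa using (hg x hx).1⟩

end LocAlg

variable (F : Type*) [Field F] [NumberField F] [IsCMField F]
variable (D : Type*) [Ring D] [Algebra F D] [Algebra ℚ D] [StarRing D]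

open scoped RestrictedProduct in
/-- The group `G(𝔸_f)` of finite adelic points of `G`, as the restricted product of the `G(ℚ_ℓ)`
with respect to the stabilisers of the lattices spanned by a `ℚ`-basis of `D` (which basis does not
matter), with its restricted product topology. -/
abbrev GAdelic : Type _ := Πʳ ℓ : Nat.Primes, [GLoc (ℓ : ℕ) D, GLocInt (ℓ : ℕ) D]

/-- A level of the form `K = K_S K^S`, with `K^S` hyperspecial.

Outside the finite set `S` the field `F` is unramified, the algebra `D` splits and its involution
becomes the one of the quasi-split group `GU`, and `K_ℓ ⊆ G(ℚ_ℓ)` corresponds to the standard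
hyperspecial subgroup under an isomorphism `e` of algebras with involution. All hyperspecial
subgroups of `G(ℚ_ℓ)` arise in this way, because they are conjugate under the adjoint group. -/
structure LevelDatum (n : ℕ) where
  /-- The set of bad primes. -/
  S : Finset Nat.Primes
  /-- The subgroup `K_S` of `G(𝔸_{f,S})`. -/
  KS : Subgroup (∀ ℓ : S, GLoc (ℓ.1 : ℕ) D)
  /-- The prime `ℓ ∉ S` is unramified in `F`. -/
  unramified : ∀ ℓ ∉ S, Squarefree (Ideal.span {((ℓ : ℕ) : 𝓞 F)})
  /-- The isomorphism of `D_ℓ` with `M_n(F_ℓ)`. -/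
  e : ∀ ℓ : Nat.Primes, ℓ ∉ S →
    LocAlg (ℓ : ℕ) D ≃ₐ[ℚ_[(ℓ : ℕ)]] Matrix (Fin n) (Fin n) (LocField (ℓ : ℕ) F)
  /-- The isomorphism is linear over `F_ℓ`. -/
  e_center : ∀ ℓ (hℓ : ℓ ∉ S) (x : F), e ℓ hℓ (toLocAlg (ℓ : ℕ) D (algebraMap F D x))
    = Matrix.scalar (Fin n) (toLoc (ℓ : ℕ) F x)
  /-- The isomorphism is compatible with the involutions. -/
  e_star : ∀ ℓ (hℓ : ℓ ∉ S) (x : LocAlg (ℓ : ℕ) D),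
    e ℓ hℓ (locStar (ℓ : ℕ) D x).unop = (dagger (ℓ : ℕ) n F (e ℓ hℓ x)).unop

namespace LevelDatum

variable {F D} {n : ℕ} (L : LevelDatum F D n)

/-- The isomorphism `G(ℚ_ℓ) → GU` at a prime `ℓ ∉ S`. -/
def toGU (ℓ : Nat.Primes) (hℓ : ℓ ∉ L.S) : GLoc (ℓ : ℕ) D →* GU (ℓ : ℕ) n F :=
  ((Units.map (L.e ℓ hℓ).toRingEquiv.toRingHom.toMonoidHom).comp
    (GLoc (ℓ : ℕ) D).subtype).codRestrict (GU (ℓ : ℕ) n F) (by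
      rintro ⟨g, c, hc⟩
      refine ⟨c, ?_⟩
      have := congrArg (L.e ℓ hℓ) hc
      rw [map_mul, L.e_star, AlgEquiv.commutes] at this
      exact this)

/-- The hyperspecial subgroup `K_ℓ` of `G(ℚ_ℓ)` at a prime `ℓ ∉ S`. -/
def KLoc (ℓ : Nat.Primes) (hℓ : ℓ ∉ L.S) : Subgroup (GLoc (ℓ : ℕ) D) :=
  (GUint (ℓ : ℕ) n F).comap (L.toGU ℓ hℓ)

/-- The subgroup `K = K_S K^S` of `G(𝔸_f)`, where `K^S` is the product of the `K_ℓ`. -/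
def K : Subgroup (GAdelic D) where
  carrier := {g | (fun ℓ : L.S => g ℓ.1) ∈ L.KS ∧ ∀ ℓ (hℓ : ℓ ∉ L.S), g ℓ ∈ L.KLoc ℓ hℓ}
  one_mem' := ⟨L.KS.one_mem, fun ℓ hℓ => (L.KLoc ℓ hℓ).one_mem⟩
  mul_mem' := fun hg hh => ⟨L.KS.mul_mem hg.1 hh.1,
    fun ℓ hℓ => (L.KLoc ℓ hℓ).mul_mem (hg.2 ℓ hℓ) (hh.2 ℓ hℓ)⟩
  inv_mem' := fun hg => ⟨L.KS.inv_mem hg.1, fun ℓ hℓ => (L.KLoc ℓ hℓ).inv_mem (hg.2 ℓ hℓ)⟩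

variable (𝒦 : Type*) [Field 𝒦] [NumberField 𝒦] [Algebra 𝒦 F] [IsTotallyComplex 𝒦]
  [Algebra.IsQuadraticExtension ℚ 𝒦]

open Classical in
/-- The Hecke operator `T_{r,m} = 𝟙_{K_S} ⊗ ⨂_{ℓ ∉ S} T_{r,m,ℓ}`, a function on `G(𝔸_f)`. -/
def hecke (r m : ℕ) (g : GAdelic D) : ℂ :=
  (if (fun ℓ : L.S => g ℓ.1) ∈ L.KS then 1 else 0) *
    ∏ᶠ ℓ : {ℓ : Nat.Primes // ℓ ∉ L.S},
      (heckeLocal (ℓ.1 : ℕ) n F 𝒦 r m).1 (L.toGU ℓ.1 ℓ.2 (g ℓ.1))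

/-- The degree of `T_{r,m}`. -/
def deg (r m : ℕ) : ℂ := heckeDegree L.K (L.hecke 𝒦 r m)

/-- The norm `N(T_{r,m})`: the product over the `ℓ ∉ S` of the sums of the absolute values of the
coefficients of the Satake transforms of the local components of `T_{r,m}`. -/
def norm (r m : ℕ) : ℝ :=
  ∏ᶠ ℓ : {ℓ : Nat.Primes // ℓ ∉ L.S},
    coeffNorm (satakeGU (ℓ.1 : ℕ) n F (heckeLocal (ℓ.1 : ℕ) n F 𝒦 r m))

end LevelDatum

end Global

end Equidist

namespace Equidist

/-! ### Unramified orders and lattices -/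

/-! Write d = [F : ℚ]. The components of the Hecke operator at the primes outside S that do not
divide m are units of the Hecke algebra, so degree and norm are finite products over the primes ℓ ∉
S dividing m (`LevelDatum.deg_eq`, `LevelDatum.norm_eq`). The heart of the matter is the local bound
`coeffNorm_satakeGU_heckeLocal_le`: norm ≤ 2^(dn) ℓ^(-d r(n-r)/2) · |degree|. Multiplying over ℓ,
the factors 2^(dn) give a constant to the power ω(m), which is at most m^ε for large square-free m,
and the primes of S dividing m cost only a constant.

The local bound is moved from `GU` to `GPlus`. By the Iwasawa decomposition G = T N K, the degree of
f is its Satake transform evaluated at δ^(-1/2) (`IsIwasawa.heckeDegree_eq`). The torus norm pulls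
the modulus of `GU` back to that of `GPlus` (`GUmodulus_torusNorm`), so base change preserves
degrees. Pushing coefficients forward along a map of lattices cannot increase the sum of their
absolute values (`coeffNorm_mapDomain_le`). The Satake isomorphism itself plays no role.

On `GPlus` the degree is the number of left cosets in the double coset, and unipotent block matrices
already give ℓ^(d r(n-r)) of them (`le_ncard_doubleCosetSet`). The Satake coefficient at t is
δ(t)^(1/2) times the number of classes u in N / (N ∩ K) with t u in the double coset. If there is
any, then the entries of t divide ℓ, so up to units they are given by idempotents ε_i of the reduced
d-dimensional algebra F_ℓ (ℓ where ε_i = 1, and 1 elsewhere). There are at most 2^d idempotents,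
hence at most 2^(dn) such t. Put D_ij = |N(`idemPow` ℓ (ε_i(1-ε_j)))|. A Hermite normal form shows
that the number of u is at most the product of the D_ij⁻¹ over i < j, while δ(t) is the product of
the D_ij / D_ji over i < j. So the square of the coefficient is at most the product of the D_ij⁻¹
over i ≠ j. Exactly r of the ε_i are one at each place, so this product is ℓ^(d r(n-r))
(`sqrt_modulus_mul_ncard_le`).

F_ℓ is a product of fields, but it is never decomposed: idempotents of the order R = ℤ_ℓ ⊗ 𝓞 F,
lifted by Hensel's lemma from the finite reduced ring R / ℓ, stand in for sets of places. The
Iwasawa decomposition of `GU` is deduced from that of GL_n: if g = b k with b triangular, then k k*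
is hermitian and triangular, and it has to be factored as β β* with β triangular and integral. This
needs an element of R of trace one, which exists because ℓ is unramified. -/

/-- A subring `R` of `A` that behaves like a finite product of discrete valuation rings with common
uniformiser `π` in the product `A` of their fraction fields. -/
structure IsUnramifiedOrder {A : Type*} [CommRing A] (R : Subring A) (π : A) : Prop where
  mem : π ∈ R
  isUnit : IsUnit π
  exists_pow_mul_mem : ∀ a : A, ∃ k : ℕ, π ^ k * a ∈ R
  isNoetherianRing : IsNoetherianRing R
  exists_idem : ∀ x ∈ R, ∃ e ∈ R, e * e = e ∧ (∃ y ∈ R, y * (x * e + (1 - e)) = 1) ∧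
    ∃ z ∈ R, (1 - e) * x = π * z
  idem_eq_zero : ∀ e : A, e * e = e → ∀ z ∈ R, e = π * z → e = 0

/-- The group of invertible matrices over a subring. -/
def glSub {A : Type*} [CommRing A] (R : Subring A) (n : ℕ) : Subgroup (Matrix (Fin n) (Fin n) A)ˣ :=
  (Subring.matrix (n := Fin n) R).toSubmonoid.units

namespace IsUnramifiedOrder

variable {A : Type*} [CommRing A] {R : Subring A} {π : A} (h : IsUnramifiedOrder R π)
include h

lemma pow_mem (k : ℕ) : π ^ k ∈ R := R.pow_mem h.mem k

lemma exists_pow_mul_mem_of_finite {ι : Type*} [Finite ι] (a : ι → A) :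
    ∃ k : ℕ, ∀ i, π ^ k * a i ∈ R := by
  classical
  have := Fintype.ofFinite ι
  choose k hk using fun i => h.exists_pow_mul_mem (a i)
  refine ⟨∑ i, k i, fun i => ?_⟩
  rw [← Finset.sum_erase_add _ _ (Finset.mem_univ i), pow_add, mul_assoc]
  exact R.mul_mem (h.pow_mem _) (hk i)

/-- Bounded `R`-submodules of `A` that contain a unit of `A` are principal. -/
theorem exists_generator (I : Submodule R A) (k : ℕ) (hk : ∀ x ∈ I, π ^ k * x ∈ R)
    (u : Aˣ) (hu : (u : A) ∈ I) :
    ∃ c : Aˣ, (c : A) ∈ I ∧ ∀ x ∈ I, ∃ s ∈ R, x = s * c := by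
  classical
  have := h.isNoetherianRing
  have hN : IsNoetherian R I := by
    obtain ⟨p, hp⟩ := h.isUnit
    have hle : I ≤ Submodule.span R {((p⁻¹ ^ k : Aˣ) : A)} := by
      intro x hx
      refine Submodule.mem_span_singleton.2 ⟨⟨_, hk x hx⟩, ?_⟩
      change π ^ k * x * ((p⁻¹ ^ k : Aˣ) : A) = x
      rw [← hp, mul_right_comm, ← Units.val_pow_eq_pow_val, ← Units.val_mul, ← mul_pow]
      simp
    have : IsNoetherian R (Submodule.span R {((p⁻¹ ^ k : Aˣ) : A)}) :=
      isNoetherian_of_fg_of_noetherian _ (Submodule.fg_span_singleton _)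
    exact isNoetherian_of_le hle
  -- `I` lies in π^(-k) R and so is Noetherian. The generator is a unit `c` of `A` with `R c`
  -- maximal among the submodules of this kind; `u` shows that there are some.
  obtain ⟨N, ⟨c, hcI, rfl⟩, hmax⟩ := set_has_maximal_iff_noetherian.2 hN
    {N : Submodule R I | ∃ c : Aˣ, ∃ hc : (c : A) ∈ I, N = Submodule.span R {⟨(c : A), hc⟩}}
    ⟨_, u, hu, rfl⟩
  refine ⟨c, hcI, fun x hx => ?_⟩
  by_contra hxc
  set z := x * ((c⁻¹ : Aˣ) : A) with hz
  have hzc : z * c = x := by rw [hz, mul_assoc, Units.inv_mul, mul_one]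
  have hzR : z ∉ R := fun hzR => hxc ⟨z, hzR, hzc.symm⟩
  have hex := h.exists_pow_mul_mem z
  -- The least exponent that clears the denominators of `z` is j + 1 > 0. The idempotent `e`
  -- obtained below is the part where this order is attained; it is nonzero by minimality.
  obtain ⟨j, hj⟩ : ∃ j, Nat.find hex = j + 1 := by
    refine Nat.exists_eq_succ_of_ne_zero fun h0 => hzR ?_
    have := Nat.find_spec hex
    rwa [h0, pow_zero, one_mul] at this
  have hj1 : π ^ (j + 1) * z ∈ R := hj ▸ Nat.find_spec hex
  have hj0 : π ^ j * z ∉ R := Nat.find_min hex (by omega)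
  obtain ⟨e, heR, hee, ⟨y', hy'R, hy'⟩, w, hwR, hw⟩ := h.exists_idem _ hj1
  have he0 : e ≠ 0 := by
    rintro rfl
    apply hj0
    have : π ^ j * z = w := h.isUnit.mul_left_cancel (by rw [← hw]; ring)
    rwa [this]
  -- `s * c` is `x` on the part `e` and `c` on the rest, so it is in `I`. Its multiplier `s` has its
  -- inverse in `R`, so maximality of `R c` forces `s ∈ R`. Then `z` is integral on `e`, against the
  -- choice of `e`.
  set s := e * z + (1 - e) with hs
  have hsu : s * ((π ^ (j + 1) * e + (1 - e)) * y') = 1 := by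
    linear_combination hy' + y' * (1 - z - π ^ (j + 1) + z * π ^ (j + 1)) * hee
  let s' : Aˣ := ⟨s, (π ^ (j + 1) * e + (1 - e)) * y', hsu, by rw [mul_comm, hsu]⟩
  have hc' : ((s' * c : Aˣ) : A) ∈ I := by
    have e1 : ((s' * c : Aˣ) : A) = (⟨e, heR⟩ : R) • x + (⟨1 - e, R.sub_mem R.one_mem heR⟩ : R) • (c : A) := by
      change s * c = e * x + (1 - e) * c
      rw [← hzc, hs]; ring
    rw [e1]
    exact I.add_mem (I.smul_mem _ hx) (I.smul_mem _ hcI)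
  have hle : Submodule.span R {(⟨(c : A), hcI⟩ : I)} ≤ Submodule.span R {⟨_, hc'⟩} := by
    rw [Submodule.span_singleton_le_iff_mem]
    refine Submodule.mem_span_singleton.2 ⟨⟨(π ^ (j + 1) * e + (1 - e)) * y',
      R.mul_mem (R.add_mem (R.mul_mem (h.pow_mem _) heR) (R.sub_mem R.one_mem heR)) hy'R⟩, ?_⟩
    apply Subtype.ext
    change (π ^ (j + 1) * e + (1 - e)) * y' * (s * c) = c
    rw [← mul_assoc, mul_comm _ s, hsu, one_mul]
  have heq := eq_of_le_of_not_lt hle (hmax _ ⟨_, hc', rfl⟩)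
  have hmem : (⟨_, hc'⟩ : I) ∈ Submodule.span R {(⟨(c : A), hcI⟩ : I)} := by
    rw [heq]; exact Submodule.mem_span_singleton_self _
  obtain ⟨t, ht⟩ := Submodule.mem_span_singleton.1 hmem
  have ht' : (t : A) * c = s * c := congrArg Subtype.val ht
  have hst : s ∈ R := by
    have := c.isUnit.mul_right_cancel ht'
    exact this ▸ t.2
  have hez : e * z ∈ R := by
    have : e * z = s - (1 - e) := by rw [hs]; ring
    rw [this]; exact R.sub_mem hst (R.sub_mem R.one_mem heR)
  refine he0 (h.idem_eq_zero e hee (y' * (π ^ j * (e * z))) (R.mul_mem hy'R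
    (R.mul_mem (h.pow_mem _) hez)) ?_)
  linear_combination (-e) * hy' + (y' * π ^ (j + 1) * z - y') * hee

variable {n : ℕ}

/-- Iwasawa decomposition for `GL_n`. -/
theorem exists_iwasawa (g : (Matrix (Fin n) (Fin n) A)ˣ) :
    ∃ b : (Matrix (Fin n) (Fin n) A)ˣ, (∀ i j, j < i → b.val i j = 0) ∧ ∃ k ∈ glSub R n, g = b * k := by
  classical
  -- The lattice g Rⁿ, to be intersected with the standard flag `V`. Lifting a generator of each
  -- graded piece `I i` gives a triangular basis of the lattice, whose matrix is `b`.
  let Λ : Submodule R (Fin n → A) :=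
    { carrier := {x | ∀ i, (g⁻¹.val.mulVec x) i ∈ R}
      zero_mem' := fun i => by simp
      add_mem' := fun hx hy i => by rw [Matrix.mulVec_add]; exact R.add_mem (hx i) (hy i)
      smul_mem' := fun c x hx i => by
        have : c • x = (c : A) • x := rfl
        rw [this, Matrix.mulVec_smul]; exact R.mul_mem c.2 (hx i) }
  have hΛ : ∀ x, x ∈ Λ ↔ ∀ i, (g⁻¹.val.mulVec x) i ∈ R := fun x => Iff.rfl
  let V (i : Fin n) : Submodule R (Fin n → A) :=
    { carrier := {x | ∀ j, i < j → x j = 0}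
      zero_mem' := fun _ _ => rfl
      add_mem' := fun hx hy j hj => by simp [hx j hj, hy j hj]
      smul_mem' := fun c x hx j hj => by simp [hx j hj] }
  let I (i : Fin n) : Submodule R A := (Λ ⊓ V i).map (LinearMap.proj i)
  obtain ⟨k₁, hk₁⟩ := h.exists_pow_mul_mem_of_finite (fun p : Fin n × Fin n => g.val p.1 p.2)
  obtain ⟨k₂, hk₂⟩ := h.exists_pow_mul_mem_of_finite (fun p : Fin n × Fin n => g⁻¹.val p.1 p.2)
  have hbd : ∀ i, ∀ x ∈ I i, π ^ k₁ * x ∈ R := by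
    rintro i _ ⟨x, ⟨hx, -⟩, rfl⟩
    have : x = g.val.mulVec (g⁻¹.val.mulVec x) := by rw [Matrix.mulVec_mulVec, Units.mul_inv, Matrix.one_mulVec]
    rw [LinearMap.proj_apply, this, Matrix.mulVec, dotProduct, Finset.mul_sum]
    refine R.sum_mem fun j _ => ?_
    rw [← mul_assoc]
    exact R.mul_mem (hk₁ (i, j)) (hx j)
  obtain ⟨p, hp⟩ := h.isUnit
  have hone : ∀ i, ((p ^ k₂ : Aˣ) : A) ∈ I i := by
    intro i
    refine ⟨Pi.single i (π ^ k₂), ⟨fun j => ?_, fun j hj => Pi.single_eq_of_ne hj.ne' _⟩, ?_⟩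
    · have : (g⁻¹.val.mulVec (Pi.single i (π ^ k₂))) j = π ^ k₂ * g⁻¹.val j i := by
        simp [mul_comm]
      rw [this]
      exact hk₂ (j, i)
    · simp [hp]
  choose c hcI hc using fun i => h.exists_generator (I i) k₁ (hbd i) (p ^ k₂) (hone i)
  choose x hx hxc using hcI
  let B : Matrix (Fin n) (Fin n) A := Matrix.of fun i j => x j i
  have hBtri : B.BlockTriangular id := fun i j hij => (hx j).2 i hij
  have hBdiag : ∀ i, B i i = c i := hxc
  have hBdet : IsUnit B := by
    rw [Matrix.isUnit_iff_isUnit_det, Matrix.det_of_isUpperTriangular hBtri]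
    simp only [hBdiag, ← Units.coe_prod]
    exact Units.isUnit _
  obtain ⟨b, hb⟩ := hBdet
  refine ⟨b, fun i j hij => by rw [hb]; exact hBtri hij, b⁻¹ * g, ?_, by group⟩
  -- Coordinates in the new basis are integral: kill the last possibly nonzero entry of `v` with a
  -- multiple of the corresponding basis vector, and go on by induction.
  have hmem : ∀ i : ℕ, ∀ v ∈ Λ, (∀ j : Fin n, i ≤ j → v j = 0) → ∀ j, (b⁻¹.val.mulVec v) j ∈ R := by
    intro i
    induction i with
    | zero =>
      intro v _ hv j
      have : v = 0 := funext fun j => hv j (Nat.zero_le _)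
      rw [this, Matrix.mulVec_zero]; exact R.zero_mem
    | succ i ih =>
      intro v hvΛ hv j
      by_cases hin : i < n
      · obtain ⟨s, hsR, hs⟩ := hc ⟨i, hin⟩ (v ⟨i, hin⟩) ⟨v, ⟨hvΛ, fun j hj => hv j hj⟩, rfl⟩
        have h1 : v - s • x ⟨i, hin⟩ ∈ Λ := Λ.sub_mem hvΛ (Λ.smul_mem ⟨s, hsR⟩ (hx _).1)
        have h2 := ih _ h1 (by
          intro j hj
          rcases hj.eq_or_lt with hj | hj
          · have : j = ⟨i, hin⟩ := Fin.ext hj.symm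
            subst this
            rw [Pi.sub_apply, Pi.smul_apply, hs, smul_eq_mul]
            have := hxc ⟨i, hin⟩
            rw [LinearMap.proj_apply] at this
            rw [this, sub_self]
          · rw [Pi.sub_apply, Pi.smul_apply, hv j hj, (hx ⟨i, hin⟩).2 j hj, smul_zero, sub_zero]) j
        have h3 : b.val.mulVec (Pi.single ⟨i, hin⟩ s) = s • x ⟨i, hin⟩ := by
          rw [hb]; ext l; simp [Matrix.mulVec_single, B, mul_comm]
        have h4 : b⁻¹.val.mulVec v = b⁻¹.val.mulVec (v - s • x ⟨i, hin⟩) + Pi.single ⟨i, hin⟩ s := by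
          rw [← h3, Matrix.mulVec_sub, Matrix.mulVec_mulVec, Units.inv_mul, Matrix.one_mulVec, sub_add_cancel]
        rw [h4, Pi.add_apply]
        refine R.add_mem h2 ?_
        by_cases hji : j = ⟨i, hin⟩
        · rw [hji, Pi.single_eq_same]; exact hsR
        · rw [Pi.single_eq_of_ne hji]; exact R.zero_mem
      · exact ih v hvΛ (fun j hj => absurd j.2 (by omega)) j
  constructor
  · intro i j
    change (b⁻¹.val * g.val) i j ∈ R
    have e1 : (b⁻¹.val * g.val) i j = b⁻¹.val.mulVec (g.val.col j) i := rfl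
    rw [e1]
    refine hmem n _ (fun l => ?_) (fun l hl => absurd l.2 (by omega)) i
    have : (g⁻¹.val.mulVec (g.val.col j)) l = (g⁻¹.val * g.val) l j := rfl
    rw [this, Units.inv_mul, Matrix.one_apply]
    split_ifs
    · exact R.one_mem
    · exact R.zero_mem
  · intro i j
    have e1 : ((b⁻¹ * g)⁻¹ : (Matrix (Fin n) (Fin n) A)ˣ).val = g⁻¹.val * B := by
      rw [mul_inv_rev, inv_inv, Units.val_mul, hb]
    change ((b⁻¹ * g)⁻¹ : (Matrix (Fin n) (Fin n) A)ˣ).val i j ∈ R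
    rw [e1]
    exact (hx j).1 i

-- One factor `c` clears the denominators of `x`, the other those of its inverse.
omit h in
lemma mul_inv_sub_one_mem {x : (Matrix (Fin n) (Fin n) A)ˣ} {c : A}
    (hx : ∀ i j, c * x.val i j ∈ R) (hx' : ∀ i j, c * x⁻¹.val i j ∈ R)
    {Z : Matrix (Fin n) (Fin n) A} (hZ : ∀ i j, Z i j ∈ R) (i j : Fin n) :
    (x⁻¹.val * ((c * c) • Z) * x.val) i j ∈ R := by
  have : x⁻¹.val * ((c * c) • Z) * x.val = (c • x⁻¹.val) * Z * (c • x.val) := by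
    simp [mul_smul]
  rw [this, Matrix.mul_apply]
  refine R.sum_mem fun l _ => R.mul_mem ?_ (hx l j)
  rw [Matrix.mul_apply]
  exact R.sum_mem fun q _ => R.mul_mem (hx' i q) (hZ q l)

/-- A double coset of `GL_n(R)` contains finitely many left cosets: there is a congruence condition
on `k₁, k₂` that implies `k₁ x K = k₂ x K`. -/
lemma conj_mem_glSub (x : (Matrix (Fin n) (Fin n) A)ˣ) : ∃ c : ℕ, ∀ k₁ ∈ glSub R n, ∀ k₂ ∈ glSub R n,
    (∀ i j, ∃ z ∈ R, k₁.val i j - k₂.val i j = π ^ c * z) → x⁻¹ * (k₁⁻¹ * k₂) * x ∈ glSub R n := by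
  obtain ⟨a, ha⟩ := h.exists_pow_mul_mem_of_finite (fun p : Fin n × Fin n => x.val p.1 p.2)
  obtain ⟨a', ha'⟩ := h.exists_pow_mul_mem_of_finite (fun p : Fin n × Fin n => x⁻¹.val p.1 p.2)
  have hx : ∀ i j, π ^ (a + a') * x.val i j ∈ R := fun i j => by
    rw [pow_add, mul_right_comm]; exact R.mul_mem (ha (i, j)) (h.pow_mem _)
  have hx' : ∀ i j, π ^ (a + a') * x⁻¹.val i j ∈ R := fun i j => by
    rw [pow_add, mul_assoc]; exact R.mul_mem (h.pow_mem _) (ha' (i, j))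
  have key : ∀ k₁ ∈ glSub R n, ∀ k₂ ∈ glSub R n,
      (∀ i j, ∃ z ∈ R, k₁.val i j - k₂.val i j = π ^ (2 * (a + a')) * z) →
      ∀ i j, (x⁻¹ * (k₁⁻¹ * k₂) * x).val i j ∈ R := by
    intro k₁ hk₁ k₂ hk₂ H i j
    choose Z hZR hZ using H
    have e1 : k₂.val = k₁.val - (π ^ (a + a') * π ^ (a + a')) • Matrix.of Z := by
      ext i j
      rw [Matrix.sub_apply, Matrix.smul_apply, Matrix.of_apply, smul_eq_mul, ← pow_add, ← two_mul, ← hZ, sub_sub_cancel]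
    have e2 : (x⁻¹ * (k₁⁻¹ * k₂) * x).val = 1 - x⁻¹.val * ((π ^ (a + a') * π ^ (a + a')) •
        (k₁⁻¹.val * Matrix.of Z)) * x.val := by
      simp only [Units.val_mul, e1, mul_sub, Units.inv_mul, sub_mul, mul_one, Matrix.mul_smul]
    rw [e2, Matrix.sub_apply]
    refine R.sub_mem ?_ (mul_inv_sub_one_mem hx hx' (fun i j => ?_) i j)
    · rw [Matrix.one_apply]
      split_ifs
      · exact R.one_mem
      · exact R.zero_mem
    · rw [Matrix.mul_apply]
      exact R.sum_mem fun l _ => R.mul_mem (hk₁.2 i l) (hZR l j)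
  refine ⟨2 * (a + a'), fun k₁ hk₁ k₂ hk₂ H => ⟨key k₁ hk₁ k₂ hk₂ H, ?_⟩⟩
  have e3 : (x⁻¹ * (k₁⁻¹ * k₂) * x)⁻¹ = x⁻¹ * (k₂⁻¹ * k₁) * x := by group
  intro i j
  change (x⁻¹ * (k₁⁻¹ * k₂) * x)⁻¹.val i j ∈ R
  rw [e3]
  refine key k₂ hk₂ k₁ hk₁ (fun i j => ?_) i j
  obtain ⟨z, hz, hz'⟩ := H i j
  exact ⟨-z, R.neg_mem hz, by linear_combination -hz'⟩

end IsUnramifiedOrder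

/-! ### Elementary divisors attached to idempotents. -/

/-- The element of a product of fields that is `π` where the idempotent `e` is one, and is one
elsewhere. -/
def idemPow {A : Type*} [CommRing A] (π e : A) : A := π * e + (1 - e)

section

variable {A : Type*} [CommRing A] {R : Subring A} {π : A}

lemma idemPow_mul_idem {e : A} (he : e * e = e) : idemPow π e * e = π * e := by
  unfold idemPow; linear_combination (π - 1) * he

lemma idemPow_mul_compl {e : A} (he : e * e = e) : (1 - e) * idemPow π e = 1 - e := by
  unfold idemPow; linear_combination (1 - π) * he

/-- `e` is the orthogonal sum of `e * f` and `e * (1 - f)`, and `idemPow π` turns orthogonal sums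
into products. -/
lemma idemPow_eq_mul {e f : A} (he : e * e = e) (hf : f * f = f) :
    idemPow π e = idemPow π (e * f) * idemPow π (e * (1 - f)) := by
  unfold idemPow
  linear_combination (-(π - 1) ^ 2 * f * (1 - f)) * he + (e * (π - 1) ^ 2) * hf

lemma mul_compl_idem {e f : A} (he : e * e = e) (hf : f * f = f) :
    e * (1 - f) * (e * (1 - f)) = e * (1 - f) := by
  linear_combination (1 - f) ^ 2 * he + e * hf

/-- A matrix over `R` whose determinant is a unit of `R` is in `GL_n(R)`. -/
lemma exists_glSub {n : ℕ} {M : Matrix (Fin n) (Fin n) A} (hM : ∀ i j, M i j ∈ R) {y : A} (hy : y ∈ R)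
    (hdet : y * M.det = 1) : ∃ k ∈ glSub R n, k.val = M := by
  have h1 : M * (y • M.adjugate) = 1 := by
    rw [Matrix.mul_smul, Matrix.mul_adjugate, smul_smul, hdet, one_smul]
  have h2 : (y • M.adjugate) * M = 1 := by
    rw [Matrix.smul_mul, Matrix.adjugate_mul, smul_smul, hdet, one_smul]
  refine ⟨⟨M, y • M.adjugate, h1, h2⟩, ⟨hM, fun i j => ?_⟩, rfl⟩
  let M' : Matrix (Fin n) (Fin n) R := Matrix.of fun i j => ⟨M i j, hM i j⟩
  have : M.adjugate = R.subtype.mapMatrix M'.adjugate := by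
    rw [RingHom.map_adjugate]; rfl
  change y * M.adjugate i j ∈ R
  rw [this]
  exact R.mul_mem hy (M'.adjugate i j).2

lemma det_mem {n : ℕ} {M : Matrix (Fin n) (Fin n) A} (hM : ∀ i j, M i j ∈ R) : M.det ∈ R := by
  let M' : Matrix (Fin n) (Fin n) R := Matrix.of fun i j => ⟨M i j, hM i j⟩
  have : M.det = R.subtype M'.det := by
    rw [RingHom.map_det]; rfl
  rw [this]
  exact M'.det.2

end

namespace IsUnramifiedOrder

variable {A : Type*} [CommRing A] {R : Subring A} {π : A} (h : IsUnramifiedOrder R π)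
include h

/-- A divisor of `π` is `π` on one part of the product of fields, and one on the other part, up to
a unit. -/
lemma exists_idemPow {a c : A} (ha : a ∈ R) (hc : c ∈ R) (hac : a * c = π) :
    ∃ e ∈ R, e * e = e ∧ ∃ u ∈ R, (∃ v ∈ R, u * v = 1) ∧ a = u * idemPow π e := by
  obtain ⟨e, he, hee, ⟨y, hy, hye⟩, z, hz, hze⟩ := h.exists_idem a ha
  -- On the part `e` the element `a` is a unit. On the complement a = π z, and a c = π makes `c` the
  -- inverse of `z` there. So the exponent is `1 - e` and the unit factor is `a * e + z`.
  have hz' : (1 - e) * z = z := h.isUnit.mul_left_cancel (by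
    linear_combination e * hze + a * hee)
  have hzc : z * c = 1 - e := h.isUnit.mul_left_cancel (by
    linear_combination (-c) * hze + (1 - e) * hac)
  have hye' : y * a * e = e := by linear_combination e * hye + (y - y * a) * hee
  refine ⟨1 - e, R.sub_mem R.one_mem he, by linear_combination hee, a * e + z,
    R.add_mem (R.mul_mem ha he) hz, ⟨y * e + c * (1 - e), R.add_mem (R.mul_mem hy he)
      (R.mul_mem hc (R.sub_mem R.one_mem he)), ?_⟩, ?_⟩
  · linear_combination (a * y) * hee + hye' + hzc - e * hzc - y * hz'
      + hee - a * c * hee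
  · unfold idemPow
    linear_combination hze - π * hz' - a * (1 - π) * hee + hz'

variable {n : ℕ}

omit h in
/-- Column reduction of an upper triangular matrix `b` such that `b` and `π b⁻¹` are integral. -/
lemma exists_reduction {Q : A → Set A} (hQR : ∀ e, Q e ⊆ R) (hQe : ∀ e, ∀ q ∈ Q e, e * q = q)
    (hQ : ∀ e ∈ R, e * e = e → ∀ x ∈ R, e * x = x → ∃ q ∈ Q e, ∃ t ∈ R, x - q = π * t)
    {ε u v : Fin n → A} (hεR : ∀ i, ε i ∈ R) (hε : ∀ i, ε i * ε i = ε i)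
    (huv : ∀ i, u i * v i = 1) (hvR : ∀ i, v i ∈ R)
    (b : (Matrix (Fin n) (Fin n) A)ˣ) (hb : ∀ i j, j < i → b.val i j = 0)
    (hbd : ∀ i, b.val i i = u i * idemPow π (ε i)) (hbR : ∀ i j, b.val i j ∈ R)
    (hπb : ∀ i j, π * b⁻¹.val i j ∈ R) :
    ∃ Y : Fin n → Fin n → A, (∀ i j, i < j → Y i j ∈ Q (ε i * (1 - ε j))) ∧
      ∃ V : Matrix (Fin n) (Fin n) A, (∀ i j, (b⁻¹.val * V) i j ∈ R) ∧
        V = Matrix.of fun i j => if i < j then Y i j else if i = j then idemPow π (ε j) else 0 := by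
  classical
  have h1ε : ∀ i, 1 - ε i ∈ R := fun i => R.sub_mem R.one_mem (hεR i)
  -- The columns of `V` are constructed from left to right, each inside the lattice b Rⁿ.
  have key : ∀ m : ℕ, ∀ j : Fin n, (j : ℕ) < m → ∃ w : Fin n → A, (∀ i, j < i → w i = 0) ∧
      w j = idemPow π (ε j) ∧ (∀ i, i < j → w i ∈ Q (ε i * (1 - ε j))) ∧
      ∀ i, (b⁻¹.val.mulVec w) i ∈ R := by
    intro m
    induction m with
    | zero => intro j hj; omega
    | succ m ih =>
      intro j hjm
      have ih' : ∀ l : Fin n, ∃ w : Fin n → A, l < j → (∀ i, l < i → w i = 0) ∧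
          w l = idemPow π (ε l) ∧ (∀ i, i < l → w i ∈ Q (ε i * (1 - ε l))) ∧
          ∀ i, (b⁻¹.val.mulVec w) i ∈ R := by
        intro l
        by_cases hl : l < j
        · obtain ⟨w, hw⟩ := ih l (by have : (l : ℕ) < j := hl; omega)
          exact ⟨w, fun _ => hw⟩
        · exact ⟨0, fun h => absurd h hl⟩
      choose w hw using ih'
      -- Where ε_j = 1, the column π e_j is taken, which is in b Rⁿ because π b⁻¹ is integral. Where
      -- ε_j = 0, the column j of `b` is normalised to have diagonal entry one, and the earlier
      -- columns `l` are subtracted where ε_l = 0; there they have a one on the diagonal, so the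
      -- entry in row `l` is cleared. What is left in row i < j is supported on ε_i (1 - ε_j).
      let s : Fin n → A := ∑ l with l < j, ((1 - ε l) * b.val l j) • w l
      let w₁ : Fin n → A := ((1 - ε j) * v j) • (b.val.col j - s) + (ε j * π) • Pi.single j 1
      have hsR : ∀ i, (b⁻¹.val.mulVec s) i ∈ R := by
        intro i
        have : b⁻¹.val.mulVec s = ∑ l with l < j, ((1 - ε l) * b.val l j) • b⁻¹.val.mulVec (w l) := by
          simp only [s, ← Matrix.mulVecLin_apply, map_sum, map_smul]
        rw [this, Finset.sum_apply]
        refine R.sum_mem fun l hl => R.mul_mem (R.mul_mem (h1ε l) (hbR l j)) ?_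
        exact (hw l (Finset.mem_filter.1 hl).2).2.2.2 i
      have hw₁R : ∀ i, (b⁻¹.val.mulVec w₁) i ∈ R := by
        intro i
        have e1 : b⁻¹.val.mulVec (b.val.col j) = (1 : Matrix (Fin n) (Fin n) A).col j := by
          rw [← Units.inv_mul b]; rfl
        have e2 : b⁻¹.val.mulVec (Pi.single j 1) = b⁻¹.val.col j := by simp
        simp only [w₁, Matrix.mulVec_add, Matrix.mulVec_smul, Matrix.mulVec_sub, e1, e2, Pi.add_apply,
          Pi.smul_apply, Pi.sub_apply, smul_eq_mul, Matrix.col_apply]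
        refine R.add_mem (R.mul_mem (R.mul_mem (h1ε j) (hvR j)) (R.sub_mem ?_ (hsR i))) ?_
        · rw [Matrix.one_apply]
          split_ifs
          · exact R.one_mem
          · exact R.zero_mem
        · rw [mul_assoc]; exact R.mul_mem (hεR j) (hπb i j)
      have hs0 : ∀ i, j ≤ i → s i = 0 := by
        intro i hi
        simp only [s, Finset.sum_apply]
        refine Finset.sum_eq_zero fun l hl => ?_
        have hl := (Finset.mem_filter.1 hl).2
        rw [Pi.smul_apply, (hw l hl).1 i (lt_of_lt_of_le hl hi), smul_zero]
      have hw₁0 : ∀ i, j < i → w₁ i = 0 := by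
        intro i hi
        simp [w₁, hs0 i hi.le, hb i j hi, Pi.single_eq_of_ne hi.ne']
      have hw₁j : w₁ j = idemPow π (ε j) := by
        simp only [w₁, Pi.add_apply, Pi.smul_apply, Pi.sub_apply, hs0 j le_rfl, Matrix.col_apply, hbd,
          Pi.single_eq_same, smul_eq_mul, idemPow]
        linear_combination (1 - ε j) * (π * ε j + (1 - ε j)) * huv j + (1 - π) * hε j
      have hw₁i : ∀ i, i < j → w₁ i ∈ R ∧ (ε i * (1 - ε j)) * w₁ i = w₁ i := by
        intro i hi
        have e1 : w₁ i = (1 - ε j) * v j * (b.val i j - s i) := by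
          simp [w₁, Pi.single_eq_of_ne hi.ne]
        have e2 : ∀ l, l < j → ∃ x ∈ R, (1 - ε l) * b.val l j * w l i
            = ε i * x + (if l = i then (1 - ε i) * b.val i j else 0) := by
          intro l hl
          rcases lt_trichotomy l i with hli | rfl | hli
          · exact ⟨0, R.zero_mem, by rw [(hw l hl).1 i hli, if_neg hli.ne]; ring⟩
          · refine ⟨0, R.zero_mem, ?_⟩
            rw [(hw l hl).2.1, if_pos rfl]
            linear_combination b.val l j * idemPow_mul_compl (π := π) (hε l)
          · have := (hw l hl).2.2.1 i hli
            refine ⟨(1 - ε l) * b.val l j * w l i, R.mul_mem (R.mul_mem (h1ε l) (hbR l j)) (hQR _ this), ?_⟩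
            rw [if_neg hli.ne']
            have := hQe _ _ this
            have h2 : ε i * w l i = w l i := by
              rw [← this]; linear_combination (1 - ε l) * w l i * hε i
            linear_combination (-(1 - ε l) * b.val l j) * h2
        have e3 : ∃ x ∈ R, s i = ε i * x + (1 - ε i) * b.val i j := by
          have e2' : ∀ l, ∃ x ∈ R, l < j → (1 - ε l) * b.val l j * w l i
              = ε i * x + (if l = i then (1 - ε i) * b.val i j else 0) := by
            intro l
            by_cases hl : l < j
            · obtain ⟨x, hx, e⟩ := e2 l hl
              exact ⟨x, hx, fun _ => e⟩
            · exact ⟨0, R.zero_mem, fun h => absurd h hl⟩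
          choose x hx e using e2'
          refine ⟨∑ l with l < j, x l, R.sum_mem fun l _ => hx l, ?_⟩
          simp only [s, Finset.sum_apply, Pi.smul_apply, smul_eq_mul]
          rw [Finset.sum_congr rfl (fun l hl => e l (Finset.mem_filter.1 hl).2),
            Finset.sum_add_distrib, Finset.mul_sum, Finset.sum_ite_eq' , if_pos (by simp [hi])]
        obtain ⟨x, hx, e3⟩ := e3
        have e4 : w₁ i = (1 - ε j) * ε i * (v j * (b.val i j - x)) := by
          rw [e1, e3]; ring
        refine ⟨?_, ?_⟩
        · rw [e4]
          exact R.mul_mem (R.mul_mem (h1ε j) (hεR i)) (R.mul_mem (hvR j) (R.sub_mem (hbR i j) hx))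
        · rw [e4]
          linear_combination (v j * (b.val i j - x)) * mul_compl_idem (hε i) (hε j)
      -- Entries may be changed modulo π, again because b Rⁿ contains π Rⁿ. This brings those above
      -- the diagonal into the chosen sets of representatives.
      have hq : ∀ i, ∃ q t, t ∈ R ∧ (i < j → q ∈ Q (ε i * (1 - ε j)) ∧ w₁ i - q = π * t) := by
        intro i
        by_cases hi : i < j
        · obtain ⟨q, hq, t, ht, e⟩ := hQ (ε i * (1 - ε j)) (R.mul_mem (hεR i) (h1ε j))
            (mul_compl_idem (hε i) (hε j)) (w₁ i) (hw₁i i hi).1 (hw₁i i hi).2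
          exact ⟨q, t, ht, fun _ => ⟨hq, e⟩⟩
        · exact ⟨0, 0, R.zero_mem, fun h => absurd h hi⟩
      choose q t htR hqt using hq
      let t' : Fin n → A := fun i => if i < j then t i else 0
      refine ⟨w₁ - π • t', fun i hi => ?_, ?_, fun i hi => ?_, fun i => ?_⟩
      · simp [t', hw₁0 i hi, hi.not_gt]
      · simp [t', hw₁j]
      · have e5 : (w₁ - π • t') i = q i := by
          simp only [t', Pi.sub_apply, Pi.smul_apply, if_pos hi, smul_eq_mul]
          linear_combination (hqt i hi).2
        rw [e5]; exact (hqt i hi).1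
      · rw [Matrix.mulVec_sub, Pi.sub_apply, Matrix.mulVec_smul]
        refine R.sub_mem (hw₁R i) ?_
        rw [Pi.smul_apply, Matrix.mulVec, dotProduct, Finset.smul_sum]
        refine R.sum_mem fun l _ => ?_
        rw [smul_eq_mul, ← mul_assoc]
        refine R.mul_mem (hπb i l) ?_
        simp only [t']
        split_ifs
        · exact htR l
        · exact R.zero_mem
  choose w hw0 hwd hwQ hwR using fun j : Fin n => key (j + 1) j (Nat.lt_succ_self _)
  refine ⟨fun i j => w j i, fun i j hij => hwQ j i hij, Matrix.of fun i j => w j i, fun i j => ?_, ?_⟩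
  · exact hwR j i
  · ext i j
    simp only [Matrix.of_apply]
    split_ifs with h1 h2
    · rfl
    · rw [h2, hwd]
    · exact hw0 j i (lt_of_le_of_ne (not_lt.1 h1) (Ne.symm h2))

omit h in
/-- The matrices of `exists_reduction` determine the left coset of `GL_n(R)`. -/
lemma inv_mul_mem_of_reduction {ε u v : Fin n → A}
    (huv : ∀ i, u i * v i = 1) (huR : ∀ i, u i ∈ R) {V : Matrix (Fin n) (Fin n) A}
    (hV : ∀ i j, j < i → V i j = 0) (hVd : ∀ i, V i i = idemPow π (ε i))
    (b : (Matrix (Fin n) (Fin n) A)ˣ) (hb : ∀ i j, j < i → b.val i j = 0)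
    (hbd : ∀ i, b.val i i = u i * idemPow π (ε i)) (hbV : ∀ i j, (b⁻¹.val * V) i j ∈ R) :
    ∃ k ∈ glSub R n, b.val * k.val = V := by
  have hbdet : b.val.det = (∏ i, u i) * ∏ i, idemPow π (ε i) := by
    rw [Matrix.det_of_isUpperTriangular (fun i j hij => hb i j hij), ← Finset.prod_mul_distrib]
    exact Finset.prod_congr rfl fun i _ => hbd i
  have hVdet : V.det = ∏ i, idemPow π (ε i) := by
    rw [Matrix.det_of_isUpperTriangular (fun i j hij => hV i j hij)]
    exact Finset.prod_congr rfl fun i _ => hVd i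
  have huv' : (∏ i, u i) * ∏ i, v i = 1 := by
    rw [← Finset.prod_mul_distrib]; exact Finset.prod_eq_one fun i _ => huv i
  have e : b⁻¹.val.det * b.val.det = 1 := by rw [← Matrix.det_mul, Units.inv_mul, Matrix.det_one]
  -- `b` and `V` have the same determinant up to `∏ u i`, which is therefore the inverse of the
  -- determinant of b⁻¹ V.
  obtain ⟨k, hk, hkV⟩ := exists_glSub hbV (R.prod_mem fun i (_ : i ∈ Finset.univ) => huR i)
    (by rw [Matrix.det_mul, hVdet]; linear_combination e - b⁻¹.val.det * hbdet)
  refine ⟨k, hk, ?_⟩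
  rw [hkV, ← mul_assoc, Units.mul_inv, one_mul]

/-- If the product of the elementary divisors `idemPow π (ε i)` is `π ^ r` up to a unit, then `r`
of the `ε i` are one at every place. -/
lemma prod_idemPow [IsReduced A] {r : ℕ} (hr : r ≤ n) {ε : Fin n → A} (hεR : ∀ i, ε i ∈ R)
    (hε : ∀ i, ε i * ε i = ε i) {x y : A} (hx : x ∈ R) (hy : y ∈ R) (hxy : x * y = 1)
    (hprod : ∏ i, idemPow π (ε i) = x * π ^ r) :
    ∏ i, ∏ j, idemPow π (ε i * (1 - ε j)) = π ^ (r * (n - r)) := by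
  classical
  rw [← sub_eq_zero]
  -- As `A` is reduced, the identity can be checked modulo each prime `P`, where every ε_i becomes 0
  -- or 1.
  refine (nilpotent_iff_mem_prime.2 fun P hP => ?_).eq_zero
  have h01 : ∀ i, ε i ∉ P → 1 - ε i ∈ P := fun i hi =>
    (hP.mem_or_mem (show ε i * (1 - ε i) ∈ P by
      rw [mul_sub, mul_one, hε, sub_self]; exact P.zero_mem)).resolve_left hi
  let I : Finset (Fin n) := Finset.univ.filter fun i => ε i ∉ P
  have hcard : I.card = r := by
    -- The product `e` of the `η i` cuts out the part of `A` where the pattern of zeros and ones of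
    -- the ε_i is the one seen at `P`. It is not in `P`, hence nonzero.
    let η : Fin n → A := fun i => if ε i ∈ P then 1 - ε i else ε i
    have hη : ∀ i, η i * η i = η i := by
      intro i; simp only [η]; split_ifs
      · linear_combination hε i
      · exact hε i
    have hηR : ∀ i, η i ∈ R := by
      intro i; simp only [η]; split_ifs
      · exact R.sub_mem R.one_mem (hεR i)
      · exact hεR i
    let e := ∏ i, η i
    have he : e * e = e := by
      simp only [e]; rw [← Finset.prod_mul_distrib]; exact Finset.prod_congr rfl fun i _ => hη i
    have heR : e ∈ R := R.prod_mem fun i _ => hηR i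
    have heP : e ∉ P := by
      intro he
      obtain ⟨i, -, hi⟩ := (hP.prod_mem_iff).1 he
      simp only [η] at hi
      split_ifs at hi with h1
      · refine hP.ne_top ((Ideal.eq_top_iff_one P).2 ?_)
        have := P.add_mem hi h1
        rwa [sub_add_cancel] at this
      · exact h1 hi
    have he1 : e * ∏ i, idemPow π (ε i) = e * π ^ I.card := by
      have : ∀ i, η i * idemPow π (ε i) = η i * (if i ∈ I then π else 1) := by
        intro i
        simp only [η, I, Finset.mem_filter, Finset.mem_univ, true_and]
        by_cases hi : ε i ∈ P
        · simp only [hi, if_true, not_true, if_false, mul_one]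
          exact idemPow_mul_compl (hε i)
        · simp only [hi, if_false, not_false_iff, if_true]
          rw [mul_comm, idemPow_mul_idem (hε i), mul_comm]
      simp only [e]
      rw [← Finset.prod_mul_distrib, Finset.prod_congr rfl fun i _ => this i, Finset.prod_mul_distrib]
      congr 1
      rw [Finset.prod_ite_mem, Finset.univ_inter, Finset.prod_const]
    rw [hprod] at he1
    by_contra hne
    -- On the part `e` the product of the elementary divisors is π ^ |I|, but it is also π ^ r up to
    -- a unit. With different exponents, `e` would be π times an element of `R`.
    have he0 : e = 0 := by
      rcases lt_or_gt_of_ne hne with hlt | hlt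
      · obtain ⟨k, rfl⟩ := Nat.exists_eq_add_of_lt hlt
        refine h.idem_eq_zero e he (e * x * π ^ k) (R.mul_mem (R.mul_mem heR hx) (h.pow_mem k)) ?_
        refine (h.isUnit.pow I.card).mul_left_cancel ?_
        rw [pow_succ, pow_add] at he1
        linear_combination -he1
      · obtain ⟨k, hk⟩ := Nat.exists_eq_add_of_lt hlt
        refine h.idem_eq_zero e he (e * y * π ^ k) (R.mul_mem (R.mul_mem heR hy) (h.pow_mem k)) ?_
        refine (h.isUnit.pow r).mul_left_cancel ?_
        rw [hk, pow_succ, pow_add] at he1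
        linear_combination y * he1 - e * π ^ r * hxy
    exact heP (he0 ▸ P.zero_mem)
  rw [← Ideal.Quotient.eq]
  simp only [map_prod, map_pow]
  have h0 : ∀ i, Ideal.Quotient.mk P (ε i) = if i ∈ I then 1 else 0 := by
    intro i
    simp only [I, Finset.mem_filter, Finset.mem_univ, true_and]
    split_ifs with hi
    · rw [Ideal.Quotient.eq_zero_iff_mem]; exact hi
    · rw [← map_one (Ideal.Quotient.mk P), eq_comm, Ideal.Quotient.eq]; exact h01 i hi
  have h1 : ∀ i j, Ideal.Quotient.mk P (idemPow π (ε i * (1 - ε j)))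
      = if i ∈ I then (if j ∈ I then 1 else Ideal.Quotient.mk P π) else 1 := by
    intro i j
    unfold idemPow
    simp only [map_add, map_mul, map_sub, map_one, h0]
    split_ifs <;> ring
  simp only [h1]
  have h2 : ∀ i, ∏ j, (if i ∈ I then (if j ∈ I then 1 else Ideal.Quotient.mk P π) else 1)
      = if i ∈ I then (Ideal.Quotient.mk P π) ^ (n - r) else 1 := by
    intro i
    split_ifs with hi
    · have : ∀ j, (if j ∈ I then 1 else Ideal.Quotient.mk P π) = if j ∈ Iᶜ then Ideal.Quotient.mk P π else 1 := by
        intro j; simp only [Finset.mem_compl]; split_ifs <;> simp_all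
      simp only [this]
      rw [Finset.prod_ite_mem, Finset.univ_inter, Finset.prod_const, Finset.card_compl, hcard, Fintype.card_fin]
    · simp
  simp only [h2]
  rw [Finset.prod_ite_mem, Finset.univ_inter, Finset.prod_const, hcard, ← pow_mul, mul_comm]

end IsUnramifiedOrder

/-! ### The order `ℤ_ℓ ⊗ 𝓞 E` -/

section LocInt

/-- An element of `ℚ_ℓ` of norm at most one, as an element of `ℤ_ℓ`. -/
def padicIntMk {ℓ : ℕ} [Fact ℓ.Prime] (x : ℚ_[ℓ]) (hx : ‖x‖ ≤ 1) : ℤ_[ℓ] := ⟨x, hx⟩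

variable (ℓ : ℕ) [Fact ℓ.Prime] (E : Type*) [Field E] [NumberField E]

/-- An integral basis of `E`, as a basis of `E_ℓ`. -/
def locBasis : Module.Basis (Module.Free.ChooseBasisIndex ℤ (𝓞 E)) ℚ_[ℓ] (LocField ℓ E) :=
  (Algebra.TensorProduct.basis ℚ_[ℓ] (integralBasis E) : Module.Basis _ ℚ_[ℓ] (ℚ_[ℓ] ⊗[ℚ] E))

lemma locBasis_apply (i) : locBasis ℓ E i = toLoc ℓ E (RingOfIntegers.basis E i : 𝓞 E) := by
  have := Algebra.TensorProduct.basis_apply (A := ℚ_[ℓ]) (integralBasis E) i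
  rw [integralBasis_apply] at this
  exact this

lemma locBasis_repr_toLoc (x : E) (i) :
    (locBasis ℓ E).repr (toLoc ℓ E x) i = algebraMap ℚ ℚ_[ℓ] ((integralBasis E).repr x i) := by
  have := Algebra.TensorProduct.basis_repr_tmul (A := ℚ_[ℓ]) (integralBasis E) 1 x
  rw [one_smul] at this
  exact congrFun (congrArg DFunLike.coe this) i

lemma locBasis_repr_toLoc_int (x : 𝓞 E) (i) :
    (locBasis ℓ E).repr (toLoc ℓ E x) i = ((RingOfIntegers.basis E).repr x i : ℤ) := by
  rw [locBasis_repr_toLoc]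
  erw [integralBasis_repr_apply]
  simp

instance : Module.Finite ℚ_[ℓ] (LocField ℓ E) := Module.Finite.of_basis (locBasis ℓ E)

lemma finrank_locField : Module.finrank ℚ_[ℓ] (LocField ℓ E) = Module.finrank ℚ E := by
  rw [Module.finrank_eq_card_basis (locBasis ℓ E), Module.finrank_eq_card_basis (integralBasis E)]

lemma toLoc_mem_locInt (x : 𝓞 E) : toLoc ℓ E x ∈ locInt ℓ E := Algebra.subset_adjoin ⟨x, rfl⟩

-- The images of the integers of `E` are closed under products, so the ℤ_ℓ-algebra that they
-- generate is merely their span, and an integral basis of `E` spans it.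
variable {ℓ E} in
lemma mem_locInt_iff {x : LocField ℓ E} :
    x ∈ locInt ℓ E ↔ ∀ i, ‖(locBasis ℓ E).repr x i‖ ≤ 1 := by
  constructor
  · intro hx
    have hclos : (Submonoid.closure (Set.range fun x : 𝓞 E => toLoc ℓ E (x : E)) : Set (LocField ℓ E))
        = Set.range fun x : 𝓞 E => toLoc ℓ E (x : E) := by
      have : (Set.range fun x : 𝓞 E => toLoc ℓ E (x : E))
          = (MonoidHom.mrange ((toLoc ℓ E).comp (algebraMap (𝓞 E) E)) : Set (LocField ℓ E)) := rfl
      rw [this, Submonoid.closure_eq]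
    have hx' : x ∈ Submodule.span ℤ_[ℓ] (Set.range fun x : 𝓞 E => toLoc ℓ E (x : E)) := by
      rw [← hclos, ← Algebra.adjoin_eq_span]
      exact hx
    clear hx
    induction hx' using Submodule.span_induction with
    | mem x hx =>
      obtain ⟨y, rfl⟩ := hx
      intro i
      rw [locBasis_repr_toLoc_int]
      exact Padic.norm_int_le_one _
    | zero => simp
    | add x y _ _ hx hy =>
      intro i
      rw [map_add]
      exact (Padic.nonarchimedean _ _).trans (max_le (hx i) (hy i))
    | smul c x _ hx =>
      intro i
      have : c • x = (c : ℚ_[ℓ]) • x := rfl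
      rw [this, map_smul, Finsupp.smul_apply, smul_eq_mul, norm_mul]
      exact mul_le_one₀ c.2 (norm_nonneg _) (hx i)
  · intro hx
    rw [← (locBasis ℓ E).sum_repr x]
    refine Subalgebra.sum_mem _ fun i _ => ?_
    have : (locBasis ℓ E).repr x i • locBasis ℓ E i
        = padicIntMk _ (hx i) • locBasis ℓ E i := rfl
    rw [this, locBasis_apply]
    exact Subalgebra.smul_mem _ (toLoc_mem_locInt ℓ E _) _

/-- An integral basis of `E`, as a basis of `ℤ_ℓ ⊗ 𝓞 E`. -/
def locIntBasis : Module.Basis (Module.Free.ChooseBasisIndex ℤ (𝓞 E)) ℤ_[ℓ] (locInt ℓ E) :=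
  .ofRepr <| LinearEquiv.trans
    { toFun := fun x i => padicIntMk ((locBasis ℓ E).repr x i) (mem_locInt_iff.1 x.2 i)
      map_add' := fun x y => by
        ext i
        simp
        exact Subtype.ext rfl
      map_smul' := fun c x => by
        ext i
        have : ((c • x : locInt ℓ E) : LocField ℓ E) = (c : ℚ_[ℓ]) • (x : LocField ℓ E) := rfl
        simp [this]
        exact Subtype.ext rfl
      invFun := fun c => ⟨∑ i, (c i : ℚ_[ℓ]) • locBasis ℓ E i, mem_locInt_iff.2 fun i => by
        rw [Module.Basis.repr_sum_self]; exact (c i).2⟩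
      left_inv := fun x => Subtype.ext ((locBasis ℓ E).sum_repr x)
      right_inv := fun c => by
        ext i
        simp only [Module.Basis.repr_sum_self]
        exact Subtype.ext rfl }
    (Finsupp.linearEquivFunOnFinite ℤ_[ℓ] ℤ_[ℓ] _).symm

lemma locIntBasis_repr (x : locInt ℓ E) (i) :
    ((locIntBasis ℓ E).repr x i : ℚ_[ℓ]) = (locBasis ℓ E).repr x i := rfl

lemma locIntBasis_apply (i) : (locIntBasis ℓ E i : LocField ℓ E) = locBasis ℓ E i := by
  classical
  apply (locBasis ℓ E).repr.injective
  ext j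
  rw [← locIntBasis_repr, Module.Basis.repr_self, Module.Basis.repr_self, Finsupp.single_apply,
    Finsupp.single_apply]
  split_ifs <;> simp

instance : Module.Finite ℤ_[ℓ] (locInt ℓ E) := Module.Finite.of_basis (locIntBasis ℓ E)

instance : Module.Free ℤ_[ℓ] (locInt ℓ E) := Module.Free.of_basis (locIntBasis ℓ E)

instance : IsNoetherianRing (locInt ℓ E) := IsNoetherianRing.of_finite ℤ_[ℓ] _

lemma exists_pow_mul_mem_locInt (x : LocField ℓ E) :
    ∃ k : ℕ, (ℓ : LocField ℓ E) ^ k * x ∈ locInt ℓ E := by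
  have h1 : ∀ i, ∃ k : ℕ, ‖(ℓ : ℚ_[ℓ]) ^ k * (locBasis ℓ E).repr x i‖ ≤ 1 := by
    intro i
    have h0 : Filter.Tendsto (fun k : ℕ => ‖(ℓ : ℚ_[ℓ])‖ ^ k * ‖(locBasis ℓ E).repr x i‖) Filter.atTop
        (nhds (0 * ‖(locBasis ℓ E).repr x i‖)) :=
      (tendsto_pow_atTop_nhds_zero_of_lt_one (norm_nonneg _) Padic.norm_p_lt_one).mul_const _
    rw [zero_mul] at h0
    obtain ⟨k, hk⟩ := ((h0.eventually (gt_mem_nhds zero_lt_one)).exists)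
    exact ⟨k, by rw [norm_mul, norm_pow]; exact hk.le⟩
  choose k hk using h1
  refine ⟨∑ i, k i, mem_locInt_iff.2 fun i => ?_⟩
  have : (ℓ : LocField ℓ E) ^ (∑ i, k i) * x = ((ℓ : ℚ_[ℓ]) ^ (∑ i, k i)) • x := by
    rw [Algebra.smul_def, map_pow, map_natCast]
  rw [this, map_smul, Finsupp.smul_apply, smul_eq_mul]
  classical
  rw [← Finset.sum_erase_add _ _ (Finset.mem_univ i), pow_add, mul_assoc, norm_mul, norm_pow]
  exact mul_le_one₀ (pow_le_one₀ (norm_nonneg _) Padic.norm_p_lt_one.le) (norm_nonneg _) (hk i)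

lemma isUnit_natCast_locField {m : ℕ} (hm : m ≠ 0) : IsUnit (m : LocField ℓ E) := by
  have : (m : LocField ℓ E) = algebraMap ℚ_[ℓ] _ (m : ℚ_[ℓ]) := by simp
  rw [this]
  exact (IsUnit.mk0 _ (by exact_mod_cast hm)).map _

lemma dvd_locInt_iff {k : ℕ} {x : locInt ℓ E} :
    (ℓ : locInt ℓ E) ^ k ∣ x ↔ ∀ i, (ℓ : ℤ_[ℓ]) ^ k ∣ (locIntBasis ℓ E).repr x i := by
  have hs : ∀ y : locInt ℓ E, (ℓ : locInt ℓ E) ^ k * y = ((ℓ : ℤ_[ℓ]) ^ k) • y := by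
    intro y
    rw [Algebra.smul_def, map_pow, map_natCast]
  constructor
  · rintro ⟨y, rfl⟩ i
    rw [hs, map_smul, Finsupp.smul_apply, smul_eq_mul]
    exact dvd_mul_right _ _
  · intro h
    choose c hc using h
    refine ⟨∑ i, c i • locIntBasis ℓ E i, ?_⟩
    rw [hs, Finset.smul_sum]
    conv_lhs => rw [← (locIntBasis ℓ E).sum_repr x]
    exact Finset.sum_congr rfl fun i _ => by rw [hc, mul_smul]

/-- Completeness is inherited from ℤ_ℓ in each coordinate of an integral basis. It makes Hensel's
lemma available for lifting idempotents. -/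
instance : IsAdicComplete (Ideal.span {(ℓ : locInt ℓ E)}) (locInt ℓ E) where
  haus' x hx := by
    have h1 : ∀ n, (ℓ : locInt ℓ E) ^ n ∣ x := by
      intro n
      have := hx n
      rwa [SModEq.zero, smul_eq_mul, Ideal.mul_top, Ideal.span_singleton_pow,
        Ideal.mem_span_singleton] at this
    apply (locIntBasis ℓ E).repr.injective
    ext i
    rw [map_zero, Finsupp.zero_apply]
    refine IsHausdorff.haus (I := IsLocalRing.maximalIdeal ℤ_[ℓ]) inferInstance _ fun n => ?_
    rw [SModEq.zero, smul_eq_mul, Ideal.mul_top, PadicInt.maximalIdeal_eq_span_p,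
      Ideal.span_singleton_pow, Ideal.mem_span_singleton]
    exact (dvd_locInt_iff ℓ E).1 (h1 n) i
  prec' f hf := by
    have h1 : ∀ {m n}, m ≤ n → (ℓ : locInt ℓ E) ^ m ∣ f m - f n := by
      intro m n hmn
      have := hf hmn
      rwa [SModEq.sub_mem, smul_eq_mul, Ideal.mul_top, Ideal.span_singleton_pow,
        Ideal.mem_span_singleton] at this
    have h2 : ∀ i, ∃ L : ℤ_[ℓ], ∀ n, (ℓ : ℤ_[ℓ]) ^ n ∣ (locIntBasis ℓ E).repr (f n) i - L := by
      intro i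
      obtain ⟨L, hL⟩ := IsPrecomplete.prec' (I := IsLocalRing.maximalIdeal ℤ_[ℓ])
        (fun n => (locIntBasis ℓ E).repr (f n) i) (fun {m n} hmn => by
          rw [SModEq.sub_mem, smul_eq_mul, Ideal.mul_top, PadicInt.maximalIdeal_eq_span_p,
            Ideal.span_singleton_pow, Ideal.mem_span_singleton, ← Finsupp.sub_apply, ← map_sub]
          exact (dvd_locInt_iff ℓ E).1 (h1 hmn) i)
      refine ⟨L, fun n => ?_⟩
      have := hL n
      rwa [SModEq.sub_mem, smul_eq_mul, Ideal.mul_top, PadicInt.maximalIdeal_eq_span_p,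
        Ideal.span_singleton_pow, Ideal.mem_span_singleton] at this
    choose L hL using h2
    refine ⟨∑ i, L i • locIntBasis ℓ E i, fun n => ?_⟩
    rw [SModEq.sub_mem, smul_eq_mul, Ideal.mul_top, Ideal.span_singleton_pow,
      Ideal.mem_span_singleton, dvd_locInt_iff]
    intro i
    rw [map_sub, Finsupp.sub_apply, Module.Basis.repr_sum_self]
    exact hL i n

end LocInt

/-! ### Reduction modulo `ℓ` and lifting of idempotents. -/

section LocInt

variable (ℓ : ℕ) [Fact ℓ.Prime] (E : Type*) [Field E] [NumberField E]

lemma exists_int_approx (x : locInt ℓ E) : ∃ y : 𝓞 E, ∃ w : locInt ℓ E,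
    (x : LocField ℓ E) = toLoc ℓ E y + ℓ * w := by
  have h1 : ∀ i, ∃ (n : ℕ) (w : ℤ_[ℓ]), (locIntBasis ℓ E).repr x i = n + ℓ * w := by
    intro i
    obtain ⟨n, -, hn⟩ := PadicInt.exists_mem_range ((locIntBasis ℓ E).repr x i)
    rw [PadicInt.maximalIdeal_eq_span_p, Ideal.mem_span_singleton] at hn
    obtain ⟨w, hw⟩ := hn
    exact ⟨n, w, by rw [← hw]; ring⟩
  choose n w hnw using h1
  refine ⟨∑ i, n i • RingOfIntegers.basis E i, ∑ i, w i • locIntBasis ℓ E i, ?_⟩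
  have h2 : x = ∑ i, n i • locIntBasis ℓ E i + (ℓ : locInt ℓ E) * ∑ i, w i • locIntBasis ℓ E i := by
    conv_lhs => rw [← (locIntBasis ℓ E).sum_repr x]
    rw [Finset.mul_sum, ← Finset.sum_add_distrib]
    refine Finset.sum_congr rfl fun i _ => ?_
    rw [hnw, add_smul, mul_smul, Nat.cast_smul_eq_nsmul, Nat.cast_smul_eq_nsmul, nsmul_eq_mul ℓ]
  conv_lhs => rw [h2]
  simp [locIntBasis_apply, locBasis_apply]

/-- Together with `exists_int_approx` this identifies 𝓞 E / ℓ with the reduction of ℤ_ℓ ⊗ 𝓞 E modulo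
ℓ, so that the ramification hypothesis on 𝓞 E can be used locally. -/
lemma natCast_dvd_iff_toLoc (y : 𝓞 E) :
    (ℓ : 𝓞 E) ∣ y ↔ ∃ w ∈ locInt ℓ E, toLoc ℓ E y = ℓ * w := by
  constructor
  · rintro ⟨z, rfl⟩
    exact ⟨_, toLoc_mem_locInt ℓ E z, by simp⟩
  · rintro ⟨w, hw, h⟩
    have h1 : ∀ i, (ℓ : ℤ) ∣ (RingOfIntegers.basis E).repr y i := by
      intro i
      rw [← PadicInt.norm_int_lt_one_iff_dvd]
      have h2 : (ℓ : LocField ℓ E) * w = (ℓ : ℚ_[ℓ]) • w := by rw [Algebra.smul_def, map_natCast]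
      have h3 := locBasis_repr_toLoc_int ℓ E y i
      rw [h, h2, map_smul, Finsupp.smul_apply, smul_eq_mul] at h3
      have h4 : ‖(((RingOfIntegers.basis E).repr y i : ℤ) : ℚ_[ℓ])‖ < 1 := by
        rw [← h3, norm_mul]
        exact mul_lt_one_of_nonneg_of_lt_one_left (norm_nonneg _) Padic.norm_p_lt_one
          (mem_locInt_iff.1 hw i)
      rw [PadicInt.norm_def]
      simpa using h4
    choose c hc using h1
    refine ⟨∑ i, c i • RingOfIntegers.basis E i, ?_⟩
    conv_lhs => rw [← (RingOfIntegers.basis E).sum_repr y]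
    rw [Finset.mul_sum]
    refine Finset.sum_congr rfl fun i _ => ?_
    rw [hc, mul_smul]
    simp [zsmul_eq_mul]

variable {E} in
lemma isRadical_of_squarefree_span {x : 𝓞 E} (h0 : x ≠ 0) (h : Squarefree (Ideal.span {x})) :
    ∀ (y : 𝓞 E) (n : ℕ), x ∣ y ^ n → x ∣ y := by
  intro y n hy
  have h1 := (isRadical_iff_squarefree_of_ne_zero (by simpa using h0)).2 h n (Ideal.span {y})
  rw [Ideal.span_singleton_pow, Ideal.dvd_span_singleton, Ideal.dvd_span_singleton,
    Ideal.mem_span_singleton, Ideal.mem_span_singleton] at h1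
  exact h1 hy

variable (hℓ : Squarefree (Ideal.span {(ℓ : 𝓞 E)}))
include hℓ

/-- The reduction modulo ℓ is that of 𝓞 E, which is reduced since ℓ is a square-free ideal. So `x`
is replaced by a global integer congruent to it. -/
lemma dvd_of_dvd_pow_locInt {x : locInt ℓ E} {n : ℕ} (h : (ℓ : locInt ℓ E) ∣ x ^ n) :
    (ℓ : locInt ℓ E) ∣ x := by
  obtain ⟨y, w, hyw⟩ := exists_int_approx ℓ E x
  let y' : locInt ℓ E := ⟨toLoc ℓ E y, toLoc_mem_locInt ℓ E y⟩
  have hx : x = y' + ℓ * w := Subtype.ext hyw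
  have h1 : (ℓ : locInt ℓ E) ∣ y' ^ n := by
    have : (ℓ : locInt ℓ E) ∣ x ^ n - y' ^ n := by
      refine dvd_trans ?_ (sub_dvd_pow_sub_pow x y' n)
      rw [hx, add_sub_cancel_left]
      exact dvd_mul_right _ _
    exact (dvd_sub_right h).1 this
  have h2 : (ℓ : 𝓞 E) ∣ y ^ n := by
    rw [natCast_dvd_iff_toLoc ℓ E]
    obtain ⟨z, hz⟩ := h1
    refine ⟨z, z.2, ?_⟩
    have := congrArg Subtype.val hz
    simpa [y'] using this
  have h3 := isRadical_of_squarefree_span (by exact_mod_cast (Fact.out : ℓ.Prime).ne_zero) hℓ y n h2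
  rw [hx]
  refine dvd_add ?_ (dvd_mul_right _ _)
  obtain ⟨w', hw', e⟩ := (natCast_dvd_iff_toLoc ℓ E y).1 h3
  exact ⟨⟨w', hw'⟩, Subtype.ext (by simpa [y'] using e)⟩

instance : Finite (locInt ℓ E ⧸ Ideal.span {(ℓ : locInt ℓ E)}) := by
  refine Finite.of_surjective (fun n : Module.Free.ChooseBasisIndex ℤ (𝓞 E) → Fin ℓ =>
    Ideal.Quotient.mk _ (∑ i, ((n i : ℕ) : ℤ_[ℓ]) • locIntBasis ℓ E i)) fun q => ?_
  obtain ⟨x, rfl⟩ := Ideal.Quotient.mk_surjective q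
  have h1 : ∀ i, ∃ n : Fin ℓ, (ℓ : ℤ_[ℓ]) ∣ (locIntBasis ℓ E).repr x i - (n : ℕ) := by
    intro i
    obtain ⟨n, hn, hn'⟩ := PadicInt.exists_mem_range ((locIntBasis ℓ E).repr x i)
    rw [PadicInt.maximalIdeal_eq_span_p, Ideal.mem_span_singleton] at hn'
    exact ⟨⟨n, hn⟩, hn'⟩
  choose n hn using h1
  refine ⟨n, ?_⟩
  rw [eq_comm, Ideal.Quotient.eq, Ideal.mem_span_singleton]
  have := dvd_locInt_iff ℓ E (k := 1) (x := x - ∑ i, ((n i : ℕ) : ℤ_[ℓ]) • locIntBasis ℓ E i)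
  rw [pow_one, pow_one] at this
  rw [this]
  intro i
  rw [map_sub, Finsupp.sub_apply, Module.Basis.repr_sum_self]
  exact hn i

/-- For an unramified prime `ℓ`, idempotents of `(ℤ_ℓ ⊗ 𝓞 E) / ℓ` lift. -/
lemma exists_idem_locInt (x : locInt ℓ E) : ∃ e : locInt ℓ E, e * e = e ∧
    (∃ y, y * (x * e + (1 - e)) = 1) ∧ (ℓ : locInt ℓ E) ∣ (1 - e) * x := by
  set I := Ideal.span {(ℓ : locInt ℓ E)} with hI
  have hmem : ∀ y : locInt ℓ E, Ideal.Quotient.mk I y = 0 ↔ (ℓ : locInt ℓ E) ∣ y := fun y => by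
    rw [Ideal.Quotient.eq_zero_iff_mem, hI, Ideal.mem_span_singleton]
  -- The residue ring is finite, so two powers of `x` agree modulo ℓ. As it is also reduced, this
  -- gives x = x ^ (t + 2) modulo ℓ, and x ^ (t + 1) is idempotent modulo ℓ.
  obtain ⟨a, b, hab, hpow⟩ := Finite.exists_ne_map_eq_of_infinite
    (fun n : ℕ => Ideal.Quotient.mk I (x ^ n))
  wlog hlt : a < b generalizing a b
  · exact this b a hab.symm hpow.symm (lt_of_le_of_ne (not_lt.1 hlt) hab.symm)
  obtain ⟨t, rfl⟩ := Nat.exists_eq_add_of_lt hlt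
  have h1 : (ℓ : locInt ℓ E) ∣ x * (1 - x ^ (t + 1)) := by
    refine dvd_of_dvd_pow_locInt ℓ E hℓ (n := a + 1) ?_
    have h2 : (ℓ : locInt ℓ E) ∣ x ^ a - x ^ (a + t + 1) := by
      rw [← hmem, map_sub, sub_eq_zero]; exact hpow
    have : (x * (1 - x ^ (t + 1))) ^ (a + 1)
        = (x ^ a - x ^ (a + t + 1)) * (x * (1 - x ^ (t + 1)) ^ a) := by
      rw [add_assoc a t 1, pow_add x a (t + 1), mul_pow]; ring
    rw [this]
    exact dvd_mul_of_dvd_left h2 _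
  set f := x ^ (t + 1) with hf
  have hff : (ℓ : locInt ℓ E) ∣ f * f - f := by
    have : f * f - f = -(x * (1 - x ^ (t + 1))) * x ^ t := by rw [hf, pow_succ]; ring
    rw [this]
    exact dvd_mul_of_dvd_left ((dvd_neg).2 h1) _
  have hH : HenselianRing (locInt ℓ E) I := inferInstance
  have hmonic : (Polynomial.X ^ 2 - Polynomial.X : Polynomial (locInt ℓ E)).Monic :=
    Polynomial.monic_X_pow_sub (by
      rw [Polynomial.degree_X]; norm_num)
  -- The derivative 2 f - 1 of X² - X at `f` is a unit modulo ℓ, since its square is 1 + 4 (f² - f).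
  obtain ⟨e, he, hef⟩ := hH.is_henselian (Polynomial.X ^ 2 - Polynomial.X) hmonic f (by
      simp only [Polynomial.eval_sub, Polynomial.eval_pow, Polynomial.eval_X, hI, Ideal.mem_span_singleton]
      rwa [sq]) (by
      refine .of_mul_eq_one (Ideal.Quotient.mk I (2 * f - 1)) ?_
      rw [← map_mul, ← map_one (Ideal.Quotient.mk I), ← sub_eq_zero, ← map_sub, hmem]
      have : (Polynomial.eval f (Polynomial.derivative (Polynomial.X ^ 2 - Polynomial.X))) * (2 * f - 1) - 1
          = 4 * (f * f - f) := by
        simp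
        ring
      rw [this]
      exact dvd_mul_of_dvd_right hff _)
  have hee : e * e = e := by
    have : Polynomial.eval e (Polynomial.X ^ 2 - Polynomial.X) = 0 := he
    simp only [Polynomial.eval_sub, Polynomial.eval_pow, Polynomial.eval_X] at this
    linear_combination this
  rw [hI, Ideal.mem_span_singleton] at hef
  obtain ⟨s, hs⟩ := hef
  obtain ⟨s₁, hs₁⟩ := h1
  -- Modulo ℓ, the inverse of `x` on the part `e` is `x ^ t`. The product is then one modulo ℓ, and
  -- ℓ is in the Jacobson radical.
  have hu : IsUnit ((x ^ t * e + (1 - e)) * (x * e + (1 - e))) := by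
    have hjac := hH.jac
    have : (x ^ t * e + (1 - e)) * (x * e + (1 - e)) = 1 + ℓ * (-(s * e)) := by
      have e1 : (x ^ t * e + (1 - e)) * (x * e + (1 - e)) = f * e + (1 - e) := by
        rw [hf, pow_succ]
        linear_combination (x ^ t * x - x ^ t - x + 1) * hee
      rw [e1]
      linear_combination (-e) * hs + hee
    rw [this]
    have h5 := Ideal.mem_jacobson_bot.1 (hjac (Ideal.mem_span_singleton_self (ℓ : locInt ℓ E))) (-(s * e))
    rwa [add_comm] at h5
  obtain ⟨y, hy⟩ := hu.exists_left_inv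
  refine ⟨e, hee, ⟨y * (x ^ t * e + (1 - e)), by rw [mul_assoc, hy]⟩, s₁ - s * x, ?_⟩
  linear_combination hs₁ - x * hs

end LocInt

/-! ### Norms, idempotents and reducedness. -/

section LocInt

variable (ℓ : ℕ) [Fact ℓ.Prime] (E : Type*) [Field E] [NumberField E]

lemma eq_zero_of_forall_pow_dvd {x : locInt ℓ E} (h : ∀ k, (ℓ : locInt ℓ E) ^ k ∣ x) : x = 0 := by
  refine IsHausdorff.haus (I := Ideal.span {(ℓ : locInt ℓ E)}) inferInstance _ fun n => ?_
  rw [SModEq.zero, smul_eq_mul, Ideal.mul_top, Ideal.span_singleton_pow, Ideal.mem_span_singleton]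
  exact h n

/-- Such an idempotent is equal to all its powers, so every power of ℓ divides it. -/
lemma idem_eq_zero_locInt {e : LocField ℓ E} (he : e * e = e) {z : LocField ℓ E} (hz : z ∈ locInt ℓ E)
    (hez : e = ℓ * z) : e = 0 := by
  have heR : e ∈ locInt ℓ E := by
    rw [hez]; exact Subalgebra.mul_mem _ (natCast_mem _ _) hz
  have h : (⟨e, heR⟩ : locInt ℓ E) = 0 := by
    refine eq_zero_of_forall_pow_dvd ℓ E fun k => ?_
    cases k with
    | zero => simp
    | succ k =>
      have h1 : (⟨e, heR⟩ : locInt ℓ E) ^ (k + 1) = ⟨e, heR⟩ :=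
        IsIdempotentElem.pow_succ_eq k (Subtype.ext he)
      have h2 : (⟨e, heR⟩ : locInt ℓ E) = ℓ * ⟨z, hz⟩ := Subtype.ext (by simpa using hez)
      rw [← h1, h2, mul_pow]
      exact dvd_mul_right _ _
  exact congrArg Subtype.val h

lemma norm_coe_locInt (x : locInt ℓ E) :
    Algebra.norm ℚ_[ℓ] (x : LocField ℓ E) = (Algebra.norm ℤ_[ℓ] x : ℤ_[ℓ]) := by
  classical
  rw [Algebra.norm_eq_matrix_det (locBasis ℓ E), Algebra.norm_eq_matrix_det (locIntBasis ℓ E)]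
  have : (((Algebra.leftMulMatrix (locIntBasis ℓ E) x).det : ℤ_[ℓ]) : ℚ_[ℓ])
      = PadicInt.Coe.ringHom (Algebra.leftMulMatrix (locIntBasis ℓ E) x).det := rfl
  rw [this, RingHom.map_det]
  congr 1
  ext i j
  rw [Algebra.leftMulMatrix_eq_repr_mul, RingHom.mapMatrix_apply, Matrix.map_apply,
    Algebra.leftMulMatrix_eq_repr_mul]
  change _ = (((locIntBasis ℓ E).repr (x * locIntBasis ℓ E j) i : ℤ_[ℓ]) : ℚ_[ℓ])
  rw [locIntBasis_repr, MulMemClass.coe_mul, locIntBasis_apply]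

lemma norm_norm_le_one {x : LocField ℓ E} (hx : x ∈ locInt ℓ E) : ‖Algebra.norm ℚ_[ℓ] x‖ ≤ 1 := by
  rw [norm_coe_locInt ℓ E ⟨x, hx⟩]
  exact (Algebra.norm ℤ_[ℓ] (⟨x, hx⟩ : locInt ℓ E)).2

lemma norm_norm_eq_one {x y : LocField ℓ E} (hx : x ∈ locInt ℓ E) (hy : y ∈ locInt ℓ E)
    (hxy : x * y = 1) : ‖Algebra.norm ℚ_[ℓ] x‖ = 1 := by
  refine le_antisymm (norm_norm_le_one ℓ E hx) ?_
  have h1 : ‖Algebra.norm ℚ_[ℓ] x‖ * ‖Algebra.norm ℚ_[ℓ] y‖ = 1 := by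
    rw [← norm_mul, ← map_mul, hxy, map_one, norm_one]
  have h2 := norm_norm_le_one ℓ E hy
  nlinarith [norm_nonneg (Algebra.norm ℚ_[ℓ] x), norm_nonneg (Algebra.norm ℚ_[ℓ] y)]

/-- The norm of `idemPow ℓ e`, and representatives of `e R / ℓ`, for an idempotent `e` of the
order `R = ℤ_ℓ ⊗ 𝓞 E`. -/
lemma exists_idem_reps (e : LocField ℓ E) (heR : e ∈ locInt ℓ E) (hee : e * e = e) :
    ∃ t : ℕ, ‖Algebra.norm ℚ_[ℓ] (idemPow (ℓ : LocField ℓ E) e)‖ = ((ℓ : ℝ) ^ t)⁻¹ ∧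
      ∃ Q : Finset (LocField ℓ E), Q.card ≤ ℓ ^ t ∧ (∀ q ∈ Q, q ∈ locInt ℓ E ∧ e * q = q) ∧
        ∀ x ∈ locInt ℓ E, e * x = x → ∃ q ∈ Q, ∃ s ∈ locInt ℓ E, x - q = ℓ * s := by
  classical
  let e' : locInt ℓ E := ⟨e, heR⟩
  have hee' : e' * e' = e' := Subtype.ext hee
  let φ : Module.End ℤ_[ℓ] (locInt ℓ E) := LinearMap.mulLeft ℤ_[ℓ] e'
  have hφ : IsIdempotentElem φ := by
    ext1 x
    change e' * (e' * x) = e' * x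
    rw [← mul_assoc, hee']
  have hcompl := LinearMap.IsIdempotentElem.isCompl hφ
  let W := LinearMap.range φ
  let W' := LinearMap.ker φ
  let eqv := Submodule.prodEquivOfIsCompl W W' hcompl
  let c : locInt ℓ E := ℓ * e' + (1 - e')
  have hWmem : ∀ x : locInt ℓ E, x ∈ W ↔ e' * x = x := by
    intro x
    constructor
    · rintro ⟨y, rfl⟩
      change e' * (e' * y) = e' * y
      rw [← mul_assoc, hee']
    · intro h; exact ⟨x, h⟩
  -- The order is the direct sum of its parts cut out by `e'` and `1 - e'`, and `c` acts as ℓ on the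
  -- first and as one on the second. So `t` is the rank of the first part, and digit vectors in a
  -- basis of it give the ℓ ^ t representatives.
  have hdet : Algebra.norm ℤ_[ℓ] c = (ℓ : ℤ_[ℓ]) ^ Module.finrank ℤ_[ℓ] W := by
    have h1 : LinearMap.mulLeft ℤ_[ℓ] c = eqv.toLinearMap ∘ₗ
        (LinearMap.prodMap ((ℓ : ℤ_[ℓ]) • LinearMap.id) LinearMap.id) ∘ₗ eqv.symm.toLinearMap := by
      rw [← LinearMap.comp_assoc, LinearEquiv.eq_comp_toLinearMap_symm]
      refine LinearMap.ext fun ⟨⟨x, hx⟩, ⟨y, hy⟩⟩ => ?_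
      have hy' : e' * y = 0 := hy
      have hx' : e' * x = x := (hWmem x).1 hx
      have e1 : ((LinearMap.mulLeft ℤ_[ℓ] c) ∘ₗ eqv.toLinearMap) (⟨x, hx⟩, ⟨y, hy⟩) = c * (x + y) := rfl
      have e2 : (eqv.toLinearMap ∘ₗ (LinearMap.prodMap ((ℓ : ℤ_[ℓ]) • LinearMap.id) LinearMap.id))
          (⟨x, hx⟩, ⟨y, hy⟩) = (ℓ : ℤ_[ℓ]) • x + y := rfl
      rw [e1, e2, Algebra.smul_def, map_natCast]
      linear_combination (ℓ - 1) * hx' + (ℓ - 1) * hy'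
    have h2 : Algebra.norm ℤ_[ℓ] c = LinearMap.det (LinearMap.mulLeft ℤ_[ℓ] c) := rfl
    rw [h2, h1, LinearMap.det_conj, LinearMap.det_prodMap, LinearMap.det_smul, LinearMap.det_id,
      LinearMap.det_id, mul_one, mul_one]
  refine ⟨Module.finrank ℤ_[ℓ] W, ?_, ?_⟩
  · have h3 : idemPow (ℓ : LocField ℓ E) e = (c : LocField ℓ E) := by
      simp [idemPow, c, e']
    rw [h3, norm_coe_locInt, hdet]
    simp
  · let b := Module.finBasis ℤ_[ℓ] W
    refine ⟨Finset.univ.image fun n : Fin (Module.finrank ℤ_[ℓ] W) → Fin ℓ =>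
      ((∑ i, ((n i : ℕ) : ℤ_[ℓ]) • (b i) : W) : LocField ℓ E), ?_, ?_, ?_⟩
    · exact Finset.card_image_le.trans (by simp)
    · intro q hq
      obtain ⟨n, -, rfl⟩ := Finset.mem_image.1 hq
      refine ⟨Subtype.property _, ?_⟩
      have := (hWmem _).1 (∑ i, ((n i : ℕ) : ℤ_[ℓ]) • (b i) : W).2
      exact congrArg Subtype.val this
    · intro x hx hex
      let x' : W := ⟨⟨x, hx⟩, (hWmem _).2 (Subtype.ext hex)⟩
      have h1 : ∀ i, ∃ n : Fin ℓ, ∃ w, b.repr x' i - (n : ℕ) = (ℓ : ℤ_[ℓ]) * w := by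
        intro i
        obtain ⟨n, hn, hn'⟩ := PadicInt.exists_mem_range (b.repr x' i)
        rw [PadicInt.maximalIdeal_eq_span_p, Ideal.mem_span_singleton] at hn'
        exact ⟨⟨n, hn⟩, hn'⟩
      choose n w hnw using h1
      refine ⟨_, Finset.mem_image_of_mem _ (Finset.mem_univ n),
        ((∑ i, w i • (b i) : W) : LocField ℓ E), Subtype.property _, ?_⟩
      have h2 : x' - ∑ i, ((n i : ℕ) : ℤ_[ℓ]) • (b i) = (ℓ : ℤ_[ℓ]) • ∑ i, w i • (b i) := by
        conv_lhs => rw [← b.sum_repr x']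
        rw [← Finset.sum_sub_distrib, Finset.smul_sum]
        refine Finset.sum_congr rfl fun i _ => ?_
        rw [← sub_smul, hnw, mul_smul]
      have h3 := congrArg (fun y : W => ((y : locInt ℓ E) : LocField ℓ E)) h2
      have h4 : ((((ℓ : ℤ_[ℓ]) • ∑ i, w i • (b i) : W) : locInt ℓ E) : LocField ℓ E)
          = ℓ * ((∑ i, w i • (b i) : W) : LocField ℓ E) := by
        rw [Submodule.coe_smul, Algebra.smul_def, map_natCast]
        simp
      rw [← h4, ← h3]
      rfl

lemma norm_natCast_prime : ‖Algebra.norm ℚ_[ℓ] (ℓ : LocField ℓ E)‖ = ((ℓ : ℝ) ^ Module.finrank ℚ E)⁻¹ := by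
  have : (ℓ : LocField ℓ E) = algebraMap ℚ_[ℓ] _ (ℓ : ℚ_[ℓ]) := by simp
  rw [this, Algebra.norm_algebraMap, finrank_locField]
  simp

variable (hℓ : Squarefree (Ideal.span {(ℓ : 𝓞 E)}))
include hℓ

/-- Scale a nilpotent element into the order. It is divisible by ℓ there because the reduction is
reduced, its quotient by ℓ is nilpotent again, and so on: it is divisible by all powers of ℓ. -/
lemma isReduced_locField : IsReduced (LocField ℓ E) := by
  constructor
  rintro x ⟨n, hn⟩
  have hu : IsUnit (ℓ : LocField ℓ E) := isUnit_natCast_locField ℓ E (Fact.out : ℓ.Prime).ne_zero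
  obtain ⟨k, hk⟩ := exists_pow_mul_mem_locInt ℓ E x
  have key : ∀ j, ∀ y : locInt ℓ E, y ^ n = 0 → (ℓ : locInt ℓ E) ^ j ∣ y := by
    intro j
    induction j with
    | zero => intro y _; simp
    | succ j ih =>
      intro y hy
      obtain ⟨z, hz⟩ := dvd_of_dvd_pow_locInt ℓ E hℓ (x := y) (n := n) (by rw [hy]; exact dvd_zero _)
      have hzn : z ^ n = 0 := by
        rw [hz, mul_pow] at hy
        have h2 := congrArg Subtype.val hy
        have h3 : (ℓ : LocField ℓ E) ^ n * (z : LocField ℓ E) ^ n = 0 := by simpa using h2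
        have h4 := (IsUnit.mul_right_eq_zero (hu.pow n)).1 h3
        exact Subtype.ext (by simpa using h4)
      rw [hz, pow_succ, mul_comm]
      exact mul_dvd_mul_left _ (ih z hzn)
  have h0 : (⟨_, hk⟩ : locInt ℓ E) = 0 := by
    refine eq_zero_of_forall_pow_dvd ℓ E fun j => key j _ (Subtype.ext ?_)
    simp [mul_pow, hn]
  exact (IsUnit.mul_right_eq_zero (hu.pow k)).1 (congrArg Subtype.val h0)

/-- If `ℓ` is unramified in `E`, then `ℤ_ℓ ⊗ 𝓞 E` is an unramified order. -/
theorem isUnramifiedOrder_locInt :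
    IsUnramifiedOrder (locInt ℓ E).toSubring (ℓ : LocField ℓ E) where
  mem := natCast_mem _ _
  isUnit := isUnit_natCast_locField ℓ E (Fact.out : ℓ.Prime).ne_zero
  exists_pow_mul_mem := exists_pow_mul_mem_locInt ℓ E
  isNoetherianRing := inferInstanceAs (IsNoetherianRing (locInt ℓ E))
  exists_idem x hx := by
    obtain ⟨e, he, ⟨y, hy⟩, z, hz⟩ := exists_idem_locInt ℓ E hℓ ⟨x, hx⟩
    refine ⟨e, e.2, congrArg Subtype.val he, ⟨y, y.2, congrArg Subtype.val hy⟩, z, z.2, ?_⟩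
    have := congrArg Subtype.val hz
    simpa using this
  idem_eq_zero e he z hz hez := idem_eq_zero_locInt ℓ E he hz hez

end LocInt

/-! ### Modulus characters -/

section Modulus

variable (ℓ : ℕ) [Fact ℓ.Prime] (n : ℕ)
variable (F : Type*) [Field F] [NumberField F]

/-- The `ℓ`-adic absolute value of the norm of a unit of `F_ℓ`, as a homomorphism. -/
def absNorm : (LocField ℓ F)ˣ →* ℝ where
  toFun x := ‖Algebra.norm ℚ_[ℓ] (x : LocField ℓ F)‖
  map_one' := by simp
  map_mul' x y := by simp

lemma absNorm_apply (x : (LocField ℓ F)ˣ) : absNorm ℓ F x = ‖Algebra.norm ℚ_[ℓ] (x : LocField ℓ F)‖ := rfl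

lemma absNorm_mul_inv (x : (LocField ℓ F)ˣ) : absNorm ℓ F x * absNorm ℓ F x⁻¹ = 1 := by
  rw [← map_mul, mul_inv_cancel, map_one]

lemma absNorm_pos (x : (LocField ℓ F)ˣ) : 0 < absNorm ℓ F x := by
  have h0 : 0 ≤ absNorm ℓ F x := by rw [absNorm_apply]; exact norm_nonneg _
  refine lt_of_le_of_ne h0 fun h => ?_
  have := absNorm_mul_inv ℓ F x
  rw [← h, zero_mul] at this
  exact zero_ne_one this

lemma absNorm_inv (x : (LocField ℓ F)ˣ) : absNorm ℓ F x⁻¹ = (absNorm ℓ F x)⁻¹ :=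
  eq_inv_of_mul_eq_one_right (absNorm_mul_inv ℓ F x)

lemma absNorm_eq_one {x : (LocField ℓ F)ˣ} (hx : (x : LocField ℓ F) ∈ locInt ℓ F)
    (hx' : ((x⁻¹ : (LocField ℓ F)ˣ) : LocField ℓ F) ∈ locInt ℓ F) : absNorm ℓ F x = 1 :=
  norm_norm_eq_one ℓ F hx hx' (Units.mul_inv x)

/-- The pairs `i < j` of indices. -/
abbrev UpperPairs : Type := {p : Fin n × Fin n // p.1 < p.2}

/-- Coordinates on the space of strictly upper triangular matrices. -/
def lieUnipotentEquiv : lieUnipotent n (LocField ℓ F) ℚ_[ℓ] ≃ₗ[ℚ_[ℓ]] (UpperPairs n → LocField ℓ F) where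
  toFun X p := X.1 p.1.1 p.1.2
  map_add' _ _ := rfl
  map_smul' _ _ := rfl
  invFun f := ⟨Matrix.of fun i j => if h : i < j then f ⟨(i, j), h⟩ else 0,
    fun i j h => by simp [h.not_gt]⟩
  left_inv X := by
    ext i j
    by_cases h : i < j
    · simp [h]
    · simp [h, X.2 i j (not_lt.1 h)]
  right_inv f := by
    ext ⟨⟨i, j⟩, h⟩
    have h : i < j := h
    simp [h]

instance : Module.Finite ℚ_[ℓ] (Matrix (Fin n) (Fin n) (LocField ℓ F)) := Module.Finite.matrix

/-- Conjugation acts on the entry (i, j) as multiplication by t_i / t_j, whose determinant over ℚ_ℓ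
is the algebra norm. -/
lemma norm_det_adDiag (t : Fin n → (LocField ℓ F)ˣ) :
    ‖LinearMap.det ((adDiag ℚ_[ℓ] t).restrict (adDiag_mem (R := LocField ℓ F) ℚ_[ℓ] t))‖
      = ∏ p : UpperPairs n, (absNorm ℓ F (t p.1.1) * (absNorm ℓ F (t p.1.2))⁻¹) := by
  have h1 : ((adDiag ℚ_[ℓ] t).restrict (adDiag_mem (R := LocField ℓ F) ℚ_[ℓ] t))
      = (lieUnipotentEquiv ℓ n F).symm.toLinearMap ∘ₗ
        (LinearMap.pi fun p : UpperPairs n => (LinearMap.mulLeft ℚ_[ℓ]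
          ((t p.1.1 * (t p.1.2)⁻¹ : (LocField ℓ F)ˣ) : LocField ℓ F)).comp (LinearMap.proj p)) ∘ₗ
        (lieUnipotentEquiv ℓ n F).symm.symm.toLinearMap := by
    rw [LinearEquiv.symm_symm, ← LinearEquiv.toLinearMap_symm_comp_eq, LinearEquiv.symm_symm]
    refine LinearMap.ext fun X => funext fun p => ?_
    change (t p.1.1 : LocField ℓ F) * X.1 p.1.1 p.1.2 * ((t p.1.2)⁻¹ : (LocField ℓ F)ˣ)
      = ((t p.1.1 * (t p.1.2)⁻¹ : (LocField ℓ F)ˣ) : LocField ℓ F) * X.1 p.1.1 p.1.2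
    rw [Units.val_mul]; ring
  rw [h1, LinearMap.det_conj, LinearMap.det_pi, norm_prod]
  refine Finset.prod_congr rfl fun p _ => ?_
  rw [← absNorm_inv, ← map_mul]
  rfl

variable [IsCMField F]

/-- Any nonzero difference z - conj z of `F` will do. Multiplication by it exchanges hermitian and
antihermitian matrices. -/
lemma exists_conj_eq_neg : ∃ η : (LocField ℓ F)ˣ, locConj ℓ F (η : LocField ℓ F) = -η ∧
    locConj ℓ F ((η⁻¹ : (LocField ℓ F)ˣ) : LocField ℓ F) = -((η⁻¹ : (LocField ℓ F)ˣ) : LocField ℓ F) := by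
  obtain ⟨z, hz⟩ : ∃ z : F, IsCMField.complexConj F z ≠ z := by
    by_contra! h
    exact IsCMField.complexConj_ne_one F (AlgEquiv.ext h)
  have hz0 : z - IsCMField.complexConj F z ≠ 0 := sub_ne_zero.2 hz.symm
  refine ⟨Units.map (toLoc ℓ F).toMonoidHom (Units.mk0 _ hz0), ?_, ?_⟩
  · change locConj ℓ F (toLoc ℓ F (z - IsCMField.complexConj F z)) = - toLoc ℓ F (z - IsCMField.complexConj F z)
    rw [locConj_toLoc, ← map_neg, map_sub, IsCMField.complexConj_apply_apply, neg_sub]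
  · change locConj ℓ F (toLoc ℓ F (z - IsCMField.complexConj F z)⁻¹) = - toLoc ℓ F (z - IsCMField.complexConj F z)⁻¹
    rw [locConj_toLoc, ← map_neg, map_inv₀, map_sub, IsCMField.complexConj_apply_apply, ← neg_sub, inv_neg]

lemma dagger_dagger (X : Matrix (Fin n) (Fin n) (LocField ℓ F)) :
    (dagger ℓ n F (dagger ℓ n F X).unop).unop = X := by
  ext i j
  rw [dagger_apply, dagger_apply, locConj_locConj, Fin.rev_rev, Fin.rev_rev]

lemma dagger_smul (a : LocField ℓ F) (X : Matrix (Fin n) (Fin n) (LocField ℓ F)) :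
    (dagger ℓ n F (a • X)).unop = locConj ℓ F a • (dagger ℓ n F X).unop := by
  ext i j
  simp [dagger_apply]

lemma dagger_mem_lieUnipotent {X : Matrix (Fin n) (Fin n) (LocField ℓ F)}
    (hX : X ∈ lieUnipotent n (LocField ℓ F) ℚ_[ℓ]) :
    (dagger ℓ n F X).unop ∈ lieUnipotent n (LocField ℓ F) ℚ_[ℓ] := fun i j h => by
  rw [dagger_apply, hX _ _ (Fin.rev_le_rev.2 h), map_zero]

/-- A strictly upper triangular matrix is the sum of an antihermitian one and of `η` times an
antihermitian one, if `η` is antihermitian. -/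
def lieGUProdEquiv (η : (LocField ℓ F)ˣ) (hη : locConj ℓ F (η : LocField ℓ F) = -η)
    (hη' : locConj ℓ F ((η⁻¹ : (LocField ℓ F)ˣ) : LocField ℓ F) = -((η⁻¹ : (LocField ℓ F)ˣ) : LocField ℓ F)) :
    (lieGU ℓ n F × lieGU ℓ n F) ≃ₗ[ℚ_[ℓ]] lieUnipotent n (LocField ℓ F) ℚ_[ℓ] where
  toFun X := ⟨X.1.1 + (η : LocField ℓ F) • X.2.1, Submodule.add_mem _ X.1.2.1
    (fun i j h => by rw [Matrix.smul_apply, X.2.2.1 i j h, smul_zero])⟩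
  map_add' X Y := by
    ext i j; simp only [Prod.fst_add, Prod.snd_add, Submodule.coe_add, Matrix.add_apply,
      Matrix.smul_apply, smul_eq_mul]; ring
  map_smul' c X := by
    ext i j; simp [smul_add]
  invFun Z := (⟨(2⁻¹ : ℚ_[ℓ]) • (Z.1 - (dagger ℓ n F Z.1).unop), by
      refine Submodule.smul_mem _ _ (Submodule.sub_mem _ Z.2 (dagger_mem_lieUnipotent ℓ n F Z.2)), by
      rw [map_smul, map_sub, MulOpposite.unop_smul, MulOpposite.unop_sub, dagger_dagger, ← smul_add]
      simp⟩,
    ⟨(2⁻¹ : ℚ_[ℓ]) • ((η⁻¹ : (LocField ℓ F)ˣ) : LocField ℓ F) • (Z.1 + (dagger ℓ n F Z.1).unop), by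
      refine Submodule.smul_mem _ _ fun i j h => ?_
      rw [Matrix.smul_apply, Submodule.add_mem _ Z.2 (dagger_mem_lieUnipotent ℓ n F Z.2) i j h, smul_zero], by
      rw [map_smul, MulOpposite.unop_smul, dagger_smul, hη', map_add, MulOpposite.unop_add, dagger_dagger,
        ← smul_add, neg_smul, add_comm (dagger ℓ n F Z.1).unop, add_neg_cancel, smul_zero]⟩)
  left_inv := by
    rintro ⟨⟨X, hX, hX'⟩, ⟨Y, hY, hY'⟩⟩
    have e1 : (dagger ℓ n F X).unop = -X := (neg_eq_of_add_eq_zero_right hX').symm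
    have e2 : (dagger ℓ n F Y).unop = -Y := (neg_eq_of_add_eq_zero_right hY').symm
    have e3 : (dagger ℓ n F (X + (η : LocField ℓ F) • Y)).unop = -X + (η : LocField ℓ F) • Y := by
      rw [map_add, MulOpposite.unop_add, dagger_smul, e1, e2, hη, smul_neg, neg_smul, neg_neg]
    have h2 : (2⁻¹ : ℚ_[ℓ]) + 2⁻¹ = 1 := by norm_num
    ext1
    · refine Subtype.ext ?_
      change (2⁻¹ : ℚ_[ℓ]) • (X + (η : LocField ℓ F) • Y - (dagger ℓ n F (X + (η : LocField ℓ F) • Y)).unop) = X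
      rw [e3]
      have : X + (η : LocField ℓ F) • Y - (-X + (η : LocField ℓ F) • Y) = X + X := by abel
      rw [this, smul_add, ← add_smul, h2, one_smul]
    · refine Subtype.ext ?_
      change (2⁻¹ : ℚ_[ℓ]) • ((η⁻¹ : (LocField ℓ F)ˣ) : LocField ℓ F) •
        (X + (η : LocField ℓ F) • Y + (dagger ℓ n F (X + (η : LocField ℓ F) • Y)).unop) = Y
      rw [e3]
      have : X + (η : LocField ℓ F) • Y + (-X + (η : LocField ℓ F) • Y)
          = (η : LocField ℓ F) • (Y + Y) := by rw [smul_add]; abel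
      rw [this, smul_smul, Units.inv_mul, one_smul, smul_add, ← add_smul, h2, one_smul]
  right_inv := by
    rintro ⟨Z, hZ⟩
    have h2 : (2⁻¹ : ℚ_[ℓ]) + 2⁻¹ = 1 := by norm_num
    refine Subtype.ext ?_
    change (2⁻¹ : ℚ_[ℓ]) • (Z - (dagger ℓ n F Z).unop) + (η : LocField ℓ F) •
      ((2⁻¹ : ℚ_[ℓ]) • ((η⁻¹ : (LocField ℓ F)ˣ) : LocField ℓ F) • (Z + (dagger ℓ n F Z).unop)) = Z
    rw [smul_comm (η : LocField ℓ F) (2⁻¹ : ℚ_[ℓ]), smul_smul (η : LocField ℓ F), Units.mul_inv, one_smul,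
      ← smul_add]
    have : Z - (dagger ℓ n F Z).unop + (Z + (dagger ℓ n F Z).unop) = Z + Z := by abel
    rw [this, smul_add, ← add_smul, h2, one_smul]

/-- Multiplication by an antihermitian unit η commutes with Ad t, so the nilpotent Lie algebra of
GL_n is a sum of two copies of `lieGU` as a module under Ad t. This avoids coordinates on `lieGU`.
-/
lemma GUmodulus_sq (t : GUtorus ℓ n F) :
    GUmodulus ℓ n F t ^ 2 = ∏ p : UpperPairs n, (absNorm ℓ F (t.1 p.1.1) * (absNorm ℓ F (t.1 p.1.2))⁻¹) := by
  obtain ⟨η, hη, hη'⟩ := exists_conj_eq_neg ℓ F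
  let f := (adDiag ℚ_[ℓ] t.1).restrict (adDiag_mem_lieGU ℓ n F t)
  let e := lieGUProdEquiv ℓ n F η hη hη'
  have h1 : (adDiag ℚ_[ℓ] t.1).restrict (adDiag_mem (R := LocField ℓ F) ℚ_[ℓ] t.1)
      = e.toLinearMap ∘ₗ (LinearMap.prodMap f f) ∘ₗ e.symm.toLinearMap := by
    rw [← LinearMap.comp_assoc, LinearEquiv.eq_comp_toLinearMap_symm]
    refine LinearMap.ext fun ⟨X, Y⟩ => Subtype.ext ?_
    change adDiag ℚ_[ℓ] t.1 (X.1 + (η : LocField ℓ F) • Y.1)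
      = adDiag ℚ_[ℓ] t.1 X.1 + (η : LocField ℓ F) • adDiag ℚ_[ℓ] t.1 Y.1
    rw [map_add]
    congr 1
    ext i j
    simp only [adDiag, LinearMap.coe_mk, AddHom.coe_mk, Matrix.of_apply, Matrix.smul_apply, smul_eq_mul]
    ring
  rw [← norm_det_adDiag, h1, LinearMap.det_conj, LinearMap.det_prodMap, norm_mul, ← sq]
  rfl

lemma GUmodulus_pos (t : GUtorus ℓ n F) : 0 < GUmodulus ℓ n F t := by
  refine lt_of_le_of_ne (norm_nonneg _) fun h => ?_
  have h1 := GUmodulus_sq ℓ n F t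
  rw [← h, zero_pow two_ne_zero] at h1
  exact (Finset.prod_pos fun p _ => mul_pos (absNorm_pos ℓ F _) (inv_pos.2 (absNorm_pos ℓ F _))).ne h1

lemma GUmodulus_eq_one {t : GUtorus ℓ n F} (ht : ∀ i, absNorm ℓ F (t.1 i) = 1) : GUmodulus ℓ n F t = 1 := by
  have h := GUmodulus_sq ℓ n F t
  simp only [ht, inv_one, mul_one, Finset.prod_const_one] at h
  exact (sq_eq_sq₀ (GUmodulus_pos ℓ n F t).le zero_le_one).1 (by rw [h, one_pow])

lemma GUmodulus_mul (s t : GUtorus ℓ n F) :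
    GUmodulus ℓ n F (s * t) = GUmodulus ℓ n F s * GUmodulus ℓ n F t := by
  refine (sq_eq_sq₀ (GUmodulus_pos ℓ n F _).le
    (mul_pos (GUmodulus_pos ℓ n F _) (GUmodulus_pos ℓ n F _)).le).1 ?_
  rw [mul_pow, GUmodulus_sq, GUmodulus_sq, GUmodulus_sq, ← Finset.prod_mul_distrib]
  refine Finset.prod_congr rfl fun p _ => ?_
  simp only [Subgroup.coe_mul, Pi.mul_apply, map_mul, mul_inv]
  ring

lemma absNorm_conj (x : (LocField ℓ F)ˣ) :
    absNorm ℓ F (Units.map (locConj ℓ F).toRingHom.toMonoidHom x) = absNorm ℓ F x := by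
  let e : LocField ℓ F ≃ₐ[ℚ_[ℓ]] LocField ℓ F := AlgEquiv.ofAlgHom (locConj ℓ F) (locConj ℓ F)
    (AlgHom.ext (locConj_locConj ℓ F)) (AlgHom.ext (locConj_locConj ℓ F))
  exact congrArg norm (Algebra.norm_eq_of_algEquiv e (x : LocField ℓ F))

variable (𝒦 : Type*) [Field 𝒦] [NumberField 𝒦] [Algebra 𝒦 F]

omit [IsCMField F] [Algebra 𝒦 F] in
lemma GPlusModulus_eq (t : GPlusTorus ℓ n F 𝒦) : GPlusModulus ℓ n F 𝒦 t
    = ∏ p : UpperPairs n, (absNorm ℓ F (t.2 p.1.1) * (absNorm ℓ F (t.2 p.1.2))⁻¹) :=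
  norm_det_adDiag ℓ n F t.2

variable [IsTotallyComplex 𝒦] [Algebra.IsQuadraticExtension ℚ 𝒦]

/-- Entry i of the norm of (c, a) has absolute value |c| |a_i| / |a_(rev i)|. In the squared modulus
|c| cancels, and the map (i, j) ↦ (rev j, rev i) on the pairs i < j turns the contribution of the
denominators into a second copy of the modulus of `a`. Moduli are positive, so comparing squares is
enough. -/
lemma GUmodulus_torusNorm (t : GPlusTorus ℓ n F 𝒦) :
    GUmodulus ℓ n F (torusNorm ℓ n F 𝒦 t) = GPlusModulus ℓ n F 𝒦 t := by
  have hpos : 0 < GPlusModulus ℓ n F 𝒦 t := by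
    rw [GPlusModulus_eq]
    exact Finset.prod_pos fun p _ => mul_pos (absNorm_pos ℓ F _) (inv_pos.2 (absNorm_pos ℓ F _))
  refine (sq_eq_sq₀ (GUmodulus_pos ℓ n F _).le hpos.le).1 ?_
  rw [GUmodulus_sq]
  obtain ⟨c, a⟩ := t
  have h1 : ∀ i, absNorm ℓ F ((torusNorm ℓ n F 𝒦 (c, a)).1 i)
      = absNorm ℓ F (Units.map (locEmb ℓ F 𝒦).toRingHom.toMonoidHom c) * absNorm ℓ F (a i)
        * (absNorm ℓ F (a i.rev))⁻¹ := by
    intro i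
    change absNorm ℓ F (_ * _ * _⁻¹) = _
    rw [map_mul, map_mul, absNorm_inv, absNorm_conj, absNorm_conj]
  have h2 : ∏ p : UpperPairs n, (absNorm ℓ F (a p.1.2.rev) * (absNorm ℓ F (a p.1.1.rev))⁻¹)
      = ∏ p : UpperPairs n, (absNorm ℓ F (a p.1.1) * (absNorm ℓ F (a p.1.2))⁻¹) := by
    let σ : UpperPairs n → UpperPairs n := fun p => ⟨(p.1.2.rev, p.1.1.rev), Fin.rev_lt_rev.2 p.2⟩
    have hσ : Function.Involutive σ := fun p => by simp [σ]
    exact Equiv.prod_comp hσ.toPerm (fun p : UpperPairs n => absNorm ℓ F (a p.1.1) * (absNorm ℓ F (a p.1.2))⁻¹)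
  rw [GPlusModulus_eq, sq]
  conv_rhs => enter [2]; rw [← h2]
  rw [← Finset.prod_mul_distrib]
  refine Finset.prod_congr rfl fun p _ => ?_
  rw [h1, h1]
  have hc := (absNorm_pos ℓ F (Units.map (locEmb ℓ F 𝒦).toRingHom.toMonoidHom c)).ne'
  have h3 := (absNorm_pos ℓ F (a p.1.1)).ne'
  have h4 := (absNorm_pos ℓ F (a p.1.2)).ne'
  have h5 := (absNorm_pos ℓ F (a p.1.1.rev)).ne'
  have h6 := (absNorm_pos ℓ F (a p.1.2.rev)).ne'
  field_simp

end Modulus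

/-! ### Elements of trace one -/

section Trace

variable (F : Type*) [Field F] [NumberField F] [IsCMField F]

local notation "σF" => IsCMField.ringOfIntegersComplexConj F
local notation "O₀" => 𝓞 (maximalRealSubfield F)

lemma ringOfIntegersComplexConj_involutive (x : 𝓞 F) : σF (σF x) = x :=
  RingOfIntegers.ext (IsCMField.complexConj_apply_apply F x)

/-- If `2` is unramified in `F`, there is an integer `x` with `x + conj x = 1`. -/
lemma exists_add_conj_eq_one_of_two (h2 : Squarefree (Ideal.span {(2 : 𝓞 F)})) :
    ∃ x : 𝓞 F, x + σF x = 1 := by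
  have hfix : ∀ y : 𝓞 F, σF y = y → ∃ t : O₀, algebraMap O₀ (𝓞 F) t = y := fun y hy =>
    (IsCMField.ringOfIntegersComplexConj_eq_self_iff F y).1 hy
  have htr : ∀ y : 𝓞 F, ∃ t : O₀, algebraMap O₀ (𝓞 F) t = y + σF y := fun y => hfix _ (by
    rw [map_add, ringOfIntegersComplexConj_involutive, add_comm])
  have hnm : ∀ y : 𝓞 F, ∃ t : O₀, algebraMap O₀ (𝓞 F) t = y * σF y := fun y => hfix _ (by
    rw [map_mul, ringOfIntegersComplexConj_involutive, mul_comm])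
  -- The ideal of traces. If it is proper, it lies in a maximal ideal `p`, which contains 2, the
  -- trace of 1. The aim is to show that conjugation would then be trivial on 𝓞 F.
  let I : Ideal O₀ :=
    { carrier := {t | ∃ y : 𝓞 F, algebraMap O₀ (𝓞 F) t = y + σF y}
      zero_mem' := ⟨0, by simp⟩
      add_mem' := by
        rintro s t ⟨x, hx⟩ ⟨y, hy⟩
        exact ⟨x + y, by rw [map_add, hx, hy, map_add]; ring⟩
      smul_mem' := by
        rintro c t ⟨x, hx⟩
        refine ⟨algebraMap O₀ (𝓞 F) c * x, ?_⟩
        rw [smul_eq_mul, map_mul, hx, map_mul, AlgEquiv.commutes]; ring }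
  by_cases hI : I = ⊤
  · have : (1 : O₀) ∈ I := hI ▸ Submodule.mem_top
    obtain ⟨y, hy⟩ := this
    exact ⟨y, by rw [← hy, map_one]⟩
  exfalso
  obtain ⟨p, hp, hIp⟩ := Ideal.exists_le_maximal I hI
  have h2p : (2 : O₀) ∈ p := hIp ⟨1, by rw [map_one, map_ofNat]; norm_num⟩
  set J : Ideal (𝓞 F) := p.map (algebraMap O₀ (𝓞 F)) with hJ
  have h2J : (2 : 𝓞 F) ∈ J := by
    have := Ideal.mem_map_of_mem (algebraMap O₀ (𝓞 F)) h2p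
    rwa [map_ofNat] at this
  have hJ0 : J ≠ 0 := by
    intro h
    rw [h] at h2J
    exact two_ne_zero h2J
  have hJsq : Squarefree J := h2.squarefree_of_dvd (by
    rw [Ideal.dvd_span_singleton]; exact h2J)
  -- J = p 𝓞 F divides 2, so it is square-free, hence radical.
  have hrad : ∀ y : 𝓞 F, y ^ 2 ∈ J → y ∈ J := by
    intro y hy
    have := (isRadical_iff_squarefree_of_ne_zero hJ0).2 hJsq 2 (Ideal.span {y})
    rw [Ideal.span_singleton_pow, Ideal.dvd_span_singleton, Ideal.dvd_span_singleton] at this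
    exact this hy
  have hJtop : J ≠ ⊤ := by
    rw [hJ, Ne, Ideal.map_eq_top_iff _ (FaithfulSMul.algebraMap_injective _ _)
      (algebraMap_isIntegral_iff.2 inferInstance)]
    exact hp.ne_top
  have hp0 : p ≠ ⊥ := by
    rintro rfl
    rw [Ideal.mem_bot] at h2p
    exact two_ne_zero h2p
  have hσJ : ∀ y ∈ J, σF y ∈ J := by
    intro y hy
    have : J.map (σF : 𝓞 F →+* 𝓞 F) = J := by
      rw [hJ, Ideal.map_map]
      congr 1
      ext1 t
      exact (IsCMField.ringOfIntegersComplexConj F).commutes t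
    rw [← this]
    exact Ideal.mem_map_of_mem (σF : 𝓞 F →+* 𝓞 F) hy
  -- Both the trace of `y` and 2 are in `J`.
  have c1 : ∀ y : 𝓞 F, y - σF y ∈ J := by
    intro y
    obtain ⟨t, ht⟩ := htr y
    have h1 : y + σF y ∈ J := by
      rw [← ht]; exact Ideal.mem_map_of_mem _ (hIp ⟨y, ht⟩)
    have : y - σF y = (y + σF y) - 2 * σF y := by ring
    rw [this]
    exact J.sub_mem h1 (J.mul_mem_right _ h2J)
  -- The residue field of `p` is finite of characteristic two, so the norm of `y` is a square c² in
  -- it. Modulo `J`, y² is the norm of `y` by the previous step, so (y - c)² is in the radical ideal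
  -- `J`.
  have c2 : ∀ y : 𝓞 F, ∃ c : O₀, y - algebraMap O₀ (𝓞 F) c ∈ J := by
    intro y
    obtain ⟨N, hN⟩ := hnm y
    have : Finite (O₀ ⧸ p) := p.finiteQuotientOfFreeOfNeBot hp0
    let : Field (O₀ ⧸ p) := Ideal.Quotient.field p
    have hchar : ringChar (O₀ ⧸ p) = 2 := by
      have h20 : (2 : O₀ ⧸ p) = 0 := by
        rw [← map_ofNat (Ideal.Quotient.mk p) 2, Ideal.Quotient.eq_zero_iff_mem]; exact h2p
      exact CharP.ringChar_of_prime_eq_zero Nat.prime_two (by exact_mod_cast h20)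
    have := Fintype.ofFinite (O₀ ⧸ p)
    obtain ⟨c', hc'⟩ := FiniteField.isSquare_of_char_two hchar (Ideal.Quotient.mk p N)
    obtain ⟨c, rfl⟩ := Ideal.Quotient.mk_surjective c'
    rw [← map_mul, Ideal.Quotient.eq] at hc'
    refine ⟨c, hrad _ ?_⟩
    have h3 := Ideal.mem_map_of_mem (algebraMap O₀ (𝓞 F)) hc'
    rw [map_sub, map_mul, hN] at h3
    have : (y - algebraMap O₀ (𝓞 F) c) ^ 2 = y * (y - σF y) + (y * σF y - algebraMap O₀ (𝓞 F) c * algebraMap O₀ (𝓞 F) c)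
        + 2 * (algebraMap O₀ (𝓞 F) c * algebraMap O₀ (𝓞 F) c - y * algebraMap O₀ (𝓞 F) c) := by ring
    rw [this]
    exact J.add_mem (J.add_mem (J.mul_mem_left _ (c1 y)) h3) (J.mul_mem_right _ h2J)
  -- Subtracting an element of O₀, `y` may be assumed to lie in J = p 𝓞 F. Since `p` is fixed by
  -- conjugation, the difference with the conjugate gains one more factor `J`. Krull's intersection
  -- theorem then gives y = conj y for all `y`.
  have c3 : ∀ k : ℕ, ∀ y : 𝓞 F, y - σF y ∈ J ^ k := by
    intro k
    induction k with
    | zero => intro y; simp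
    | succ k ih =>
      have key : ∀ z ∈ J, z - σF z ∈ J ^ (k + 1) := by
        intro z hz
        rw [hJ, Ideal.map] at hz
        have : z ∈ J ∧ z - σF z ∈ J ^ (k + 1) := by
          induction hz using Submodule.span_induction with
          | mem z hz =>
            obtain ⟨t, ht, rfl⟩ := hz
            refine ⟨Ideal.mem_map_of_mem _ ht, ?_⟩
            rw [AlgEquiv.commutes, sub_self]; exact Submodule.zero_mem _
          | zero => simp
          | add x y _ _ hx hy =>
            refine ⟨J.add_mem hx.1 hy.1, ?_⟩
            have : x + y - σF (x + y) = (x - σF x) + (y - σF y) := by rw [map_add]; ring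
            rw [this]; exact Submodule.add_mem _ hx.2 hy.2
          | smul a x _ hx =>
            refine ⟨J.mul_mem_left _ hx.1, ?_⟩
            have : a • x - σF (a • x) = a * (x - σF x) + (a - σF a) * σF x := by
              rw [smul_eq_mul, map_mul]; ring
            rw [this]
            refine Submodule.add_mem _ (Ideal.mul_mem_left _ _ hx.2) ?_
            rw [pow_succ]
            exact Ideal.mul_mem_mul (ih a) (hσJ _ hx.1)
        exact this.2
      intro y
      obtain ⟨c, hc⟩ := c2 y
      have := key _ hc
      rwa [map_sub, AlgEquiv.commutes, sub_sub_sub_cancel_right] at this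
  have hfixall : ∀ y : 𝓞 F, σF y = y := by
    intro y
    have : y - σF y ∈ ⨅ k : ℕ, J ^ k := by
      rw [Submodule.mem_iInf]; exact fun k => c3 k y
    rw [Ideal.iInf_pow_eq_bot_of_isDomain J hJtop, Ideal.mem_bot] at this
    exact (sub_eq_zero.1 this).symm
  refine IsCMField.complexConj_ne_one F (AlgEquiv.ext fun x => ?_)
  obtain ⟨a, b, -, rfl⟩ := IsFractionRing.div_surjective (A := 𝓞 F) x
  rw [map_div₀, AlgEquiv.one_apply]
  have ha := congrArg (algebraMap (𝓞 F) F) (hfixall a)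
  have hb := congrArg (algebraMap (𝓞 F) F) (hfixall b)
  exact congrArg₂ _ ha hb

variable (ℓ : ℕ) [Fact ℓ.Prime]

/-- For odd ℓ the element 1/2 has trace one; only ℓ = 2 needs the ramification hypothesis. -/
lemma exists_add_locConj_eq_one (hℓ : Squarefree (Ideal.span {(ℓ : 𝓞 F)})) :
    ∃ x ∈ locInt ℓ F, x + locConj ℓ F x = 1 := by
  rcases eq_or_ne ℓ 2 with rfl | h2
  · obtain ⟨x, hx⟩ := exists_add_conj_eq_one_of_two F (by simpa using hℓ)
    refine ⟨_, toLoc_mem_locInt 2 F x, ?_⟩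
    rw [locConj_toLoc, ← map_add, ← map_one (toLoc 2 F)]
    exact congrArg (toLoc 2 F) (congrArg (algebraMap (𝓞 F) F) hx)
  · have hu : IsUnit (2 : ℤ_[ℓ]) := by
      rw [PadicInt.isUnit_iff]
      refine le_antisymm (PadicInt.norm_le_one _) (not_lt.1 fun h => ?_)
      have := (PadicInt.norm_int_lt_one_iff_dvd (p := ℓ) 2).1 (by exact_mod_cast h)
      have h3 := (Nat.prime_dvd_prime_iff_eq (Fact.out : ℓ.Prime) Nat.prime_two).1 (by exact_mod_cast this)
      exact h2 h3
    obtain ⟨u, hu⟩ := hu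
    refine ⟨algebraMap ℤ_[ℓ] _ ((u⁻¹ : ℤ_[ℓ]ˣ) : ℤ_[ℓ]), Subalgebra.algebraMap_mem _ _, ?_⟩
    rw [IsScalarTower.algebraMap_apply ℤ_[ℓ] ℚ_[ℓ] (LocField ℓ F), AlgHom.commutes,
      ← IsScalarTower.algebraMap_apply ℤ_[ℓ] ℚ_[ℓ] (LocField ℓ F), ← map_add, ← two_mul, ← hu, Units.mul_inv, map_one]

end Trace

/-! ### Iwasawa decomposition for the quasi-split similitude group -/

lemma mul_eq_zero_of_idem {M : Type*} [Ring M] {u v i j : M} (hu : u * i = u) (hv : j * v = v)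
    (hij : i * j = 0) : u * v = 0 := by
  rw [← hu, ← hv, mul_assoc, ← mul_assoc i, hij, zero_mul, mul_zero]

/-- A block upper triangular hermitian element `h` of a ring with involution, with respect to
idempotents `E`, `P`, `H` such that the involution swaps `E` and `H`, is of the form `β β*`, if its
middle block is, and if there is a central element `τ` with `τ + τ* = 1`. -/
lemma exists_mul_star_eq {M : Type*} [Ring M] (dag : M →+ M) (hmul : ∀ x y, dag (x * y) = dag y * dag x)
    (hinv : ∀ x, dag (dag x) = x) {E P H h g μ ν τ : M} (hsum : E + P + H = 1)
    (hEE : E * E = E) (hHH : H * H = H) (hEP : E * P = 0) (hPE : P * E = 0)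
    (hEH : E * H = 0) (hHE : H * E = 0) (hPH : P * H = 0) (hHP : H * P = 0)
    (hdE : dag E = H) (hdP : dag P = P) (hdh : dag h = h) (hgh : g * h = 1)
    (h1 : P * h * E = 0) (h2 : H * h * E = 0) (h3 : H * h * P = 0)
    (h4 : H * g * E = 0) (h5 : H * g * P = 0)
    (hμP : μ * P = μ) (hPν : P * ν = ν) (hμν : μ * ν = P)
    (hmid : P * h * P = μ * dag μ) (hτ : ∀ x, τ * x = x * τ) (hτ1 : τ + dag τ = 1) :
    h = (E * h * E + μ + H + E * h * dag ν + τ * (E * h * H - E * h * dag ν * dag (E * h * dag ν)) * (H * g * H))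
      * dag (E * h * E + μ + H + E * h * dag ν
        + τ * (E * h * H - E * h * dag ν * dag (E * h * dag ν)) * (H * g * H)) := by
  -- In blocks for E, P, H, the element β is ((a, x, y), (0, μ, 0), (0, 0, 1)) and its adjoint is
  -- ((1, 0, y*), (0, μ*, x*), (0, 0, a*)). Comparing β β* with `h` leaves a y* + y a* = c in the
  -- corner. The choice y = τ c (a*)⁻¹ solves this as τ + τ* = 1 and c* = c, the inverse of a* = H h
  -- H on its block being H g H.
  have hdH : dag H = E := by rw [← hdE, hinv]
  set x := E * h * dag ν with hx
  set c := E * h * H - x * dag x with hc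
  set y := τ * c * (H * g * H) with hy
  set a := E * h * E with ha
  have hdνP : dag ν * P = dag ν := by rw [← hdP, ← hmul, hPν]
  have hxP : x * P = x := by rw [hx, mul_assoc, hdνP]
  have hyH : y * H = y := by rw [hy, mul_assoc, mul_assoc (H * g), hHH]
  have haE : a * E = a := by rw [ha, mul_assoc, hEE]
  have hda : dag a = H * h * H := by rw [ha, hmul, hmul, hdh, hdE, mul_assoc]
  have hdx : dag x = ν * h * H := by rw [hx, hmul, hmul, hinv, hdh, hdE, mul_assoc]
  have hEx : E * x = x := by rw [hx, ← mul_assoc, ← mul_assoc, hEE]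
  have hdxH : dag x * H = dag x := by rw [hdx, mul_assoc, hHH]
  have hEc : E * c = c := by
    rw [hc, mul_sub, ← mul_assoc, ← mul_assoc, hEE, ← mul_assoc, hEx]
  have hcH : c * H = c := by
    have e1 : E * h * H * H = E * h * H := by rw [mul_assoc (E * h), hHH]
    have e2 : x * dag x * H = x * dag x := by rw [mul_assoc, hdxH]
    rw [hc, sub_mul, e1, e2]
  have hdc : dag c = c := by
    rw [hc, map_sub, hmul x, hinv, hmul (E * h), hmul E, hdH, hdh, hdE, mul_assoc E]
  have hHda : H * dag a = dag a := by rw [hda, ← mul_assoc, ← mul_assoc, hHH]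
  have hPdμ : P * dag μ = dag μ := by
    conv_lhs => rw [← hdP, ← hmul, hμP]
  have hPdx : P * dag x = dag x := by rw [hdx, ← mul_assoc, ← mul_assoc, hPν]
  have hEdy : E * dag y = dag y := by rw [← hdH, ← hmul, hyH]
  have hinvH : H * g * H * (H * h * H) = H := by
    have e : H * g * (E + P + H) * (h * H) = H := by
      rw [hsum, mul_one, mul_assoc, ← mul_assoc g, hgh, one_mul, hHH]
    rw [mul_add, mul_add, h4, h5, zero_add, zero_add] at e
    calc H * g * H * (H * h * H) = H * g * (H * H) * (h * H) := by noncomm_ring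
      _ = H := by rw [hHH, e]
  have e1 : y * dag a = τ * c := by
    rw [hy, hda, mul_assoc, hinvH, mul_assoc, hcH]
  have e2 : a * dag y = c * dag τ := by
    have : dag (y * dag a) = dag (τ * c) := by rw [e1]
    rwa [hmul y, hinv, hmul τ, hdc] at this
  have e3 : x * dag μ = E * h * P := by
    rw [hx, mul_assoc, ← hmul, hμν, hdP]
  have e4 : μ * dag x = P * h * H := by
    rw [hdx, ← mul_assoc, ← mul_assoc, hμν]
  have hdτ : ∀ z, dag τ * z = z * dag τ := by
    intro z
    have : dag τ = 1 - τ := eq_sub_of_add_eq' hτ1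
    rw [this, sub_mul, mul_sub, hτ, one_mul, mul_one]
  have z1 : a * dag a = 0 := mul_eq_zero_of_idem haE hHda hEH
  have z2 : a * dag μ = 0 := mul_eq_zero_of_idem haE hPdμ hEP
  have z3 : a * dag x = 0 := mul_eq_zero_of_idem haE hPdx hEP
  have z4 : μ * dag a = 0 := mul_eq_zero_of_idem hμP hHda hPH
  have z5 : μ * E = 0 := mul_eq_zero_of_idem hμP hEE hPE
  have z6 : μ * dag y = 0 := mul_eq_zero_of_idem hμP hEdy hPE
  have z7 : H * dag μ = 0 := mul_eq_zero_of_idem hHH hPdμ hHP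
  have z8 : H * dag x = 0 := mul_eq_zero_of_idem hHH hPdx hHP
  have z9 : H * dag y = 0 := mul_eq_zero_of_idem hHH hEdy hHE
  have z10 : x * dag a = 0 := mul_eq_zero_of_idem hxP hHda hPH
  have z11 : x * E = 0 := mul_eq_zero_of_idem hxP hEE hPE
  have z12 : x * dag y = 0 := mul_eq_zero_of_idem hxP hEdy hPE
  have z13 : y * dag μ = 0 := mul_eq_zero_of_idem hyH hPdμ hHP
  have z14 : y * E = 0 := mul_eq_zero_of_idem hyH hEE hHE
  have z15 : y * dag x = 0 := mul_eq_zero_of_idem hyH hPdx hHP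
  have z16 : y * dag y = 0 := mul_eq_zero_of_idem hyH hEdy hHE
  have e5 : (a + μ + H + x + y) * dag (a + μ + H + x + y)
      = a + P * h * P + P * h * H + H * h * H + E * h * P + x * dag x + (τ * c + c * dag τ) := by
    simp only [map_add, hdH, mul_add, add_mul, z1, z2, z3, z4, z5, z6, z7, z8, z9, z10, z11, z12, z13,
      z14, z15, z16, e1, e2, e3, e4, haE, hHE, hHda, ← hmid, add_zero, zero_add]
    rw [hda]
    abel
  have e6 : τ * c + c * dag τ = c := by
    rw [← hdτ, ← add_mul, hτ1, one_mul]
  have e7 : h = (E + P + H) * h * (E + P + H) := by rw [hsum, one_mul, mul_one]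
  rw [e5, e6, hc]
  conv_lhs => rw [e7]
  simp only [mul_add, add_mul, h1, h2, h3]
  rw [ha]
  abel

section GU

variable (ℓ : ℕ) [Fact ℓ.Prime] (n : ℕ)
variable (F : Type*) [Field F] [NumberField F] [IsCMField F]

/-- The involution `dagger`, as an additive map of the matrix ring into itself. -/
def dag : Matrix (Fin n) (Fin n) (LocField ℓ F) →+ Matrix (Fin n) (Fin n) (LocField ℓ F) :=
  MulOpposite.opAddEquiv.symm.toAddMonoidHom.comp (dagger ℓ n F).toRingHom.toAddMonoidHom

lemma dag_apply (X : Matrix (Fin n) (Fin n) (LocField ℓ F)) (i j : Fin n) :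
    dag ℓ n F X i j = locConj ℓ F (X j.rev i.rev) := rfl

lemma dag_mul (X Y : Matrix (Fin n) (Fin n) (LocField ℓ F)) :
    dag ℓ n F (X * Y) = dag ℓ n F Y * dag ℓ n F X :=
  congrArg MulOpposite.unop (map_mul (dagger ℓ n F) X Y)

lemma dag_dag (X : Matrix (Fin n) (Fin n) (LocField ℓ F)) : dag ℓ n F (dag ℓ n F X) = X :=
  dagger_dagger ℓ n F X

lemma dag_one : dag ℓ n F 1 = 1 := congrArg MulOpposite.unop (map_one (dagger ℓ n F))

lemma dag_diagonal (d : Fin n → LocField ℓ F) :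
    dag ℓ n F (Matrix.diagonal d) = Matrix.diagonal fun i => locConj ℓ F (d i.rev) := by
  ext i j
  rw [dag_apply, Matrix.diagonal_apply, Matrix.diagonal_apply]
  by_cases h : i = j
  · subst h; simp
  · rw [if_neg h, if_neg (fun h' => h (Fin.rev_injective h').symm), map_zero]

lemma det_dag (X : Matrix (Fin n) (Fin n) (LocField ℓ F)) :
    (dag ℓ n F X).det = locConj ℓ F X.det := by
  have : dag ℓ n F X = ((locConj ℓ F).toRingHom.mapMatrix (X.submatrix Fin.revPerm Fin.revPerm)).transpose := by
    ext i j; rfl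
  rw [this, Matrix.det_transpose, ← RingHom.map_det, Matrix.det_submatrix_equiv_self]
  rfl

/-- The ring of integral upper triangular matrices. -/
def upperInt : Subring (Matrix (Fin n) (Fin n) (LocField ℓ F)) where
  carrier := {X | (∀ i j, X i j ∈ locInt ℓ F) ∧ ∀ i j, j < i → X i j = 0}
  zero_mem' := ⟨fun _ _ => Subalgebra.zero_mem _, fun _ _ _ => rfl⟩
  one_mem' := ⟨fun i j => by
      rw [Matrix.one_apply]; split_ifs
      · exact Subalgebra.one_mem _
      · exact Subalgebra.zero_mem _, fun i j h => Matrix.one_apply_ne h.ne'⟩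
  add_mem' := fun hX hY => ⟨fun i j => Subalgebra.add_mem _ (hX.1 i j) (hY.1 i j),
    fun i j h => by rw [Matrix.add_apply, hX.2 i j h, hY.2 i j h, add_zero]⟩
  neg_mem' := fun hX => ⟨fun i j => Subalgebra.neg_mem _ (hX.1 i j),
    fun i j h => by rw [Matrix.neg_apply, hX.2 i j h, neg_zero]⟩
  mul_mem' := by
    intro X Y hX hY
    refine ⟨fun i j => ?_, fun i j h => ?_⟩
    · rw [Matrix.mul_apply]
      exact Subalgebra.sum_mem _ fun k _ => Subalgebra.mul_mem _ (hX.1 i k) (hY.1 k j)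
    · exact (Matrix.BlockTriangular.mul (b := id) (fun i j h => hX.2 i j h) (fun i j h => hY.2 i j h)) h

omit [IsCMField F] in
lemma diagonal_mem_upperInt {d : Fin n → LocField ℓ F} (hd : ∀ i, d i ∈ locInt ℓ F) :
    Matrix.diagonal d ∈ upperInt ℓ n F := by
  refine ⟨fun i j => ?_, fun i j h => Matrix.diagonal_apply_ne _ h.ne'⟩
  rw [Matrix.diagonal_apply]; split_ifs
  · exact hd i
  · exact Subalgebra.zero_mem _

lemma locConj_mem {x : LocField ℓ F} (hx : x ∈ locInt ℓ F) : locConj ℓ F x ∈ locInt ℓ F := locMap_mem ℓ _ hx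

lemma dag_mem_upperInt {X : Matrix (Fin n) (Fin n) (LocField ℓ F)} (hX : X ∈ upperInt ℓ n F) :
    dag ℓ n F X ∈ upperInt ℓ n F :=
  ⟨fun i j => locConj_mem ℓ F (hX.1 _ _), fun i j h => by
    rw [dag_apply, hX.2 _ _ (Fin.rev_lt_rev.2 h), map_zero]⟩

/-- A hermitian matrix in `GL_n(R)` that is upper triangular and of the form `k k*` is of the form
`β β*` for an upper triangular `β` in `GL_n(R)`. -/
lemma exists_upperInt_mul_dag {τ : LocField ℓ F} (hτ : τ ∈ locInt ℓ F) (hτ1 : τ + locConj ℓ F τ = 1)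
    {k : (Matrix (Fin n) (Fin n) (LocField ℓ F))ˣ} (hk : k ∈ glInt ℓ F n)
    (hU : k.val * dag ℓ n F k.val ∈ upperInt ℓ n F)
    (hU' : dag ℓ n F k⁻¹.val * k⁻¹.val ∈ upperInt ℓ n F) :
    ∃ β ∈ upperInt ℓ n F, k.val * dag ℓ n F k.val = β * dag ℓ n F β := by
  set h := k.val * dag ℓ n F k.val with hh
  set g := dag ℓ n F k⁻¹.val * k⁻¹.val with hg
  have hgh : g * h = 1 := by
    have : g * h = dag ℓ n F k⁻¹.val * (k⁻¹.val * k.val) * dag ℓ n F k.val := by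
      rw [hg, hh]; noncomm_ring
    rw [this, Units.inv_mul, mul_one, ← dag_mul, Units.mul_inv, dag_one]
  have hdh : dag ℓ n F h = h := by rw [hh, dag_mul, dag_dag]
  have hdiag : ∀ i, g i i * h i i = 1 := by
    intro i
    have h0 := congrFun (congrFun hgh i) i
    rw [Matrix.mul_apply, Matrix.one_apply_eq, Finset.sum_eq_single i] at h0
    · exact h0
    · intro j _ hj
      rcases lt_or_gt_of_ne hj with hj | hj
      · rw [hU'.2 i j hj, zero_mul]
      · rw [hU.2 j i hj, mul_zero]
    · simp
  -- `W` is the product of the diagonal entries of `h` before the middle, and `w` is its inverse.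
  let W : LocField ℓ F := ∏ i with i < i.rev, h i i
  let w : LocField ℓ F := ∏ i with i < i.rev, g i i
  have hwW : w * W = 1 := by
    rw [← Finset.prod_mul_distrib]; exact Finset.prod_eq_one fun i _ => hdiag i
  have hWR : W ∈ locInt ℓ F := Subalgebra.prod_mem _ fun i _ => hU.1 i i
  have hwR : w ∈ locInt ℓ F := Subalgebra.prod_mem _ fun i _ => hU'.1 i i
  let d := k.val.det
  let d' := k⁻¹.val.det
  have hdd' : d * d' = 1 := by
    rw [← Matrix.det_mul, Units.mul_inv, Matrix.det_one]
  have hdR : d ∈ locInt ℓ F := det_mem (R := (locInt ℓ F).toSubring) hk.1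
  have hd'R : d' ∈ locInt ℓ F := det_mem (R := (locInt ℓ F).toSubring) hk.2
  have hrev : ∀ i, h i.rev i.rev = locConj ℓ F (h i i) := by
    intro i
    conv_lhs => rw [← hdh]
    rw [dag_apply, Fin.rev_rev]
  -- The middle entry, which occurs for odd n only, must be a norm. The entries before and after the
  -- middle are conjugate, so det h = W h_mm conj W, while h = k k* has determinant d conj d. Hence
  -- h_mm is the norm of d w.
  have hmid : ∀ m : Fin n, m = m.rev → h m m = (d * w) * locConj ℓ F (d * w) := by
    intro m hm
    have h1 : h.det = d * locConj ℓ F d := by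
      rw [hh, Matrix.det_mul, det_dag]
    rw [Matrix.det_of_isUpperTriangular (fun i j hij => hU.2 i j hij)] at h1
    have h2 : ∏ i, h i i = W * (h m m * locConj ℓ F W) := by
      rw [← Finset.prod_filter_mul_prod_filter_not Finset.univ (fun i : Fin n => i < i.rev)]
      congr 1
      have h3 : (Finset.univ.filter fun i : Fin n => ¬ i < i.rev)
          = insert m (Finset.univ.filter fun i : Fin n => i.rev < i) := by
        ext i
        simp only [Finset.mem_filter, Finset.mem_univ, true_and, Finset.mem_insert, not_lt]
        constructor
        · intro hi
          rcases hi.eq_or_lt with hi | hi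
          · left
            have h4 := congrArg Fin.val hi
            have h5 := congrArg Fin.val hm
            rw [Fin.val_rev] at h4 h5
            ext; omega
          · exact Or.inr hi
        · rintro (rfl | hi)
          · exact hm.symm.le
          · exact hi.le
      rw [h3, Finset.prod_insert (by simp [← hm])]
      congr 1
      rw [map_prod]
      refine Finset.prod_bij (fun i _ => i.rev) ?_ ?_ ?_ ?_
      · intro i hi; simpa using hi
      · intro i _ j _ hij; exact Fin.rev_injective hij
      · intro i hi; exact ⟨i.rev, by simpa using hi, Fin.rev_rev i⟩
      · intro i _; rw [hrev, locConj_locConj]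
    rw [h2] at h1
    have h4 : locConj ℓ F w * locConj ℓ F W = 1 := by rw [← map_mul, hwW, map_one]
    rw [map_mul]
    linear_combination w * locConj ℓ F w * h1 - h m m * w * W * h4 - h m m * hwW
  let D (f : Fin n → LocField ℓ F) : Matrix (Fin n) (Fin n) (LocField ℓ F) := Matrix.diagonal f
  let E := D fun i => if i < i.rev then 1 else 0
  let P := D fun i => if i = i.rev then 1 else 0
  let H := D fun i => if i.rev < i then 1 else 0
  let μ := D fun i => if i = i.rev then d * w else 0
  let ν := D fun i => if i = i.rev then d' * W else 0
  have hrl : ∀ i j : Fin n, i = i.rev → j < j.rev → j < i := by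
    intro i j hi hj
    have h4 := congrArg Fin.val hi
    have h5 : (j : ℕ) < j.rev := hj
    rw [Fin.val_rev] at h4 h5
    exact Fin.lt_def.2 (by omega)
  have hhl : ∀ i j : Fin n, i.rev < i → j < j.rev → j < i := by
    intro i j hi hj
    have h4 : (i.rev : ℕ) < i := hi
    have h5 : (j : ℕ) < j.rev := hj
    rw [Fin.val_rev] at h4 h5
    exact Fin.lt_def.2 (by omega)
  have hhr : ∀ i j : Fin n, i.rev < i → j = j.rev → j < i := by
    intro i j hi hj
    have h4 : (i.rev : ℕ) < i := hi
    have h5 := congrArg Fin.val hj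
    rw [Fin.val_rev] at h4 h5
    exact Fin.lt_def.2 (by omega)
  have tri : ∀ {X : Matrix (Fin n) (Fin n) (LocField ℓ F)} (p q : Fin n → Prop) [DecidablePred p]
      [DecidablePred q], X ∈ upperInt ℓ n F → (∀ i j, p i → q j → j < i) →
      D (fun i => if p i then 1 else 0) * X * D (fun i => if q i then 1 else 0) = 0 := by
    intro X p q _ _ hX hpq
    ext i j
    simp only [D, Matrix.mul_diagonal, Matrix.diagonal_mul, Matrix.zero_apply]
    by_cases hp : p i
    · by_cases hq : q j
      · rw [hX.2 i j (hpq i j hp hq)]; simp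
      · simp [hq]
    · simp [hp]
  have DD : ∀ f f', D f * D f' = D fun i => f i * f' i := fun f f' => Matrix.diagonal_mul_diagonal _ _
  have hτc : ∀ X, D (fun _ => τ) * X = X * D (fun _ => τ) := by
    intro X
    ext i j
    simp only [D, Matrix.mul_diagonal, Matrix.diagonal_mul]
    ring
  have key := exists_mul_star_eq (dag ℓ n F) (dag_mul ℓ n F) (dag_dag ℓ n F) (E := E) (P := P) (H := H)
    (h := h) (g := g) (μ := μ) (ν := ν) (τ := D fun _ => τ)
    (by
      have : (1 : Matrix (Fin n) (Fin n) (LocField ℓ F)) = D fun _ => 1 := Matrix.diagonal_one.symm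
      rw [this, Matrix.diagonal_add, Matrix.diagonal_add]
      congr 1
      ext i
      rcases lt_trichotomy i i.rev with hi | hi | hi
      · rw [if_pos hi, if_neg hi.ne, if_neg hi.not_gt]; simp
      · rw [if_neg hi.not_lt, if_pos hi, if_neg hi.symm.not_lt]; simp
      · rw [if_neg hi.not_gt, if_neg hi.ne', if_pos hi]; simp)
    (by rw [DD]; congr 1; ext i; simp)
    (by rw [DD]; congr 1; ext i; simp)
    (by
      rw [DD]; rw [← Matrix.diagonal_zero]; congr 1; ext i
      by_cases hi : i = i.rev
      · rw [if_neg hi.not_lt, zero_mul]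
      · rw [if_neg hi, mul_zero])
    (by
      rw [DD]; rw [← Matrix.diagonal_zero]; congr 1; ext i
      by_cases hi : i = i.rev
      · rw [if_neg hi.not_lt, mul_zero]
      · rw [if_neg hi, zero_mul])
    (by
      rw [DD]; rw [← Matrix.diagonal_zero]; congr 1; ext i
      by_cases hi : i < i.rev
      · rw [if_neg hi.not_gt, mul_zero]
      · rw [if_neg hi, zero_mul])
    (by
      rw [DD]; rw [← Matrix.diagonal_zero]; congr 1; ext i
      by_cases hi : i < i.rev
      · rw [if_neg hi.not_gt, zero_mul]
      · rw [if_neg hi, mul_zero])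
    (by
      rw [DD]; rw [← Matrix.diagonal_zero]; congr 1; ext i
      by_cases hi : i = i.rev
      · rw [if_neg hi.symm.not_lt, mul_zero]
      · rw [if_neg hi, zero_mul])
    (by
      rw [DD]; rw [← Matrix.diagonal_zero]; congr 1; ext i
      by_cases hi : i = i.rev
      · rw [if_neg hi.symm.not_lt, zero_mul]
      · rw [if_neg hi, mul_zero])
    (by rw [dag_diagonal]; congr 1; ext i; rw [Fin.rev_rev]; split_ifs <;> simp)
    (by
      rw [dag_diagonal]; congr 1; ext i; rw [Fin.rev_rev]
      by_cases hi : i = i.rev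
      · rw [if_pos hi.symm, if_pos hi, map_one]
      · rw [if_neg (Ne.symm hi), if_neg hi, map_zero])
    hdh hgh (tri _ _ hU hrl) (tri _ _ hU hhl) (tri _ _ hU hhr) (tri _ _ hU' hhl) (tri _ _ hU' hhr)
    (by rw [DD]; congr 1; ext i; split_ifs <;> simp)
    (by rw [DD]; congr 1; ext i; split_ifs <;> simp)
    (by
      rw [DD]; congr 1; ext i; split_ifs
      · linear_combination d * d' * hwW + hdd'
      · simp)
    (by
      rw [dag_diagonal, DD]
      ext i j
      simp only [P, D, Matrix.mul_diagonal, Matrix.diagonal_mul]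
      rw [Matrix.diagonal_apply]
      by_cases hi : i = i.rev
      · by_cases hj : j = j.rev
        · have hij : i = j := by
            have h4 := congrArg Fin.val hi
            have h5 := congrArg Fin.val hj
            rw [Fin.val_rev] at h4 h5
            ext; omega
          subst hij
          simp only [Fin.rev_rev, if_pos hi, if_pos hi.symm, if_true, one_mul, mul_one]
          exact hmid i hi
        · have hij : i ≠ j := fun hij => hj (hij ▸ hi)
          rw [if_neg hj, if_neg hij, mul_zero]
      · rw [if_neg hi, zero_mul, zero_mul]
        by_cases hij : i = j
        · rw [if_pos hij, if_neg hi, zero_mul]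
        · rw [if_neg hij])
    hτc
    (by
      rw [dag_diagonal, Matrix.diagonal_add, ← Matrix.diagonal_one]; congr 1; ext i; exact hτ1)
  have hite : ∀ {x : LocField ℓ F} (_ : x ∈ locInt ℓ F) (p : Prop) [Decidable p],
      (if p then x else 0) ∈ locInt ℓ F := by
    intro x hx p _
    split_ifs
    · exact hx
    · exact Subalgebra.zero_mem _
  have hES : E ∈ upperInt ℓ n F := diagonal_mem_upperInt ℓ n F fun i => hite (Subalgebra.one_mem _) _
  have hHS : H ∈ upperInt ℓ n F := diagonal_mem_upperInt ℓ n F fun i => hite (Subalgebra.one_mem _) _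
  have hμS : μ ∈ upperInt ℓ n F := diagonal_mem_upperInt ℓ n F fun i => hite (Subalgebra.mul_mem _ hdR hwR) _
  have hνS : ν ∈ upperInt ℓ n F := diagonal_mem_upperInt ℓ n F fun i => hite (Subalgebra.mul_mem _ hd'R hWR) _
  have hτS : (D fun _ => τ) ∈ upperInt ℓ n F := diagonal_mem_upperInt ℓ n F fun i => hτ
  have hxS : E * h * dag ℓ n F ν ∈ upperInt ℓ n F :=
    Subring.mul_mem _ (Subring.mul_mem _ hES hU) (dag_mem_upperInt ℓ n F hνS)
  refine ⟨_, ?_, key⟩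
  refine Subring.add_mem _ (Subring.add_mem _ (Subring.add_mem _ (Subring.add_mem _
    (Subring.mul_mem _ (Subring.mul_mem _ hES hU) hES) hμS) hHS) hxS)
    (Subring.mul_mem _ (Subring.mul_mem _ hτS (Subring.sub_mem _ ?_ ?_))
      (Subring.mul_mem _ (Subring.mul_mem _ hHS hU') hHS))
  · exact Subring.mul_mem _ (Subring.mul_mem _ hES hU) hHS
  · exact Subring.mul_mem _ hxS (dag_mem_upperInt ℓ n F hxS)

/-- Iwasawa decomposition for the quasi-split similitude group, at a prime `ℓ` that is unramified
in `F`. -/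
theorem exists_GU_iwasawa (hℓ : Squarefree (Ideal.span {(ℓ : 𝓞 F)}))
    (g : (Matrix (Fin n) (Fin n) (LocField ℓ F))ˣ) (hg : g ∈ GU ℓ n F) :
    ∃ b ∈ GU ℓ n F, (∀ i j, j < i → b.val i j = 0) ∧ ∃ k ∈ GU ℓ n F, k ∈ glInt ℓ F n ∧ g = b * k := by
  obtain ⟨b, hb, k, hk, rfl⟩ := (isUnramifiedOrder_locInt ℓ F hℓ).exists_iwasawa g
  have hk : k ∈ glInt ℓ F n := hk
  obtain ⟨τ, hτ, hτ1⟩ := exists_add_locConj_eq_one F ℓ hℓ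
  obtain ⟨c, hc⟩ := hg
  have hbinv : ∀ i j, j < i → b⁻¹.val i j = 0 := by
    let _ := b.invertible
    have := Matrix.blockTriangular_inv_of_blockTriangular (M := b.val) (b := id) (fun i j h => hb i j h)
    intro i j hij
    rw [Matrix.coe_units_inv]
    exact this hij
  have hdagtri : ∀ {X : Matrix (Fin n) (Fin n) (LocField ℓ F)}, (∀ i j, j < i → X i j = 0) →
      ∀ i j, j < i → dag ℓ n F X i j = 0 := fun hX i j h => by
    rw [dag_apply, hX _ _ (Fin.rev_lt_rev.2 h), map_zero]
  have hmultri : ∀ {X Y : Matrix (Fin n) (Fin n) (LocField ℓ F)}, (∀ i j, j < i → X i j = 0) →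
      (∀ i j, j < i → Y i j = 0) → ∀ i j, j < i → (X * Y) i j = 0 := fun hX hY i j h =>
    (Matrix.BlockTriangular.mul (b := id) (fun i j h => hX i j h) (fun i j h => hY i j h)) h
  have hdaginv : ∀ u : (Matrix (Fin n) (Fin n) (LocField ℓ F))ˣ, dag ℓ n F u.val * dag ℓ n F u⁻¹.val = 1 := fun u => by
    rw [← dag_mul, Units.inv_mul, dag_one]
  have hdaginv' : ∀ u : (Matrix (Fin n) (Fin n) (LocField ℓ F))ˣ, dag ℓ n F u⁻¹.val * dag ℓ n F u.val = 1 := fun u => by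
    rw [← dag_mul, Units.mul_inv, dag_one]
  have hc' : b.val * k.val * (dag ℓ n F k.val * dag ℓ n F b.val) = algebraMap _ _ (c : ℚ_[ℓ]) := by
    rw [← dag_mul]; exact hc
  -- The similitude relation for b k shows that k k*, which is integral because `k` is, is also
  -- upper triangular.
  have hh : k.val * dag ℓ n F k.val = (c : ℚ_[ℓ]) • (b⁻¹.val * dag ℓ n F b⁻¹.val) := by
    have e1 : b⁻¹.val * (b.val * k.val * (dag ℓ n F k.val * dag ℓ n F b.val)) * dag ℓ n F b⁻¹.val
        = (b⁻¹.val * b.val) * (k.val * dag ℓ n F k.val) * (dag ℓ n F b.val * dag ℓ n F b⁻¹.val) := by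
      noncomm_ring
    rw [hc', Units.inv_mul, hdaginv, one_mul, mul_one, ← Algebra.commutes, mul_assoc, ← Algebra.smul_def] at e1
    exact e1.symm
  have hg' : dag ℓ n F k⁻¹.val * k⁻¹.val = ((c⁻¹ : ℚ_[ℓ]ˣ) : ℚ_[ℓ]) • (dag ℓ n F b.val * b.val) := by
    have e1 : k.val * dag ℓ n F k.val * (dag ℓ n F k⁻¹.val * k⁻¹.val) = 1 := by
      have : k.val * dag ℓ n F k.val * (dag ℓ n F k⁻¹.val * k⁻¹.val)
        = k.val * (dag ℓ n F k.val * dag ℓ n F k⁻¹.val) * k⁻¹.val := by noncomm_ring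
      rw [this, hdaginv, mul_one, Units.mul_inv]
    have e2 : ((c⁻¹ : ℚ_[ℓ]ˣ) : ℚ_[ℓ]) • (dag ℓ n F b.val * b.val) * (k.val * dag ℓ n F k.val) = 1 := by
      rw [hh, smul_mul_smul_comm, Units.inv_mul, one_smul]
      have : dag ℓ n F b.val * b.val * (b⁻¹.val * dag ℓ n F b⁻¹.val)
        = dag ℓ n F b.val * (b.val * b⁻¹.val) * dag ℓ n F b⁻¹.val := by noncomm_ring
      rw [this, Units.mul_inv, mul_one, hdaginv]
    exact (left_inv_eq_right_inv e2 e1).symm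
  have hkU : k.val * dag ℓ n F k.val ∈ upperInt ℓ n F := by
    refine ⟨fun i j => ?_, fun i j hij => ?_⟩
    · rw [Matrix.mul_apply]
      exact Subalgebra.sum_mem _ fun l _ => Subalgebra.mul_mem _ (hk.1 i l) (locConj_mem ℓ F (hk.1 _ _))
    · rw [hh, Matrix.smul_apply, hmultri hbinv (hdagtri hbinv) i j hij, smul_zero]
  have hkU' : dag ℓ n F k⁻¹.val * k⁻¹.val ∈ upperInt ℓ n F := by
    refine ⟨fun i j => ?_, fun i j hij => ?_⟩
    · rw [Matrix.mul_apply]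
      exact Subalgebra.sum_mem _ fun l _ => Subalgebra.mul_mem _ (locConj_mem ℓ F (hk.2 _ _)) (hk.2 _ _)
    · rw [hg', Matrix.smul_apply, hmultri (hdagtri hb) hb i j hij, smul_zero]
  obtain ⟨β, hβ, hβk⟩ := exists_upperInt_mul_dag ℓ n F hτ hτ1 hk hkU hkU'
  have hββ : β * (dag ℓ n F β * (dag ℓ n F k⁻¹.val * k⁻¹.val)) = 1 := by
    rw [← mul_assoc, ← hβk]
    have : k.val * dag ℓ n F k.val * (dag ℓ n F k⁻¹.val * k⁻¹.val)
      = k.val * (dag ℓ n F k.val * dag ℓ n F k⁻¹.val) * k⁻¹.val := by noncomm_ring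
    rw [this, hdaginv, mul_one, Units.mul_inv]
  -- With β β* = k k*, the decomposition b k = (b β)(β⁻¹ k) stays in the similitude group: β⁻¹ k is
  -- unitary, with similitude factor one.
  let B : (Matrix (Fin n) (Fin n) (LocField ℓ F))ˣ := ⟨β, _, hββ, mul_eq_one_comm.1 hββ⟩
  have hB : B ∈ glInt ℓ F n := ⟨hβ.1, (Subring.mul_mem _ (dag_mem_upperInt ℓ n F hβ) hkU').1⟩
  have hkGU : B⁻¹ * k ∈ GU ℓ n F := by
    refine ⟨1, ?_⟩
    change (B⁻¹.val * k.val) * dag ℓ n F (B⁻¹.val * k.val) = _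
    have : (B⁻¹.val * k.val) * dag ℓ n F (B⁻¹.val * k.val)
        = B⁻¹.val * B.val * (dag ℓ n F B.val * dag ℓ n F B⁻¹.val) := by
      rw [dag_mul]
      calc B⁻¹.val * k.val * (dag ℓ n F k.val * dag ℓ n F B⁻¹.val)
          = B⁻¹.val * (k.val * dag ℓ n F k.val) * dag ℓ n F B⁻¹.val := by noncomm_ring
        _ = B⁻¹.val * (B.val * dag ℓ n F B.val) * dag ℓ n F B⁻¹.val := by rw [hβk]
        _ = _ := by noncomm_ring
    rw [this, Units.inv_mul, hdaginv]; simp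
  refine ⟨b * B, ?_, hmultri hb hβ.2, B⁻¹ * k, hkGU, Subgroup.mul_mem _ (Subgroup.inv_mem _ hB) hk, by group⟩
  have : b * B = b * k * (B⁻¹ * k)⁻¹ := by group
  rw [this]
  exact Subgroup.mul_mem _ ⟨c, hc⟩ (Subgroup.inv_mem _ hkGU)

end GU

/-! ### Iwasawa decompositions and Satake transforms -/

section Iwasawa

variable {G : Type*} [Group G] {A : Type*} [CommGroup A]

/-- The double coset of `x`, as a set of left cosets of `K`. -/
def doubleCosetSet (K : Subgroup G) (x : G) : Set (G ⧸ K) := {q | ∃ k ∈ K, q = ((k * x : G) : G ⧸ K)}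

/-- `G = T N K`, with `T` normalising `N` and `T N ∩ K = (T ∩ K) (N ∩ K)`, and with double cosets of
`K` consisting of finitely many left cosets. -/
structure IsIwasawa (K N : Subgroup G) (ι : A →* G) : Prop where
  exists_eq : ∀ g, ∃ a, ∃ u ∈ N, ∃ k ∈ K, g = ι a * u * k
  conj_mem : ∀ a, ∀ u ∈ N, ι a * u * (ι a)⁻¹ ∈ N
  mem_of_mul_mem : ∀ a, ∀ u ∈ N, ι a * u ∈ K → ι a ∈ K
  finite : ∀ x, (doubleCosetSet K x).Finite

lemma heckeAlgebra.apply_mul {K : Subgroup G} (f : heckeAlgebra K) (g : G) {k : G} (hk : k ∈ K) :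
    f.1 (g * k) = f.1 g := by
  have := f.2.1 1 K.one_mem k hk g
  rwa [one_mul] at this

lemma heckeAlgebra.apply_out {K : Subgroup G} (f : heckeAlgebra K) (g : G) :
    f.1 (g : G ⧸ K).out = f.1 g := by
  obtain ⟨k, hk⟩ := QuotientGroup.mk_out_eq_mul K g
  rw [hk, heckeAlgebra.apply_mul f g k.2]

lemma heckeAlgebra.finite_support {K : Subgroup G} (hK : ∀ x, (doubleCosetSet K x).Finite)
    (f : heckeAlgebra K) : (Function.support fun q : G ⧸ K => f.1 q.out).Finite := by
  obtain ⟨s, hs⟩ := f.2.2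
  refine (s.finite_toSet.biUnion fun x _ => hK x).subset fun q hq => ?_
  obtain ⟨x, hx, k₁, hk₁, k₂, hk₂, h⟩ := hs _ hq
  refine Set.mem_biUnion hx ⟨k₁, hk₁, ?_⟩
  rw [← q.out_eq', h]
  exact QuotientGroup.mk_mul_of_mem _ hk₂

lemma charDoubleCoset_apply_out (K : Subgroup G) (x : G) (q : G ⧸ K) [Decidable (q ∈ doubleCosetSet K x)] :
    (charDoubleCoset K x).1 q.out = if q ∈ doubleCosetSet K x then 1 else 0 := by
  classical
  have : (∃ k₁ ∈ K, ∃ k₂ ∈ K, q.out = k₁ * x * k₂) ↔ q ∈ doubleCosetSet K x := by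
    constructor
    · rintro ⟨k₁, hk₁, k₂, hk₂, h⟩
      refine ⟨k₁, hk₁, ?_⟩
      rw [← q.out_eq', h]
      exact QuotientGroup.mk_mul_of_mem _ hk₂
    · rintro ⟨k, hk, h⟩
      obtain ⟨k', hk'⟩ := QuotientGroup.mk_out_eq_mul K (k * x)
      exact ⟨k, hk, k', k'.2, by rw [h, hk']⟩
  change (if _ then _ else _) = _
  simp only [this]

lemma finsum_indicator_one {X : Type*} {s : Set X} (hs : s.Finite) (f : X → ℂ)
    (h1 : ∀ x ∈ s, f x = 1) (h0 : ∀ x ∉ s, f x = 0) : ∑ᶠ x, f x = s.ncard := by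
  rw [finsum_eq_sum_of_support_subset f (s := hs.toFinset)
    (fun x hx => by simpa using by_contra fun h => hx (h0 x h)),
    Finset.sum_congr rfl (g := fun _ => (1 : ℂ)) fun x hx => h1 x (by simpa using hx),
    Finset.sum_const, nsmul_one, Set.ncard_eq_toFinset_card s hs]

lemma heckeDegree_charDoubleCoset {K : Subgroup G} {x : G} (hx : (doubleCosetSet K x).Finite) :
    heckeDegree K (charDoubleCoset K x).1 = (doubleCosetSet K x).ncard := by
  classical
  exact finsum_indicator_one hx _ (fun q hq => by rw [charDoubleCoset_apply_out, if_pos hq])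
    fun q hq => by rw [charDoubleCoset_apply_out, if_neg hq]

lemma charDoubleCoset_eq_heckeUnit {K : Subgroup G} {x : G} (hx : x ∈ K) :
    charDoubleCoset K x = heckeUnit K := by
  classical
  refine Subtype.ext (funext fun g => ?_)
  have : (∃ k₁ ∈ K, ∃ k₂ ∈ K, g = k₁ * x * k₂) ↔ ∃ k₁ ∈ K, ∃ k₂ ∈ K, g = k₁ * 1 * k₂ := by
    constructor
    · rintro ⟨a, ha, b, hb, rfl⟩
      exact ⟨a * x, K.mul_mem ha hx, b, hb, by group⟩
    · rintro ⟨a, ha, b, hb, rfl⟩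
      exact ⟨a * x⁻¹, K.mul_mem ha (K.inv_mem hx), b, hb, by group⟩
  change (if _ then _ else _) = (if _ then _ else _)
  simp only [this]

lemma heckeUnit_apply {K : Subgroup G} (g : G) [Decidable (g ∈ K)] :
    (heckeUnit K).1 g = if g ∈ K then 1 else 0 := by
  classical
  have : (∃ k₁ ∈ K, ∃ k₂ ∈ K, g = k₁ * 1 * k₂) ↔ g ∈ K := by
    constructor
    · rintro ⟨a, ha, b, hb, rfl⟩
      rw [mul_one]
      exact K.mul_mem ha hb
    · intro hg
      exact ⟨1, K.one_mem, g, hg, by group⟩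
  change (if _ then _ else _) = (if _ then _ else _)
  simp only [this]

variable {K N : Subgroup G} {ι : A →* G}

/-- A representative in `T` of an element of `T / (T ∩ K)`. -/
def CocharLattice.out (q : CocharLattice K ι) : A := Quotient.out (s := QuotientGroup.leftRel _) q

lemma CocharLattice.mk_out (q : CocharLattice K ι) : CocharLattice.mk K ι q.out = q :=
  Quotient.out_eq' (s₁ := QuotientGroup.leftRel (K.comap ι)) q

lemma CocharLattice.mk_eq_mk {a b : A} :
    CocharLattice.mk K ι a = CocharLattice.mk K ι b ↔ ι (a⁻¹ * b) ∈ K :=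
  QuotientGroup.eq (s := K.comap ι)

/-- The map from `T / (T ∩ K) × N / (N ∩ K)` to `G / K`. -/
def iwasawaMap (K N : Subgroup G) (ι : A →* G) (p : CocharLattice K ι × (N ⧸ K.subgroupOf N)) : G ⧸ K :=
  ((ι p.1.out * (p.2.out : N) : G) : G ⧸ K)

namespace IsIwasawa

variable (h : IsIwasawa K N ι)
include h

/-- This turns a sum over G / K into a double sum over cocharacters and N / (N ∩ K). For
surjectivity, replacing `a` by the chosen representative of its class conjugates `u` by an element
of T ∩ K. -/
lemma bijective : Function.Bijective (iwasawaMap K N ι) := by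
  have hconj : ∀ a, ∀ u ∈ N, (ι a)⁻¹ * u * ι a ∈ N := fun a u hu => by
    have := h.conj_mem a⁻¹ u hu
    rwa [map_inv, inv_inv] at this
  constructor
  · rintro ⟨q, u⟩ ⟨q', u'⟩ he
    have h1 : (ι q.out * (u.out : N))⁻¹ * (ι q'.out * (u'.out : N)) ∈ K := QuotientGroup.eq.1 he
    have h2 : (ι q.out * (u.out : N))⁻¹ * (ι q'.out * (u'.out : N))
        = ι (q.out⁻¹ * q'.out)
          * (((ι (q.out⁻¹ * q'.out))⁻¹ * (u.out : N)⁻¹ * ι (q.out⁻¹ * q'.out)) * (u'.out : N)) := by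
      simp only [map_mul, map_inv, mul_inv_rev, inv_inv, mul_assoc, inv_mul_cancel_left, Subgroup.coe_inv,
        mul_inv_cancel_left]
    rw [h2] at h1
    have h3 := h.mem_of_mul_mem _ _ (N.mul_mem (hconj _ _ (N.inv_mem (u.out : N).2)) (u'.out : N).2) h1
    have hq : q = q' := by
      rw [← q.mk_out, ← q'.mk_out]
      exact CocharLattice.mk_eq_mk.2 h3
    subst hq
    have h4 : ((u.out : N) : G)⁻¹ * (u'.out : N) ∈ K := by
      rw [inv_mul_cancel, map_one] at h1
      simpa using h1
    have h5 : u = u' := by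
      rw [← u.out_eq', ← u'.out_eq']
      exact QuotientGroup.eq.2 h4
    rw [h5]
  · intro x
    induction x using QuotientGroup.induction_on with
    | H g =>
      obtain ⟨a, u, hu, k, hk, rfl⟩ := h.exists_eq g
      set q := CocharLattice.mk K ι a with hq
      have h1 : ι (a⁻¹ * q.out) ∈ K := CocharLattice.mk_eq_mk.1 (by rw [q.mk_out])
      set b := a⁻¹ * q.out with hb
      have hv := hconj b u hu
      set v : N := ⟨_, hv⟩ with hv'
      obtain ⟨w, hw⟩ := QuotientGroup.mk_out_eq_mul (K.subgroupOf N) v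
      refine ⟨(q, (v : N ⧸ K.subgroupOf N)), ?_⟩
      refine QuotientGroup.eq.2 ?_
      have h2 : ι q.out = ι a * ι b := by rw [← map_mul, hb, mul_inv_cancel_left]
      have hw' : ((w : N) : G) ∈ K := w.2
      change (ι q.out * _)⁻¹ * _ ∈ K
      rw [hw, h2]
      have h3 : (ι a * ι b * ((v * w : N) : G))⁻¹ * (ι a * u * k) = ((w : N) : G)⁻¹ * (ι b)⁻¹ * k := by
        rw [Subgroup.coe_mul, hv']
        group
      rw [h3]
      exact K.mul_mem (K.mul_mem (K.inv_mem hw') (K.inv_mem h1)) hk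

lemma finite_support (f : heckeAlgebra K) : (Function.support fun p : CocharLattice K ι × (N ⧸ K.subgroupOf N) =>
    f.1 (ι p.1.out * (p.2.out : N))).Finite := by
  refine ((heckeAlgebra.finite_support h.finite f).preimage h.bijective.injective.injOn).subset
    fun p hp => ?_
  rw [Set.mem_preimage, Function.mem_support, iwasawaMap, heckeAlgebra.apply_out]
  exact hp

lemma finite_satakeCoeff (δ : A → ℝ) (f : heckeAlgebra K) : (Function.support
    fun q : CocharLattice K ι => satakeCoeff K N ι δ f.1 q.out).Finite := by
  refine ((h.finite_support f).image Prod.fst).subset fun q hq => ?_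
  by_contra hq'
  refine hq ?_
  have : ∀ u : N ⧸ K.subgroupOf N, f.1 (ι q.out * (u.out : N)) = 0 := fun u => by
    by_contra hu
    exact hq' ⟨(q, u), hu, rfl⟩
  exact mul_eq_zero_of_right _ (finsum_eq_zero_of_forall_eq_zero this)

lemma satake_coeff (δ : A → ℝ) (f : heckeAlgebra K) (q : CocharLattice K ι) :
    (satake K N ι δ f.1).coeff q = satakeCoeff K N ι δ f.1 q.out := by
  classical
  have hs : (Function.support fun q : CocharLattice K ι =>
      MonoidAlgebra.single q (satakeCoeff K N ι δ f.1 q.out))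
      ⊆ (h.finite_satakeCoeff δ f).toFinset := fun q hq => by
    rw [Set.Finite.coe_toFinset]
    exact fun h0 => hq (MonoidAlgebra.single_eq_zero.2 h0)
  have : satake K N ι δ f.1 = ∑ q ∈ (h.finite_satakeCoeff δ f).toFinset,
      MonoidAlgebra.single q (satakeCoeff K N ι δ f.1 q.out) :=
    finsum_eq_sum_of_support_subset _ hs
  rw [this, MonoidAlgebra.coeff_sum, Finsupp.finsetSum_apply]
  simp only [MonoidAlgebra.coeff_single, Finsupp.single_apply]
  rw [Finset.sum_ite_eq' _ q]
  split_ifs with hq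
  · rfl
  · rw [Set.Finite.mem_toFinset] at hq
    exact (not_not.1 hq).symm

/-- Summing over N / (N ∩ K) first gives the Satake coefficients without their factor δ^(1/2):
integration over G is evaluation of the Satake transform at δ^(-1/2). -/
lemma heckeDegree_eq {δ : A → ℝ} (hδ : ∀ a, 0 < δ a) (f : heckeAlgebra K) :
    heckeDegree K f.1
      = (satake K N ι δ f.1).coeff.sum fun q c => ((Real.sqrt (δ q.out))⁻¹ : ℂ) * c := by
  have h1 : heckeDegree K f.1 = ∑ᶠ p : CocharLattice K ι × (N ⧸ K.subgroupOf N),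
      f.1 (ι p.1.out * (p.2.out : N)) :=
    (finsum_eq_of_bijective _ h.bijective fun p => by
      rw [iwasawaMap, heckeAlgebra.apply_out]).symm
  rw [h1, finsum_curry _ (h.finite_support f)]
  have h2 : ∀ q : CocharLattice K ι, ∑ᶠ u : N ⧸ K.subgroupOf N, f.1 (ι q.out * (u.out : N))
      = ((Real.sqrt (δ q.out))⁻¹ : ℂ) * (satake K N ι δ f.1).coeff q := fun q => by
    have hne : (Real.sqrt (δ q.out) : ℂ) ≠ 0 := by
      exact_mod_cast (Real.sqrt_pos.2 (hδ _)).ne'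
    rw [h.satake_coeff, satakeCoeff, inv_mul_cancel_left₀ hne]
  rw [finsum_congr h2]
  refine finsum_eq_sum_of_support_subset _ fun q hq => ?_
  rw [Finset.mem_coe, Finsupp.mem_support_iff]
  exact fun h0 => hq (by simp only [h0, mul_zero])

lemma satake_heckeUnit {δ : A → ℝ} (hδ : ∀ a, ι a ∈ K → δ a = 1) :
    satake K N ι δ (heckeUnit K).1 = MonoidAlgebra.single 1 1 := by
  classical
  refine MonoidAlgebra.ext (Finsupp.ext fun q => ?_)
  rw [h.satake_coeff, MonoidAlgebra.coeff_single, Finsupp.single_apply, satakeCoeff]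
  have hq : ι q.out ∈ K ↔ 1 = q := by
    rw [← q.mk_out, ← map_one (CocharLattice.mk K ι), CocharLattice.mk_eq_mk, q.mk_out, inv_one, one_mul]
  split_ifs with h1
  · have hqK := hq.2 h1
    rw [hδ _ hqK, Real.sqrt_one, Complex.ofReal_one, one_mul]
    rw [finsum_eq_single _ (((1 : N) : N ⧸ K.subgroupOf N))]
    · obtain ⟨w, hw⟩ := QuotientGroup.mk_out_eq_mul (K.subgroupOf N) 1
      rw [hw, heckeUnit_apply, if_pos]
      rw [one_mul]
      exact K.mul_mem hqK w.2
    · intro u hu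
      rw [heckeUnit_apply, if_neg]
      intro hK
      refine hu ?_
      rw [← u.out_eq']
      refine QuotientGroup.eq.2 ?_
      rw [mul_one]
      exact (K.subgroupOf N).inv_mem ((K.mul_mem_cancel_left hqK).1 hK)
  · refine mul_eq_zero_of_right _ (finsum_eq_zero_of_forall_eq_zero fun u => ?_)
    rw [heckeUnit_apply, if_neg]
    exact fun hK => h1 (hq.1 (h.mem_of_mul_mem _ _ (u.out : N).2 hK))

/-- The Satake transform of the characteristic function of a double coset. -/
lemma satakeCoeff_charDoubleCoset (δ : A → ℝ) (x : G) (q : CocharLattice K ι) :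
    satakeCoeff K N ι δ (charDoubleCoset K x).1 q.out = (Real.sqrt (δ q.out) : ℂ) *
      ({u : N ⧸ K.subgroupOf N | iwasawaMap K N ι (q, u) ∈ doubleCosetSet K x}.ncard : ℂ) := by
  classical
  have hval : ∀ u : N ⧸ K.subgroupOf N, (charDoubleCoset K x).1 (ι q.out * (u.out : N))
      = if iwasawaMap K N ι (q, u) ∈ doubleCosetSet K x then 1 else 0 := fun u => by
    rw [← charDoubleCoset_apply_out, iwasawaMap, heckeAlgebra.apply_out]
  rw [satakeCoeff, finsum_indicator_one]
  · refine ((h.finite x).preimage (f := fun u => iwasawaMap K N ι (q, u)) ?_)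
    intro u _ u' _ huu
    exact (Prod.ext_iff.1 (h.bijective.injective huu)).2
  · exact fun u hu => (hval u).trans (if_pos hu)
  · exact fun u hu => (hval u).trans (if_neg hu)

end IsIwasawa

/-- Evaluation at δ'^(-1/2) pulls back along `φ` to evaluation at δ^(-1/2). -/
lemma heckeDegree_eq_of_satake_eq {G' : Type*} [Group G'] {A' : Type*} [CommGroup A']
    {K' N' : Subgroup G'} {ι' : A' →* G'} (h : IsIwasawa K N ι) (h' : IsIwasawa K' N' ι')
    {δ : A → ℝ} (hδ : ∀ a, 0 < δ a) {δ' : A' → ℝ} (hδ' : ∀ a, 0 < δ' a)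
    (φ : CocharLattice K ι → CocharLattice K' ι') (hφ : ∀ q, δ' (φ q).out = δ q.out)
    {f : heckeAlgebra K} {f' : heckeAlgebra K'}
    (hf : satake K' N' ι' δ' f'.1 = MonoidAlgebra.mapDomain φ (satake K N ι δ f.1)) :
    heckeDegree K' f'.1 = heckeDegree K f.1 := by
  rw [h'.heckeDegree_eq hδ', h.heckeDegree_eq hδ, hf]
  change (Finsupp.mapDomain φ (satake K N ι δ f.1).coeff).sum _ = _
  rw [Finsupp.sum_mapDomain_index (fun _ => mul_zero _) (fun _ _ _ => mul_add _ _ _)]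
  simp only [hφ]

/-- Triangle inequality on each fibre of `φ`. -/
lemma coeffNorm_mapDomain_le {X Y : Type*} (φ : X → Y) (P : MonoidAlgebra ℂ X) :
    coeffNorm (MonoidAlgebra.mapDomain φ P) ≤ coeffNorm P := by
  classical
  change ((Finsupp.mapDomain φ P.coeff).sum fun _ c => ‖c‖) ≤ P.coeff.sum fun _ c => ‖c‖
  rw [Finsupp.sum, Finsupp.sum]
  calc ∑ y ∈ (Finsupp.mapDomain φ P.coeff).support, ‖Finsupp.mapDomain φ P.coeff y‖
      ≤ ∑ y ∈ P.coeff.support.image φ, ‖Finsupp.mapDomain φ P.coeff y‖ :=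
        Finset.sum_le_sum_of_subset_of_nonneg Finsupp.mapDomain_support fun _ _ _ => norm_nonneg _
    _ ≤ ∑ y ∈ P.coeff.support.image φ, ∑ x ∈ P.coeff.support with φ x = y, ‖P.coeff x‖ := by
        refine Finset.sum_le_sum fun y _ => ?_
        rw [Finsupp.mapDomain, Finsupp.sum, Finsupp.finsetSum_apply, Finset.sum_filter]
        refine (norm_sum_le _ _).trans (Finset.sum_le_sum fun x _ => ?_)
        rw [Finsupp.single_apply]
        split_ifs <;> simp
    _ = ∑ x ∈ P.coeff.support, ‖P.coeff x‖ :=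
        Finset.sum_fiberwise_of_maps_to (fun x hx => Finset.mem_image_of_mem φ hx) _

lemma coeffNorm_single {X : Type*} (x : X) (c : ℂ) : coeffNorm (MonoidAlgebra.single x c) = ‖c‖ :=
  Finsupp.sum_single_index norm_zero

lemma coeffNorm_zero {X : Type*} : coeffNorm (0 : MonoidAlgebra ℂ X) = 0 := Finsupp.sum_zero_index

lemma coeffNorm_nonneg {X : Type*} (P : MonoidAlgebra ℂ X) : 0 ≤ coeffNorm P :=
  Finset.sum_nonneg fun _ _ => norm_nonneg _

lemma coeffNorm_le {X : Type*} (P : MonoidAlgebra ℂ X) {s : Finset X} {B : ℝ} (hB : 0 ≤ B)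
    (hs : ∀ x, P.coeff x ≠ 0 → x ∈ s) (hP : ∀ x, ‖P.coeff x‖ ≤ B) : coeffNorm P ≤ s.card * B := by
  calc coeffNorm P ≤ ∑ _x ∈ P.coeff.support, B := Finset.sum_le_sum fun x _ => hP x
    _ = P.coeff.support.card * B := by rw [Finset.sum_const, nsmul_eq_mul]
    _ ≤ s.card * B := by
      gcongr
      exact fun x hx => hs x (Finsupp.mem_support_iff.1 hx)

end Iwasawa

/-! ### The Iwasawa decompositions of `G⁺` and `GU` -/

/-- The left coset of k x depends on `k` only through the finite invariant `τ k`, which will be `k`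
modulo a power of ℓ. -/
lemma doubleCosetSet_finite {G : Type*} [Group G] {K : Subgroup G} {x : G} {T : Type*} [Finite T]
    (τ : G → T) (h : ∀ k₁ ∈ K, ∀ k₂ ∈ K, τ k₁ = τ k₂ → x⁻¹ * (k₁⁻¹ * k₂) * x ∈ K) :
    (doubleCosetSet K x).Finite := by
  choose k hk hkq using fun q : doubleCosetSet K x => q.2
  refine Set.finite_coe_iff.1 (Finite.of_injective (fun q => τ (k q)) fun q q' hq => ?_)
  refine Subtype.ext ?_
  rw [hkq q, hkq q']
  refine QuotientGroup.eq.2 ?_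
  have := h _ (hk q) _ (hk q') hq
  rwa [mul_inv_rev, mul_assoc, ← mul_assoc _ _ x, ← mul_assoc]

section Unipotent

variable {n : ℕ} {R : Type*} [CommRing R]

lemma mul_apply_diag_of_upper {X Y : Matrix (Fin n) (Fin n) R} (hX : ∀ i j, j < i → X i j = 0)
    (hY : ∀ i j, j < i → Y i j = 0) (i : Fin n) : (X * Y) i i = X i i * Y i i := by
  rw [Matrix.mul_apply, Finset.sum_eq_single i]
  · intro k _ hk
    rcases lt_or_gt_of_ne hk with h | h
    · rw [hX i k h, zero_mul]
    · rw [hY k i h, mul_zero]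
  · simp

lemma inv_upper (b : (Matrix (Fin n) (Fin n) R)ˣ) (hb : ∀ i j, j < i → b.val i j = 0)
    (i j : Fin n) (hij : j < i) : b⁻¹.val i j = 0 := by
  let _ := b.invertible
  have := Matrix.blockTriangular_inv_of_blockTriangular (M := b.val) (b := id) fun i j h => hb i j h
  rw [Matrix.coe_units_inv]
  exact this hij

lemma exists_diagUnits_mul_unipotent (b : (Matrix (Fin n) (Fin n) R)ˣ)
    (hb : ∀ i j, j < i → b.val i j = 0) :
    ∃ a : Fin n → Rˣ, (∀ i, (a i : R) = b.val i i) ∧ ∃ u ∈ unipotent n R, b = diagUnits n R a * u := by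
  have hb' := inv_upper b hb
  have h1 : ∀ i, b.val i i * b⁻¹.val i i = 1 := fun i => by
    rw [← mul_apply_diag_of_upper hb hb', Units.mul_inv, Matrix.one_apply_eq]
  let a : Fin n → Rˣ := fun i => ⟨b.val i i, b⁻¹.val i i, h1 i, by rw [mul_comm, h1]⟩
  have e1 : ∀ i j, ((diagUnits n R a)⁻¹ * b).val i j = b⁻¹.val i i * b.val i j := fun i j => by
    rw [← map_inv, Units.val_mul, diagUnits_val, Matrix.diagonal_mul]; rfl
  have e2 : ∀ i j, ((diagUnits n R a)⁻¹ * b)⁻¹.val i j = b⁻¹.val i j * b.val j j := fun i j => by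
    rw [mul_inv_rev, inv_inv, Units.val_mul, diagUnits_val, Matrix.mul_diagonal]
  refine ⟨a, fun i => rfl, (diagUnits n R a)⁻¹ * b, ⟨⟨fun i j h => ?_, fun i => ?_⟩,
    fun i j h => ?_, fun i => ?_⟩, by group⟩
  · exact (e1 i j).trans (by rw [hb i j h, mul_zero])
  · exact (e1 i i).trans (by rw [mul_comm, h1])
  · exact (e2 i j).trans (by rw [hb' i j h, zero_mul])
  · exact (e2 i i).trans (by rw [mul_comm, h1])

lemma diagUnits_conj_apply (a : Fin n → Rˣ) (u : (Matrix (Fin n) (Fin n) R)ˣ) (i j : Fin n) :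
    (diagUnits n R a * u * (diagUnits n R a)⁻¹).val i j = a i * u.val i j * ((a j)⁻¹ : Rˣ) := by
  rw [← map_inv, Units.val_mul, Units.val_mul, diagUnits_val, diagUnits_val, Matrix.mul_diagonal,
    Matrix.diagonal_mul]
  rfl

lemma conj_mem_unipotent (a : Fin n → Rˣ) {u : (Matrix (Fin n) (Fin n) R)ˣ} (hu : u ∈ unipotent n R) :
    diagUnits n R a * u * (diagUnits n R a)⁻¹ ∈ unipotent n R := by
  have key : ∀ v : (Matrix (Fin n) (Fin n) R)ˣ, ((∀ i j, j < i → v.val i j = 0) ∧ ∀ i, v.val i i = 1) →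
      (∀ i j, j < i → (diagUnits n R a * v * (diagUnits n R a)⁻¹).val i j = 0) ∧
        ∀ i, (diagUnits n R a * v * (diagUnits n R a)⁻¹).val i i = 1 := fun v hv => by
    refine ⟨fun i j h => ?_, fun i => ?_⟩
    · rw [diagUnits_conj_apply, hv.1 i j h, mul_zero, zero_mul]
    · rw [diagUnits_conj_apply, hv.2 i, mul_one, Units.mul_inv]
  refine ⟨key u hu.1, ?_⟩
  have := key u⁻¹ hu.2
  rw [show diagUnits n R a * u⁻¹ * (diagUnits n R a)⁻¹
    = (diagUnits n R a * u * (diagUnits n R a)⁻¹)⁻¹ by group] at this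
  exact this

end Unipotent

section Local

universe v

variable (ℓ : ℕ) [Fact ℓ.Prime] (n : ℕ)
variable (F : Type v) [Field F] [NumberField F]

lemma diagUnits_mem_of_mul_mem {a : Fin n → (LocField ℓ F)ˣ}
    {u : (Matrix (Fin n) (Fin n) (LocField ℓ F))ˣ} (hu : u ∈ unipotent n (LocField ℓ F))
    (h : diagUnits n (LocField ℓ F) a * u ∈ glInt ℓ F n) : diagUnits n (LocField ℓ F) a ∈ glInt ℓ F n := by
  refine diagUnits_mem ℓ n F fun i => ⟨?_, ?_⟩
  · have h1 := h.1 i i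
    have hd : u.val i i = 1 := hu.1.2 i
    have e : (diagUnits n (LocField ℓ F) a * u).val i i = a i := by
      rw [Units.val_mul, diagUnits_val, Matrix.diagonal_mul, hd, mul_one]
    exact e ▸ h1
  · have h1 := h.2 i i
    have e : (diagUnits n (LocField ℓ F) a * u)⁻¹.val i i = ((a i)⁻¹ : (LocField ℓ F)ˣ) := by
      rw [mul_inv_rev, ← map_inv, Units.val_mul, diagUnits_val, Matrix.mul_diagonal]
      have := hu.2.2 i
      rw [show u⁻¹.val i i = 1 from this, one_mul]
      rfl
    exact e ▸ h1

/-- Integral matrices modulo `ℓ ^ c`. -/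
lemma exists_reduction_mod (c : ℕ) : ∃ (T : Type v) (_ : Finite T)
    (τ : (Matrix (Fin n) (Fin n) (LocField ℓ F))ˣ → T), ∀ k₁ ∈ glInt ℓ F n, ∀ k₂ ∈ glInt ℓ F n,
      τ k₁ = τ k₂ → ∀ i j, ∃ z ∈ locInt ℓ F, k₁.val i j - k₂.val i j = (ℓ : LocField ℓ F) ^ c * z := by
  classical
  have : NeZero (ℓ ^ c) := ⟨pow_ne_zero _ (Fact.out : ℓ.Prime).ne_zero⟩
  refine ⟨Fin n → Fin n → Module.Free.ChooseBasisIndex ℤ (𝓞 F) → ZMod (ℓ ^ c), inferInstance,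
    fun k i j b => if h : k.val i j ∈ locInt ℓ F then
      PadicInt.toZModPow c ((locIntBasis ℓ F).repr ⟨k.val i j, h⟩ b) else 0, ?_⟩
  intro k₁ h₁ k₂ h₂ hk i j
  have e₁ : k₁.val i j ∈ locInt ℓ F := h₁.1 i j
  have e₂ : k₂.val i j ∈ locInt ℓ F := h₂.1 i j
  have hdvd : (ℓ : locInt ℓ F) ^ c ∣ ⟨k₁.val i j, e₁⟩ - ⟨k₂.val i j, e₂⟩ := by
    rw [dvd_locInt_iff]
    intro b
    have := congrFun (congrFun (congrFun hk i) j) b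
    simp only [dif_pos e₁, dif_pos e₂] at this
    rw [map_sub, Finsupp.sub_apply, ← Ideal.mem_span_singleton, ← PadicInt.ker_toZModPow,
      RingHom.mem_ker, map_sub, this, sub_self]
  obtain ⟨z, hz⟩ := hdvd
  refine ⟨z, z.2, ?_⟩
  have := congrArg Subtype.val hz
  simpa using this

variable (hℓ : Squarefree (Ideal.span {(ℓ : 𝓞 F)}))
include hℓ

lemma exists_conj_mem_glInt (x : (Matrix (Fin n) (Fin n) (LocField ℓ F))ˣ) : ∃ (T : Type v) (_ : Finite T)
    (τ : (Matrix (Fin n) (Fin n) (LocField ℓ F))ˣ → T), ∀ k₁ ∈ glInt ℓ F n, ∀ k₂ ∈ glInt ℓ F n,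
      τ k₁ = τ k₂ → x⁻¹ * (k₁⁻¹ * k₂) * x ∈ glInt ℓ F n := by
  obtain ⟨c, hc⟩ := (isUnramifiedOrder_locInt ℓ F hℓ).conj_mem_glSub x
  obtain ⟨T, hT, τ, hτ⟩ := exists_reduction_mod ℓ n F c
  exact ⟨T, hT, τ, fun k₁ h₁ k₂ h₂ hk => hc k₁ h₁ k₂ h₂ (hτ k₁ h₁ k₂ h₂ hk)⟩

variable (𝒦 : Type*) [Field 𝒦] [NumberField 𝒦] [Algebra 𝒦 F]

omit [Algebra 𝒦 F] in
lemma isIwasawa_GPlus : IsIwasawa (GPlusInt ℓ n F 𝒦) (GPlusUnip ℓ n F 𝒦) (GPlusDiag ℓ n F 𝒦) where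
  exists_eq := by
    rintro ⟨c, x⟩
    obtain ⟨b, hb, k, hk, rfl⟩ := (isUnramifiedOrder_locInt ℓ F hℓ).exists_iwasawa x
    obtain ⟨a, -, u, hu, rfl⟩ := exists_diagUnits_mul_unipotent b hb
    refine ⟨(c, a), (1, u), ⟨Subgroup.one_mem _, hu⟩, (1, k), ⟨Subgroup.one_mem _, hk⟩, ?_⟩
    exact Prod.ext (by simp [GPlusDiag]) rfl
  conj_mem := by
    rintro ⟨c, a⟩ ⟨d, u⟩ ⟨hd, hu⟩
    refine ⟨?_, conj_mem_unipotent a hu⟩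
    have hd' : d = 1 := hd
    subst hd'
    change c * 1 * c⁻¹ ∈ (⊥ : Subgroup _)
    rw [mul_one, mul_inv_cancel]
    exact Subgroup.one_mem _
  mem_of_mul_mem := by
    rintro ⟨c, a⟩ ⟨d, u⟩ ⟨hd, hu⟩ ⟨h1, h2⟩
    refine ⟨?_, diagUnits_mem_of_mul_mem ℓ n F hu h2⟩
    have hd' : d = 1 := hd
    subst hd'
    have h3 : c * 1 ∈ locIntUnits ℓ 𝒦 := h1
    rw [mul_one] at h3
    exact h3
  finite := by
    rintro ⟨c, x⟩
    obtain ⟨T, hT, τ, hτ⟩ := exists_conj_mem_glInt ℓ n F hℓ x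
    refine doubleCosetSet_finite (fun g => τ g.2) fun k₁ h₁ k₂ h₂ hk =>
      ⟨?_, hτ _ h₁.2 _ h₂.2 hk⟩
    change c⁻¹ * (k₁.1⁻¹ * k₂.1) * c ∈ locIntUnits ℓ 𝒦
    rw [mul_comm, mul_inv_cancel_left]
    exact Subgroup.mul_mem _ (Subgroup.inv_mem _ h₁.1) h₂.1

variable [IsCMField F]

/-- Only the existence of the decomposition is special to `GU`; the rest restricts from GL_n.
Reading the similitude relation of the triangular factor on the diagonal shows that its diagonal
part is in `GUtorus`. -/
lemma isIwasawa_GU : IsIwasawa (GUint ℓ n F) (GUunip ℓ n F) (GUdiag ℓ n F) where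
  exists_eq := by
    rintro ⟨g, hg⟩
    obtain ⟨b, ⟨c, hc⟩, hbu, k, hkU, hk, rfl⟩ := exists_GU_iwasawa ℓ n F hℓ g hg
    obtain ⟨a, ha, u, hu, rfl⟩ := exists_diagUnits_mul_unipotent b hbu
    set b := diagUnits n (LocField ℓ F) a * u with hb
    have haT : a ∈ GUtorus ℓ n F := by
      refine ⟨c, fun i => ?_⟩
      have h1 := congrFun (congrFun hc i) i
      rw [mul_apply_diag_of_upper hbu (fun i j h => by
        rw [dagger_apply, hbu _ _ (Fin.rev_lt_rev.2 h), map_zero]), dagger_apply,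
        Matrix.algebraMap_matrix_apply, if_pos rfl] at h1
      rw [ha, ha, h1]
    let t : GUtorus ℓ n F := ⟨a, haT⟩
    have huU : u ∈ GU ℓ n F := by
      have : u = ((GUdiag ℓ n F t : GU ℓ n F) : (Matrix (Fin n) (Fin n) (LocField ℓ F))ˣ)⁻¹ * b := by
        rw [hb]
        exact (inv_mul_cancel_left _ _).symm
      rw [this]
      exact Subgroup.mul_mem _ (Subgroup.inv_mem _ (GUdiag ℓ n F t).2) ⟨c, hc⟩
    exact ⟨t, ⟨u, huU⟩, hu, ⟨k, hkU⟩, hk, rfl⟩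
  conj_mem := fun a u hu => conj_mem_unipotent a.1 hu
  mem_of_mul_mem := fun a u hu h => diagUnits_mem_of_mul_mem ℓ n F hu h
  finite := by
    rintro ⟨x, hx⟩
    obtain ⟨T, hT, τ, hτ⟩ := exists_conj_mem_glInt ℓ n F hℓ x
    exact doubleCosetSet_finite (fun g => τ g.1) fun k₁ h₁ k₂ h₂ hk => hτ _ h₁ _ h₂ hk

omit hℓ in
lemma GUmodulus_eq_one_of_mem {t : GUtorus ℓ n F} (ht : GUdiag ℓ n F t ∈ GUint ℓ n F) :
    GUmodulus ℓ n F t = 1 :=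
  GUmodulus_eq_one ℓ n F fun i =>
    absNorm_eq_one ℓ F (mem_of_diagUnits_mem ℓ n F ht i).1 (mem_of_diagUnits_mem ℓ n F ht i).2

omit hℓ [IsCMField F] [Algebra 𝒦 F] in
lemma GPlusModulus_pos (t : GPlusTorus ℓ n F 𝒦) : 0 < GPlusModulus ℓ n F 𝒦 t := by
  rw [GPlusModulus_eq]
  exact Finset.prod_pos fun p _ => mul_pos (absNorm_pos ℓ F _) (inv_pos.2 (absNorm_pos ℓ F _))

variable [IsTotallyComplex 𝒦] [Algebra.IsQuadraticExtension ℚ 𝒦]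

omit hℓ in
lemma GUmodulus_cocharNorm_out (q : CocharLattice (GPlusInt ℓ n F 𝒦) (GPlusDiag ℓ n F 𝒦)) :
    GUmodulus ℓ n F (cocharNorm ℓ n F 𝒦 q).out = GPlusModulus ℓ n F 𝒦 q.out := by
  have h1 : cocharNorm ℓ n F 𝒦 q
      = CocharLattice.mk (GUint ℓ n F) (GUdiag ℓ n F) (torusNorm ℓ n F 𝒦 q.out) := by
    conv_lhs => rw [← q.mk_out]
    rfl
  have h2 : GUdiag ℓ n F ((torusNorm ℓ n F 𝒦 q.out)⁻¹ * (cocharNorm ℓ n F 𝒦 q).out) ∈ GUint ℓ n F :=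
    CocharLattice.mk_eq_mk.1 (by rw [← h1, CocharLattice.mk_out])
  have h3 := GUmodulus_eq_one_of_mem ℓ n F h2
  rw [← GUmodulus_torusNorm, ← mul_one (GUmodulus ℓ n F (torusNorm ℓ n F 𝒦 q.out)), ← h3,
    ← GUmodulus_mul, mul_inv_cancel_left]

/-- Base change preserves degrees. -/
theorem IsBaseChange.heckeDegree_eq
    {B : heckeAlgebra (GPlusInt ℓ n F 𝒦) →ₗ[ℂ] heckeAlgebra (GUint ℓ n F)} (hB : IsBaseChange ℓ n F 𝒦 B)
    (f : heckeAlgebra (GPlusInt ℓ n F 𝒦)) :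
    heckeDegree (GUint ℓ n F) (B f).1 = heckeDegree (GPlusInt ℓ n F 𝒦) f.1 :=
  heckeDegree_eq_of_satake_eq (isIwasawa_GPlus ℓ n F hℓ 𝒦) (isIwasawa_GU ℓ n F hℓ)
    (GPlusModulus_pos ℓ n F 𝒦) (GUmodulus_pos ℓ n F) (cocharNorm ℓ n F 𝒦)
    (GUmodulus_cocharNorm_out ℓ n F 𝒦) (hB.satake_eq f)

theorem coeffNorm_satakeGU_heckeUnit : coeffNorm (satakeGU ℓ n F (heckeUnit _)) = 1 := by
  rw [satakeGU, (isIwasawa_GU ℓ n F hℓ).satake_heckeUnit fun t ht => GUmodulus_eq_one_of_mem ℓ n F ht,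
    coeffNorm_single, norm_one]

end Local

/-! ### Idempotents of finite-dimensional reduced algebras -/

section Idempotents

variable (k : Type*) [Field k] (A : Type*) [CommRing A] [Algebra k A] [Module.Finite k A]

/-- A reduced Artinian ring is the product of its residue fields, each of dimension at least one. -/
lemma card_maximalSpectrum_le_finrank [IsReduced A] [IsArtinianRing A] :
    Nat.card (MaximalSpectrum A) ≤ Module.finrank k A := by
  classical
  let _ := Fintype.ofFinite (MaximalSpectrum A)
  have e : A ≃ₗ[k] ∀ I : MaximalSpectrum A, A ⧸ I.asIdeal :=
    (IsArtinianRing.equivPi A).toLinearEquiv.restrictScalars k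
  have hfin : ∀ I : MaximalSpectrum A, Module.Finite k (A ⧸ I.asIdeal) := fun I =>
    Module.Finite.of_surjective (Ideal.Quotient.mkₐ k I.asIdeal).toLinearMap
      (Ideal.Quotient.mkₐ_surjective k I.asIdeal)
  have hnt : ∀ I : MaximalSpectrum A, Nontrivial (A ⧸ I.asIdeal) := fun I =>
    Ideal.Quotient.nontrivial_iff.2 I.isMaximal.ne_top
  rw [e.finrank_eq, Module.finrank_pi_fintype, Nat.card_eq_fintype_card, Fintype.card_eq_sum_ones]
  exact Finset.sum_le_sum fun I _ => Module.finrank_pos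

/-- A reduced algebra of dimension `d` over a field has at most `2 ^ d` idempotents. -/
lemma finite_card_idempotents_le [IsReduced A] : Finite {e : A // e * e = e} ∧
    Nat.card {e : A // e * e = e} ≤ 2 ^ Module.finrank k A := by
  classical
  have : IsArtinianRing A := IsArtinianRing.of_finite k A
  let φ : {e : A // e * e = e} → Set (MaximalSpectrum A) := fun e => {I | (e : A) ∈ I.asIdeal}
  have hφ : Function.Injective φ := by
    intro e f hef
    refine Subtype.ext ((IsArtinianRing.equivPi A).injective (funext fun I => ?_))
    rw [IsArtinianRing.equivPi_apply, IsArtinianRing.equivPi_apply]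
    have hone : ∀ g : {e : A // e * e = e}, (g : A) ∉ I.asIdeal →
        Ideal.Quotient.mk I.asIdeal (g : A) = 1 := fun g hg => by
      have h1 : (g : A) * (1 - g) ∈ I.asIdeal := by
        rw [mul_sub, mul_one, g.2, sub_self]; exact Ideal.zero_mem _
      have h2 := (I.isMaximal.isPrime.mem_or_mem h1).resolve_left hg
      rw [← map_one (Ideal.Quotient.mk I.asIdeal)]
      exact (Ideal.Quotient.eq.2 h2).symm
    have hI : I ∈ φ e ↔ I ∈ φ f := by rw [hef]
    by_cases h : (e : A) ∈ I.asIdeal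
    · have h' : (f : A) ∈ I.asIdeal := hI.1 h
      rw [Ideal.Quotient.eq_zero_iff_mem.2 h, Ideal.Quotient.eq_zero_iff_mem.2 h']
    · rw [hone e h, hone f fun h' => h (hI.2 h')]
  refine ⟨Finite.of_injective φ hφ, (Nat.card_le_card_of_injective φ hφ).trans ?_⟩
  let _ := Fintype.ofFinite (MaximalSpectrum A)
  rw [Nat.card_eq_fintype_card, Fintype.card_set, ← Nat.card_eq_fintype_card]
  exact Nat.pow_le_pow_right two_pos (card_maximalSpectrum_le_finrank k A)

end Idempotents

/-! ### Products over ordered pairs of indices. -/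

section Products

lemma prod_prod_eq_prod_upperPairs {n : ℕ} {M : Type*} [CommMonoid M] (f : Fin n → Fin n → M)
    (hf : ∀ i, f i i = 1) :
    ∏ i, ∏ j, f i j = ∏ p : UpperPairs n, f p.1.1 p.1.2 * f p.1.2 p.1.1 := by
  rw [← Fintype.prod_prod_type', Finset.prod_mul_distrib]
  rw [← Finset.prod_filter_mul_prod_filter_not Finset.univ fun p : Fin n × Fin n => p.1 < p.2]
  congr 1
  · exact Finset.prod_subtype _ (fun p => by simp) _
  · rw [← Finset.prod_subtype (p := fun p : Fin n × Fin n => p.1 < p.2)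
      (Finset.univ.filter fun p : Fin n × Fin n => p.1 < p.2) (fun p => by simp)
      fun p => f p.2 p.1]
    rw [← Finset.prod_subset (s₁ := Finset.univ.filter fun p : Fin n × Fin n => p.2 < p.1)
      (fun p hp => by
        rw [Finset.mem_filter] at hp ⊢
        exact ⟨hp.1, hp.2.not_gt⟩)
      (fun p hp hp' => by
        have h1 : ¬ p.1 < p.2 := (Finset.mem_filter.1 hp).2
        have h2 : ¬ p.2 < p.1 := fun h => hp' (Finset.mem_filter.2 ⟨Finset.mem_univ _, h⟩)
        have h3 : p.1 = p.2 := le_antisymm (not_lt.1 h2) (not_lt.1 h1)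
        rw [h3, hf])]
    exact Finset.prod_bij' (fun p _ => p.swap) (fun p _ => p.swap) (by simp) (by simp) (by simp)
      (by simp) (by simp)

end Products

/-! ### The Hecke operators of `G⁺` -/

section Plus

variable (ℓ : ℕ) [Fact ℓ.Prime] (n : ℕ)
variable (F : Type*) [Field F] [NumberField F]

lemma exists_natCast_mul_eq_one {m : ℕ} (hm : ¬ ℓ ∣ m) :
    (m : LocField ℓ F) ∈ locInt ℓ F ∧ ∃ y ∈ locInt ℓ F, (m : LocField ℓ F) * y = 1 := by
  have hu : IsUnit (m : ℤ_[ℓ]) := by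
    rw [PadicInt.isUnit_iff]
    by_contra h
    exact hm (PadicInt.norm_natCast_lt_one_iff.1 (lt_of_le_of_ne (PadicInt.norm_le_one _) h))
  obtain ⟨u, hu⟩ := hu
  refine ⟨natCast_mem (locInt ℓ F) m, algebraMap ℤ_[ℓ] _ ((u⁻¹ : ℤ_[ℓ]ˣ) : ℤ_[ℓ]),
    Subalgebra.algebraMap_mem _ _, ?_⟩
  rw [← map_natCast (algebraMap ℤ_[ℓ] (LocField ℓ F)) m, ← map_mul, ← hu, Units.mul_inv, map_one]

lemma natCast_prime_mem : (ℓ : LocField ℓ F) ∈ locInt ℓ F := natCast_mem (locInt ℓ F) ℓ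

/-- The entries of the diagonal matrix `diag(a, …, a, 1, …, 1)`, with `r` entries `a`. -/
def firstEntries {R : Type*} [CommRing R] (r : ℕ) (a : Rˣ) (i : Fin n) : Rˣ := if (i : ℕ) < r then a else 1

variable (𝒦 : Type*) [Field 𝒦] [NumberField 𝒦] [Algebra 𝒦 F]

omit [Algebra 𝒦 F] in
lemma heckePlus_eq {m : ℕ} (hm : IsUnit (m : LocField ℓ F)) (r : ℕ) :
    heckePlus ℓ n F 𝒦 r m = charDoubleCoset (GPlusInt ℓ n F 𝒦)
      (1, diagUnits n (LocField ℓ F) (firstEntries n r hm.unit)) := dif_pos hm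

omit [Algebra 𝒦 F] in
lemma heckePlus_eq_heckeUnit {m : ℕ} (hm : ¬ ℓ ∣ m) (r : ℕ) :
    heckePlus ℓ n F 𝒦 r m = heckeUnit _ := by
  obtain ⟨h1, y, hy, h2⟩ := exists_natCast_mul_eq_one ℓ F hm
  have hu : IsUnit (m : LocField ℓ F) := IsUnit.of_mul_eq_one _ h2
  rw [heckePlus_eq ℓ n F 𝒦 hu]
  refine charDoubleCoset_eq_heckeUnit ⟨Subgroup.one_mem _, diagUnits_mem ℓ n F fun i => ?_⟩
  have hinv : ((hu.unit⁻¹ : (LocField ℓ F)ˣ) : LocField ℓ F) = y :=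
    Units.inv_eq_of_mul_eq_one_right h2
  rw [firstEntries]
  split_ifs
  · exact ⟨h1, hinv ▸ hy⟩
  · rw [inv_one]
    exact ⟨Subalgebra.one_mem _, Subalgebra.one_mem _⟩

/-- There are `ℓ ^ [E : ℚ]` elements of `ℤ_ℓ ⊗ 𝓞 E` that are distinct modulo `ℓ`. -/
lemma exists_digits : ∃ ω : (Module.Free.ChooseBasisIndex ℤ (𝓞 F) → Fin ℓ) → locInt ℓ F,
    ∀ v v', (ℓ : locInt ℓ F) ∣ ω v - ω v' → v = v' := by
  refine ⟨fun v => (locIntBasis ℓ F).equivFun.symm fun b => ((v b : ℕ) : ℤ_[ℓ]), fun v v' h => ?_⟩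
  rw [← pow_one (ℓ : locInt ℓ F), dvd_locInt_iff] at h
  funext b
  have hb := h b
  rw [map_sub, Finsupp.sub_apply, ← Module.Basis.equivFun_apply, ← Module.Basis.equivFun_apply,
    LinearEquiv.apply_symm_apply, LinearEquiv.apply_symm_apply, pow_one] at hb
  have h1 : ((ℓ : ℤ) : ℤ_[ℓ]) ∣ (((v b : ℕ) - (v' b : ℕ) : ℤ) : ℤ_[ℓ]) := by
    push_cast; exact hb
  have h2 : (ℓ : ℤ) ∣ ((v b : ℕ) - (v' b : ℕ) : ℤ) := by
    rw [← PadicInt.norm_int_lt_one_iff_dvd]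
    obtain ⟨z, hz⟩ := h1
    rw [hz, norm_mul]
    calc ‖((ℓ : ℤ) : ℤ_[ℓ])‖ * ‖z‖ ≤ ‖((ℓ : ℤ) : ℤ_[ℓ])‖ * 1 := by
          gcongr
          exact PadicInt.norm_le_one z
      _ < 1 := by
          rw [mul_one, PadicInt.norm_int_lt_one_iff_dvd]
  have h3 : (v b : ℕ) ≡ (v' b : ℕ) [MOD ℓ] := by
    rw [Nat.modEq_iff_dvd]
    rw [← neg_sub]
    exact (dvd_neg).2 h2
  exact Fin.ext (by rw [← Nat.mod_eq_of_lt (v b).2, ← Nat.mod_eq_of_lt (v' b).2]; exact h3)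

/-- The unipotent matrix with upper right block `X`. -/
def blockUnipotent {R : Type*} [CommRing R] (r : ℕ) (X : Fin n → Fin n → R) : Matrix (Fin n) (Fin n) R :=
  Matrix.of fun i j => if (i : ℕ) < r ∧ r ≤ j then X i j else 0

lemma blockUnipotent_mul {R : Type*} [CommRing R] (r : ℕ) (X Y : Fin n → Fin n → R) :
    blockUnipotent n r X * blockUnipotent n r Y = 0 := by
  ext i j
  rw [Matrix.mul_apply]
  refine Finset.sum_eq_zero fun k _ => ?_
  simp only [blockUnipotent, Matrix.of_apply]
  by_cases h : (k : ℕ) < r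
  · rw [if_neg (by omega), zero_mul]
  · rw [if_neg (c := (k : ℕ) < r ∧ _) (by omega), mul_zero]

lemma one_sub_mul_one_add_blockUnipotent {R : Type*} [CommRing R] (r : ℕ) (X Y : Fin n → Fin n → R) :
    (1 - blockUnipotent n r X) * (1 + blockUnipotent n r Y)
      = 1 + blockUnipotent n r Y - blockUnipotent n r X := by
  rw [mul_add, mul_one, sub_mul, one_mul, blockUnipotent_mul, sub_zero]
  abel

variable {n F} in
lemma one_add_blockUnipotent_mem {r : ℕ} {X : Fin n → Fin n → LocField ℓ F}
    (hX : ∀ i j, X i j ∈ locInt ℓ F) :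
    ∃ k ∈ glInt ℓ F n, k.val = 1 + blockUnipotent n r X ∧ k⁻¹.val = 1 - blockUnipotent n r X := by
  have h1 : (1 + blockUnipotent n r X) * (1 - blockUnipotent n r X) = 1 := by
    rw [mul_sub, mul_one, add_mul, one_mul, blockUnipotent_mul, add_zero, add_sub_cancel_right]
  have h2 : (1 - blockUnipotent n r X) * (1 + blockUnipotent n r X) = 1 := by
    rw [one_sub_mul_one_add_blockUnipotent, add_sub_cancel_right]
  have hone : ∀ i j, (1 : Matrix (Fin n) (Fin n) (LocField ℓ F)) i j ∈ locInt ℓ F := fun i j => by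
    rw [Matrix.one_apply]; split_ifs
    · exact Subalgebra.one_mem _
    · exact Subalgebra.zero_mem _
  have hB : ∀ i j, blockUnipotent n r X i j ∈ locInt ℓ F := fun i j => by
    rw [blockUnipotent, Matrix.of_apply]; split_ifs
    · exact hX i j
    · exact Subalgebra.zero_mem _
  exact ⟨⟨_, _, h1, h2⟩, ⟨fun i j => Subalgebra.add_mem _ (hone i j) (hB i j),
    fun i j => Subalgebra.sub_mem _ (hone i j) (hB i j)⟩, rfl, rfl⟩

omit [Algebra 𝒦 F] in
/-- A lower bound for the number of left cosets in the double coset of `diag(m, …, m, 1, …, 1)`. -/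
lemma le_ncard_doubleCosetSet (hℓ : Squarefree (Ideal.span {(ℓ : 𝓞 F)})) {m r : ℕ}
    (hm : IsUnit (m : LocField ℓ F)) (hdvd : ℓ ∣ m) (hr : r ≤ n) :
    ℓ ^ (Module.finrank ℚ F * (r * (n - r))) ≤ (doubleCosetSet (GPlusInt ℓ n F 𝒦)
      (1, diagUnits n (LocField ℓ F) (firstEntries n r hm.unit))).ncard := by
  classical
  obtain ⟨ω, hω⟩ := exists_digits ℓ F
  -- Unipotent matrices whose upper right r × (n - r) block has entries in a set of ℓ ^ d elements
  -- that are distinct modulo ℓ; each yields a left coset.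
  let X : (Fin r × Fin (n - r) → Module.Free.ChooseBasisIndex ℤ (𝓞 F) → Fin ℓ) →
      Fin n → Fin n → LocField ℓ F := fun v i j =>
    if h : (i : ℕ) < r ∧ r ≤ j then ω (v (⟨i, h.1⟩, ⟨j - r, by omega⟩)) else 0
  have hX : ∀ v i j, X v i j ∈ locInt ℓ F := fun v i j => by
    simp only [X]; split_ifs
    · exact Subtype.coe_prop _
    · exact Subalgebra.zero_mem _
  choose k hk hk1 hk2 using fun v => one_add_blockUnipotent_mem ℓ (r := r) (hX v)
  set a := firstEntries n r hm.unit with ha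
  let Φ : (Fin r × Fin (n - r) → Module.Free.ChooseBasisIndex ℤ (𝓞 F) → Fin ℓ) →
      doubleCosetSet (GPlusInt ℓ n F 𝒦) (1, diagUnits n (LocField ℓ F) a) := fun v =>
    ⟨_, ((1, k v) : GPlus ℓ n F 𝒦), ⟨Subgroup.one_mem _, hk v⟩, rfl⟩
  have hΦ : Function.Injective Φ := by
    intro v v' hv
    have h1 : (((1, k v) : GPlus ℓ n F 𝒦) * (1, diagUnits n (LocField ℓ F) a))⁻¹
        * (((1, k v') : GPlus ℓ n F 𝒦) * (1, diagUnits n (LocField ℓ F) a)) ∈ GPlusInt ℓ n F 𝒦 :=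
      QuotientGroup.eq.1 (Subtype.ext_iff.1 hv)
    have h2 : (k v * diagUnits n (LocField ℓ F) a)⁻¹ * (k v' * diagUnits n (LocField ℓ F) a)
      ∈ glInt ℓ F n := h1.2
    have h3 : (k v * diagUnits n (LocField ℓ F) a)⁻¹ * (k v' * diagUnits n (LocField ℓ F) a)
        = diagUnits n (LocField ℓ F) a⁻¹ * ((k v)⁻¹ * k v') * (diagUnits n (LocField ℓ F) a⁻¹)⁻¹ := by
      rw [map_inv]; group
    funext ⟨i, j⟩
    let i' : Fin n := ⟨i, by omega⟩
    let j' : Fin n := ⟨r + j, by omega⟩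
    have hij : (i' : ℕ) < r ∧ r ≤ (j' : ℕ) := ⟨i.2, by simp [j']⟩
    have hne : i' ≠ j' := fun h => by have := congrArg Fin.val h; omega
    have hXv : ∀ v, X v i' j' = ω (v (i, j)) := fun v => by
      simp only [X]
      rw [dif_pos hij]
      simp [i', j']
    -- If two of the cosets agree, this entry says that the difference of the digits divided by m is
    -- integral; ℓ divides m, so the digits agree modulo ℓ.
    have h4 := h2.1 i' j'
    change ((k v * diagUnits n (LocField ℓ F) a)⁻¹ * (k v' * diagUnits n (LocField ℓ F) a)).val i' j'
      ∈ locInt ℓ F at h4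
    rw [h3, diagUnits_conj_apply, Units.val_mul, hk1, hk2,
      one_sub_mul_one_add_blockUnipotent] at h4
    have h5 : (1 + blockUnipotent n r (X v') - blockUnipotent n r (X v)) i' j'
        = (ω (v' (i, j)) : LocField ℓ F) - ω (v (i, j)) := by
      rw [Matrix.sub_apply, Matrix.add_apply, Matrix.one_apply_ne hne, zero_add]
      simp only [blockUnipotent, Matrix.of_apply, if_pos hij, hXv]
    have h6 : a i' = hm.unit := if_pos hij.1
    have h7 : a j' = 1 := if_neg (by have := hij.2; omega)
    simp only [Pi.inv_apply] at h4
    rw [h5, h6, h7] at h4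
    simp only [inv_one, Units.val_one, mul_one] at h4
    set z : locInt ℓ F := ⟨_, h4⟩ with hz
    refine (hω _ _ ?_).symm
    obtain ⟨c, rfl⟩ := hdvd
    refine ⟨c * z, Subtype.ext ?_⟩
    have h8 : (((ℓ * c : ℕ) : LocField ℓ F)) * ((hm.unit⁻¹ : (LocField ℓ F)ˣ) : LocField ℓ F) = 1 :=
      hm.mul_val_inv
    push_cast [hz] at h8 ⊢
    linear_combination (-((ω (v' (i, j)) : LocField ℓ F) - ω (v (i, j)))) * h8
  have hfin : Finite (doubleCosetSet (GPlusInt ℓ n F 𝒦) (1, diagUnits n (LocField ℓ F) a)) :=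
    (isIwasawa_GPlus ℓ n F hℓ 𝒦).finite _
  have h9 := Nat.card_le_card_of_injective Φ hΦ
  rw [Nat.card_coe_set_eq] at h9
  refine le_trans (le_of_eq ?_) h9
  have hcard : Fintype.card (Module.Free.ChooseBasisIndex ℤ (𝓞 F)) = Module.finrank ℚ F :=
    (Module.finrank_eq_card_basis (integralBasis F)).symm
  rw [Nat.card_eq_fintype_card, Fintype.card_fun, Fintype.card_fun, Fintype.card_fin,
    Fintype.card_prod, Fintype.card_fin, Fintype.card_fin, hcard, ← pow_mul]

end Plus

/-! ### The Satake transform of the Hecke operators of `G⁺` -/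

section SatakePlus

variable (ℓ : ℕ) [Fact ℓ.Prime] (n : ℕ)
variable (F : Type*) [Field F] [NumberField F]

lemma prod_firstEntries {R : Type*} [CommRing R] {r : ℕ} (hr : r ≤ n) (a : Rˣ) :
    ∏ i : Fin n, (firstEntries n r a i : R) = (a : R) ^ r := by
  have h1 : ∀ i : Fin n, (firstEntries n r a i : R) = if (i : ℕ) < r then (a : R) else 1 := fun i => by
    rw [firstEntries]; split_ifs <;> rfl
  rw [Finset.prod_congr rfl fun i _ => h1 i, Finset.prod_ite, Finset.prod_const, Finset.prod_const_one,
    mul_one]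
  congr 1
  rw [Fin.card_filter_val_lt, min_eq_right hr]

/-- Matrices in the double coset of `diag(m, …, m, 1, …, 1)`. -/
lemma integral_of_mem_doubleCoset {c r : ℕ} (hc : ¬ ℓ ∣ c) (hr : r ≤ n)
    (hm : IsUnit ((ℓ * c : ℕ) : LocField ℓ F)) {k₁ k₂ : (Matrix (Fin n) (Fin n) (LocField ℓ F))ˣ}
    (h₁ : k₁ ∈ glInt ℓ F n) (h₂ : k₂ ∈ glInt ℓ F n) {g : (Matrix (Fin n) (Fin n) (LocField ℓ F))ˣ}
    (hg : g = k₁ * diagUnits n (LocField ℓ F) (firstEntries n r hm.unit) * k₂) :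
    (∀ i j, g.val i j ∈ locInt ℓ F) ∧ (∀ i j, (ℓ : LocField ℓ F) * g⁻¹.val i j ∈ locInt ℓ F) ∧
      ∃ x ∈ locInt ℓ F, ∃ y ∈ locInt ℓ F, x * y = 1 ∧ g.val.det = x * (ℓ : LocField ℓ F) ^ r := by
  obtain ⟨hcR, d, hd, hcd⟩ := exists_natCast_mul_eq_one ℓ F hc
  let S := Subring.matrix (n := Fin n) (locInt ℓ F).toSubring
  have hdiag : ∀ f : Fin n → LocField ℓ F, (∀ i, f i ∈ locInt ℓ F) → Matrix.diagonal f ∈ S :=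
    fun f hf i j => by
      change Matrix.diagonal f i j ∈ locInt ℓ F
      rw [Matrix.diagonal_apply]; split_ifs
      · exact hf i
      · exact Subalgebra.zero_mem _
  have hinv : (ℓ : LocField ℓ F) * ((hm.unit⁻¹ : (LocField ℓ F)ˣ) : LocField ℓ F) = d := by
    have h8 : (((ℓ * c : ℕ) : LocField ℓ F)) * ((hm.unit⁻¹ : (LocField ℓ F)ˣ) : LocField ℓ F) = 1 :=
      hm.mul_val_inv
    generalize ((hm.unit⁻¹ : (LocField ℓ F)ˣ) : LocField ℓ F) = I at h8 ⊢
    rw [Nat.cast_mul] at h8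
    linear_combination d * h8 - (ℓ : LocField ℓ F) * I * hcd
  refine ⟨?_, ?_, ?_⟩
  · have : g.val ∈ S := by
      rw [hg, Units.val_mul, Units.val_mul, diagUnits_val]
      refine Subring.mul_mem _ (Subring.mul_mem _ h₁.1 (hdiag _ fun i => ?_)) h₂.1
      rw [firstEntries]; split_ifs
      · exact natCast_mem (locInt ℓ F) _
      · exact Subalgebra.one_mem _
    exact this
  · have : (ℓ : LocField ℓ F) • g⁻¹.val ∈ S := by
      have e : (ℓ : LocField ℓ F) • g⁻¹.val = k₂⁻¹.val * ((ℓ : LocField ℓ F) •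
          Matrix.diagonal fun i => (((firstEntries n r hm.unit)⁻¹ i : (LocField ℓ F)ˣ) : LocField ℓ F))
          * k₁⁻¹.val := by
        rw [hg, mul_inv_rev, mul_inv_rev, ← map_inv, Units.val_mul, Units.val_mul, diagUnits_val,
          Matrix.mul_smul, Matrix.smul_mul, mul_assoc]
      rw [e, ← Matrix.diagonal_smul]
      refine Subring.mul_mem _ (Subring.mul_mem _ h₂.2 (hdiag _ fun i => ?_)) h₁.2
      rw [Pi.smul_apply, smul_eq_mul, Pi.inv_apply, firstEntries]
      split_ifs
      · rw [hinv]; exact hd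
      · rw [inv_one, Units.val_one, mul_one]; exact natCast_prime_mem ℓ F
    exact fun i j => this i j
  · have hdet : ∀ k ∈ glInt ℓ F n, k.val.det ∈ locInt ℓ F ∧ k⁻¹.val.det ∈ locInt ℓ F ∧
        k.val.det * k⁻¹.val.det = 1 := fun k hk =>
      ⟨det_mem (R := (locInt ℓ F).toSubring) fun i j => hk.1 i j,
        det_mem (R := (locInt ℓ F).toSubring) fun i j => hk.2 i j, by
        rw [← Matrix.det_mul, Units.mul_inv, Matrix.det_one]⟩
    obtain ⟨a1, a2, a3⟩ := hdet k₁ h₁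
    obtain ⟨b1, b2, b3⟩ := hdet k₂ h₂
    refine ⟨k₁.val.det * (c : LocField ℓ F) ^ r * k₂.val.det,
      Subalgebra.mul_mem _ (Subalgebra.mul_mem _ a1 (Subalgebra.pow_mem _ hcR r)) b1,
      k₁⁻¹.val.det * d ^ r * k₂⁻¹.val.det,
      Subalgebra.mul_mem _ (Subalgebra.mul_mem _ a2 (Subalgebra.pow_mem _ hd r)) b2, ?_, ?_⟩
    · have hcd' : (c : LocField ℓ F) ^ r * d ^ r = 1 := by rw [← mul_pow, hcd, one_pow]
      linear_combination k₂.val.det * k₂⁻¹.val.det * (c : LocField ℓ F) ^ r * d ^ r * a3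
        + (c : LocField ℓ F) ^ r * d ^ r * b3 + hcd'
    · rw [hg, Units.val_mul, Units.val_mul, Matrix.det_mul, Matrix.det_mul, diagUnits_val,
        Matrix.det_diagonal, prod_firstEntries n hr, IsUnit.unit_spec]
      push_cast
      ring

variable (𝒦 : Type*) [Field 𝒦] [NumberField 𝒦]

/-- The class of `(1, idemPow ℓ ε)` in the lattice of cocharacters of `G⁺`. -/
structure IsIdemClass (q : CocharLattice (GPlusInt ℓ n F 𝒦) (GPlusDiag ℓ n F 𝒦))
    (ε u v : Fin n → LocField ℓ F) : Prop where
  fst_mem : q.out.1 ∈ locIntUnits ℓ 𝒦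
  mem : ∀ i, ε i ∈ locInt ℓ F
  idem : ∀ i, ε i * ε i = ε i
  mem_left : ∀ i, u i ∈ locInt ℓ F
  mem_right : ∀ i, v i ∈ locInt ℓ F
  mul_eq_one : ∀ i, u i * v i = 1
  eq_mul : ∀ i, (q.out.2 i : LocField ℓ F) = u i * idemPow (ℓ : LocField ℓ F) (ε i)

-- Diagonal matrices with the same elementary divisors differ by units of the order. So the
-- idempotents alone determine the class, and classes can be counted by them.
variable {ℓ n F 𝒦} in
lemma IsIdemClass.unique {q q' : CocharLattice (GPlusInt ℓ n F 𝒦) (GPlusDiag ℓ n F 𝒦)}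
    {ε u v u' v' : Fin n → LocField ℓ F} (h : IsIdemClass ℓ n F 𝒦 q ε u v)
    (h' : IsIdemClass ℓ n F 𝒦 q' ε u' v') : q = q' := by
  rw [← q.mk_out, ← q'.mk_out]
  refine CocharLattice.mk_eq_mk.2 ⟨Subgroup.mul_mem _ (Subgroup.inv_mem _ h.fst_mem) h'.fst_mem, ?_⟩
  have key : ∀ {p p' : CocharLattice (GPlusInt ℓ n F 𝒦) (GPlusDiag ℓ n F 𝒦)}
      {w z w' z' : Fin n → LocField ℓ F}, IsIdemClass ℓ n F 𝒦 p ε w z →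
      IsIdemClass ℓ n F 𝒦 p' ε w' z' → ∀ i, ((p.out.2 i)⁻¹ * p'.out.2 i : (LocField ℓ F)ˣ).val ∈ locInt ℓ F := by
    intro p p' w z w' z' hp hp' i
    have e : ((p.out.2 i)⁻¹ * p'.out.2 i : (LocField ℓ F)ˣ).val = z i * w' i := by
      refine (p.out.2 i).isUnit.mul_left_cancel ?_
      rw [← Units.val_mul, mul_inv_cancel_left, hp'.eq_mul, hp.eq_mul]
      linear_combination (-(w' i * idemPow (ℓ : LocField ℓ F) (ε i))) * hp.mul_eq_one i
    rw [e]
    exact Subalgebra.mul_mem _ (hp.mem_right i) (hp'.mem_left i)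
  refine diagUnits_mem ℓ n F fun i => ⟨key h h' i, ?_⟩
  have := key h' h i
  change (((q.out.2 i)⁻¹ * q'.out.2 i)⁻¹ : (LocField ℓ F)ˣ).val ∈ locInt ℓ F
  rw [mul_inv_rev, inv_inv]
  exact this

variable (hℓ : Squarefree (Ideal.span {(ℓ : 𝓞 F)})) {c r : ℕ} (hc : ¬ ℓ ∣ c) (hr : r ≤ n)
  (hm : IsUnit ((ℓ * c : ℕ) : LocField ℓ F))

/-- The matrix `g` represents the left coset of (q, u), so it differs from an element of the double
coset by an integral invertible matrix; that it is triangular with diagonal part `q.out.2` comes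
from its shape. -/
lemma integral_of_iwasawaMap_mem (hc : ¬ ℓ ∣ c) (hr : r ≤ n)
    {q : CocharLattice (GPlusInt ℓ n F 𝒦) (GPlusDiag ℓ n F 𝒦)}
    {u : GPlusUnip ℓ n F 𝒦 ⧸ (GPlusInt ℓ n F 𝒦).subgroupOf (GPlusUnip ℓ n F 𝒦)}
    (hu : iwasawaMap (GPlusInt ℓ n F 𝒦) (GPlusUnip ℓ n F 𝒦) (GPlusDiag ℓ n F 𝒦) (q, u)
      ∈ doubleCosetSet (GPlusInt ℓ n F 𝒦) (1, diagUnits n (LocField ℓ F) (firstEntries n r hm.unit)))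
    {g : (Matrix (Fin n) (Fin n) (LocField ℓ F))ˣ}
    (hg : g = diagUnits n (LocField ℓ F) q.out.2 * (u.out : GPlusUnip ℓ n F 𝒦).1.2) :
    q.out.1 ∈ locIntUnits ℓ 𝒦 ∧ (∀ i j, j < i → g.val i j = 0) ∧ (∀ i, g.val i i = q.out.2 i) ∧
    (∀ i j, g.val i j ∈ locInt ℓ F) ∧ (∀ i j, (ℓ : LocField ℓ F) * g⁻¹.val i j ∈ locInt ℓ F) ∧
      ∃ x ∈ locInt ℓ F, ∃ y ∈ locInt ℓ F, x * y = 1 ∧ g.val.det = x * (ℓ : LocField ℓ F) ^ r := by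
  obtain ⟨k, hk, hku⟩ := hu
  have h1 := QuotientGroup.eq.1 hku
  set w : GPlusUnip ℓ n F 𝒦 := u.out with hw
  obtain ⟨hw1, hw2⟩ := w.2
  have hw1' : w.1.1 = 1 := hw1
  have h3 : q.out.1 * w.1.1 = k.1 * ((k.1 * 1)⁻¹ * (q.out.1 * w.1.1)) := by
    rw [mul_one, mul_inv_cancel_left]
  have h2 : (GPlusDiag ℓ n F 𝒦 q.out * (w : GPlus ℓ n F 𝒦))⁻¹
      * (k * (1, diagUnits n (LocField ℓ F) (firstEntries n r hm.unit))) ∈ GPlusInt ℓ n F 𝒦 := h1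
  have h4 : (q.out.1 * w.1.1)⁻¹ * (k.1 * 1) ∈ locIntUnits ℓ 𝒦 := h2.1
  have h5 : g⁻¹ * (k.2 * diagUnits n (LocField ℓ F) (firstEntries n r hm.unit)) ∈ glInt ℓ F n := by
    rw [hg]; exact h2.2
  refine ⟨?_, ?_, ?_, integral_of_mem_doubleCoset ℓ n F hc hr hm hk.2 (Subgroup.inv_mem _ h5) (by group)⟩
  · rw [hw1', mul_one, mul_one] at h4
    have h6 := Subgroup.mul_mem _ (show k.1 ∈ locIntUnits ℓ 𝒦 from hk.1) (Subgroup.inv_mem _ h4)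
    rwa [mul_inv_rev, inv_inv, mul_inv_cancel_left] at h6
  · intro i j hij
    have h0 : w.1.2.val i j = 0 := hw2.1.1 i j hij
    rw [hg, Units.val_mul, diagUnits_val, Matrix.diagonal_mul, h0, mul_zero]
  · intro i
    have h0 : w.1.2.val i i = 1 := hw2.1.2 i
    rw [hg, Units.val_mul, diagUnits_val, Matrix.diagonal_mul, h0, mul_one]

include hℓ

/-- For triangular `g` with `g` and ℓ g⁻¹ integral, the diagonal entries of both multiply to ℓ. So
each diagonal entry of `g` divides ℓ, and `IsUnramifiedOrder.exists_idemPow` applies. -/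
lemma exists_isIdemClass (hc : ¬ ℓ ∣ c) (hr : r ≤ n)
    {q : CocharLattice (GPlusInt ℓ n F 𝒦) (GPlusDiag ℓ n F 𝒦)}
    {u : GPlusUnip ℓ n F 𝒦 ⧸ (GPlusInt ℓ n F 𝒦).subgroupOf (GPlusUnip ℓ n F 𝒦)}
    (hu : iwasawaMap (GPlusInt ℓ n F 𝒦) (GPlusUnip ℓ n F 𝒦) (GPlusDiag ℓ n F 𝒦) (q, u)
      ∈ doubleCosetSet (GPlusInt ℓ n F 𝒦) (1, diagUnits n (LocField ℓ F) (firstEntries n r hm.unit))) :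
    ∃ ε w v : Fin n → LocField ℓ F, IsIdemClass ℓ n F 𝒦 q ε w v ∧
      ∃ x ∈ locInt ℓ F, ∃ y ∈ locInt ℓ F, x * y = 1 ∧
        ∏ i, idemPow (ℓ : LocField ℓ F) (ε i) = x * (ℓ : LocField ℓ F) ^ r := by
  obtain ⟨h1, htri, hd, hint, hint', x, hx, y, hy, hxy, hdet⟩ :=
    integral_of_iwasawaMap_mem ℓ n F 𝒦 hm hc hr hu rfl
  set g := diagUnits n (LocField ℓ F) q.out.2 * (u.out : GPlusUnip ℓ n F 𝒦).1.2 with hg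
  have hginv := inv_upper g htri
  have hgi : ∀ i, g.val i i * g⁻¹.val i i = 1 := fun i => by
    rw [← mul_apply_diag_of_upper htri hginv, Units.mul_inv, Matrix.one_apply_eq]
  have := fun i => (isUnramifiedOrder_locInt ℓ F hℓ).exists_idemPow (a := g.val i i)
    (c := (ℓ : LocField ℓ F) * g⁻¹.val i i) (hint i i) (hint' i i)
    (by linear_combination (ℓ : LocField ℓ F) * hgi i)
  choose ε hε hεε w hw v' hwe using this
  choose v hv hwv using v'
  refine ⟨ε, w, v, ⟨h1, hε, hεε, hw, hv, hwv, fun i => by rw [← hd]; exact hwe i⟩, x * ∏ i, v i,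
    Subalgebra.mul_mem _ hx (Subalgebra.prod_mem _ fun i _ => hv i), y * ∏ i, w i,
    Subalgebra.mul_mem _ hy (Subalgebra.prod_mem _ fun i _ => hw i), ?_, ?_⟩
  · have : (∏ i, w i) * ∏ i, v i = 1 := by
      rw [← Finset.prod_mul_distrib]; exact Finset.prod_eq_one fun i _ => hwv i
    linear_combination (∏ i, w i) * (∏ i, v i) * hxy + this
  · have h2 : ∏ i, g.val i i = g.val.det := (Matrix.det_of_isUpperTriangular fun i j h => htri i j h).symm
    have h3 : ∀ i, idemPow (ℓ : LocField ℓ F) (ε i) = v i * g.val i i := fun i => by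
      rw [hwe]; linear_combination (-idemPow (ℓ : LocField ℓ F) (ε i)) * hwv i
    rw [Finset.prod_congr rfl fun i _ => h3 i, Finset.prod_mul_distrib, h2, hdet]
    ring

/-- The upper bound for the coefficients of the Satake transform. -/
lemma sqrt_modulus_mul_ncard_le (hc : ¬ ℓ ∣ c) (hr : r ≤ n)
    {q : CocharLattice (GPlusInt ℓ n F 𝒦) (GPlusDiag ℓ n F 𝒦)} {ε w v : Fin n → LocField ℓ F}
    (hq : IsIdemClass ℓ n F 𝒦 q ε w v) {x y : LocField ℓ F} (hx : x ∈ locInt ℓ F) (hy : y ∈ locInt ℓ F)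
    (hxy : x * y = 1) (hprod : ∏ i, idemPow (ℓ : LocField ℓ F) (ε i) = x * (ℓ : LocField ℓ F) ^ r) :
    Real.sqrt (GPlusModulus ℓ n F 𝒦 q.out) * ({u | iwasawaMap (GPlusInt ℓ n F 𝒦) (GPlusUnip ℓ n F 𝒦)
      (GPlusDiag ℓ n F 𝒦) (q, u) ∈ doubleCosetSet (GPlusInt ℓ n F 𝒦)
        (1, diagUnits n (LocField ℓ F) (firstEntries n r hm.unit))}.ncard : ℝ)
      ≤ Real.sqrt ((ℓ : ℝ) ^ (Module.finrank ℚ F * (r * (n - r)))) := by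
  classical
  have hred := isReduced_locField ℓ F hℓ
  have hreps : ∀ e : LocField ℓ F, ∃ (t : ℕ) (Q : Finset (LocField ℓ F)),
      (e ∈ locInt ℓ F → e * e = e →
        ‖Algebra.norm ℚ_[ℓ] (idemPow (ℓ : LocField ℓ F) e)‖ = ((ℓ : ℝ) ^ t)⁻¹) ∧ Q.card ≤ ℓ ^ t ∧
      (∀ q ∈ Q, q ∈ locInt ℓ F ∧ e * q = q) ∧ (e ∈ locInt ℓ F → e * e = e →
        ∀ x ∈ locInt ℓ F, e * x = x → ∃ q ∈ Q, ∃ s ∈ locInt ℓ F, x - q = ℓ * s) := fun e => by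
    by_cases h : e ∈ locInt ℓ F ∧ e * e = e
    · obtain ⟨t, h1, Q, h2, h3, h4⟩ := exists_idem_reps ℓ F e h.1 h.2
      exact ⟨t, Q, fun _ _ => h1, h2, h3, fun _ _ => h4⟩
    · exact ⟨0, ∅, fun h1 h2 => absurd ⟨h1, h2⟩ h, by simp, by simp, fun h1 h2 => absurd ⟨h1, h2⟩ h⟩
  choose t Q hnorm hcard hQ hQx using hreps
  have hcR : ∀ {e f}, e ∈ locInt ℓ F → f ∈ locInt ℓ F → e * (1 - f) ∈ locInt ℓ F := fun he hf =>
    Subalgebra.mul_mem _ he (Subalgebra.sub_mem _ (Subalgebra.one_mem _) hf)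
  set S := {u | iwasawaMap (GPlusInt ℓ n F 𝒦) (GPlusUnip ℓ n F 𝒦)
      (GPlusDiag ℓ n F 𝒦) (q, u) ∈ doubleCosetSet (GPlusInt ℓ n F 𝒦)
        (1, diagUnits n (LocField ℓ F) (firstEntries n r hm.unit))} with hS
  let g : S → (Matrix (Fin n) (Fin n) (LocField ℓ F))ˣ := fun u =>
    diagUnits n (LocField ℓ F) q.out.2 * (u.1.out : GPlusUnip ℓ n F 𝒦).1.2
  have hg : ∀ u : S, (∀ i j, j < i → (g u).val i j = 0) ∧ (∀ i, (g u).val i i = w i * idemPow (ℓ : LocField ℓ F) (ε i)) ∧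
      (∀ i j, (g u).val i j ∈ locInt ℓ F) ∧ (∀ i j, (ℓ : LocField ℓ F) * (g u)⁻¹.val i j ∈ locInt ℓ F) := fun u => by
    obtain ⟨h1, htri, hd, hint, hint', -⟩ := integral_of_iwasawaMap_mem ℓ n F 𝒦 hm hc hr u.2 rfl
    exact ⟨htri, fun i => by rw [← hq.eq_mul]; exact hd i, hint, hint'⟩
  -- Each class `u` is encoded by a Hermite normal form of t u; its diagonal depends only on ε, so
  -- its entries above the diagonal determine `u`.
  have hY := fun u => IsUnramifiedOrder.exists_reduction (R := (locInt ℓ F).toSubring)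
    (π := (ℓ : LocField ℓ F)) (Q := fun e => (Q e : Set (LocField ℓ F)))
    (fun e q hq => (hQ e q hq).1) (fun e q hq => (hQ e q hq).2) (fun e he hee x hx hex => hQx e he hee x hx hex)
    hq.mem hq.idem hq.mul_eq_one hq.mem_right (g u) (hg u).1 (hg u).2.1 (hg u).2.2.1 (hg u).2.2.2
  choose Y hYQ V hVR hV using hY
  let Φ : S → ∀ p : UpperPairs n, Q (ε p.1.1 * (1 - ε p.1.2)) := fun u p => ⟨Y u p.1.1 p.1.2, hYQ u _ _ p.2⟩
  have hΦ : Function.Injective Φ := by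
    intro u u' huu
    have hVV : V u = V u' := by
      rw [hV, hV]
      ext i j
      simp only [Matrix.of_apply]
      by_cases hij : i < j
      · rw [if_pos hij, if_pos hij]
        exact Subtype.ext_iff.1 (congrFun huu ⟨(i, j), hij⟩)
      · rw [if_neg hij, if_neg hij]
    have hVtri : ∀ i j, j < i → V u i j = 0 := fun i j hij => by
      rw [hV, Matrix.of_apply, if_neg hij.not_gt, if_neg hij.ne']
    have hVd : ∀ i, V u i i = idemPow (ℓ : LocField ℓ F) (ε i) := fun i => by
      rw [hV, Matrix.of_apply, if_neg (lt_irrefl i), if_pos rfl]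
    obtain ⟨k, hk, hk'⟩ := IsUnramifiedOrder.inv_mul_mem_of_reduction (R := (locInt ℓ F).toSubring)
      hq.mul_eq_one hq.mem_left hVtri hVd (g u) (hg u).1 (hg u).2.1 (hVR u)
    obtain ⟨k', hk₁, hk₁'⟩ := IsUnramifiedOrder.inv_mul_mem_of_reduction (R := (locInt ℓ F).toSubring)
      hq.mul_eq_one hq.mem_left (hVV ▸ hVtri) (hVV ▸ hVd) (g u') (hg u').1 (hg u').2.1 (hVR u')
    have h1 : g u * k = g u' * k' := Units.ext (hk'.trans (hVV.trans hk₁'.symm))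
    have h2 : (u.1.out : GPlusUnip ℓ n F 𝒦).1.2⁻¹ * (u'.1.out : GPlusUnip ℓ n F 𝒦).1.2 = k * k'⁻¹ := by
      have h3 : (u.1.out : GPlusUnip ℓ n F 𝒦).1.2⁻¹ * (u'.1.out : GPlusUnip ℓ n F 𝒦).1.2
          = (g u)⁻¹ * (g u' * k') * k'⁻¹ := by
        simp only [g]; group
      rw [h3, ← h1]; group
    refine Subtype.ext ?_
    rw [← u.1.out_eq', ← u'.1.out_eq']
    refine QuotientGroup.eq.2 ⟨?_, ?_⟩
    · have e1 : (u.1.out : GPlusUnip ℓ n F 𝒦).1.1 = 1 := (u.1.out : GPlusUnip ℓ n F 𝒦).2.1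
      have e2 : (u'.1.out : GPlusUnip ℓ n F 𝒦).1.1 = 1 := (u'.1.out : GPlusUnip ℓ n F 𝒦).2.1
      change (u.1.out : GPlusUnip ℓ n F 𝒦).1.1⁻¹ * (u'.1.out : GPlusUnip ℓ n F 𝒦).1.1 ∈ locIntUnits ℓ 𝒦
      rw [e1, e2, inv_one, one_mul]
      exact Subgroup.one_mem _
    · change (u.1.out : GPlusUnip ℓ n F 𝒦).1.2⁻¹ * (u'.1.out : GPlusUnip ℓ n F 𝒦).1.2 ∈ glInt ℓ F n
      rw [h2]
      exact Subgroup.mul_mem _ hk (Subgroup.inv_mem _ hk₁)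
  have hcount : S.ncard ≤ ∏ p : UpperPairs n, ℓ ^ t (ε p.1.1 * (1 - ε p.1.2)) := by
    have h1 := Nat.card_le_card_of_injective Φ hΦ
    rw [Nat.card_coe_set_eq, Nat.card_pi] at h1
    refine h1.trans (Finset.prod_le_prod' fun p _ => ?_)
    rw [Nat.card_eq_fintype_card, Fintype.card_coe]
    exact hcard _
  -- D_ij⁻¹ is ℓ ^ t, which bounds the number of representatives allowed in position (i, j). The
  -- common part ε_i ε_j cancels in |t_i| / |t_j|, leaving D_ij / D_ji.
  let D : Fin n → Fin n → ℝ := fun i j => ‖Algebra.norm ℚ_[ℓ] (idemPow (ℓ : LocField ℓ F) (ε i * (1 - ε j)))‖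
  have hD : ∀ i j, D i j = ((ℓ : ℝ) ^ t (ε i * (1 - ε j)))⁻¹ := fun i j =>
    hnorm _ (hcR (hq.mem i) (hq.mem j)) (mul_compl_idem (hq.idem i) (hq.idem j))
  have hℓpos : (0 : ℝ) < ℓ := by exact_mod_cast (Fact.out : ℓ.Prime).pos
  have hDpos : ∀ i j, 0 < D i j := fun i j => by rw [hD]; positivity
  have hDii : ∀ i, D i i = 1 := fun i => by
    have : ε i * (1 - ε i) = 0 := by linear_combination -hq.idem i
    simp only [D, this, idemPow, mul_zero, sub_zero, zero_add, map_one, norm_one]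
  have habs : ∀ i, absNorm ℓ F (q.out.2 i) = ‖Algebra.norm ℚ_[ℓ] (idemPow (ℓ : LocField ℓ F) (ε i))‖ := fun i => by
    rw [absNorm_apply, hq.eq_mul, map_mul, norm_mul,
      norm_norm_eq_one ℓ F (hq.mem_left i) (hq.mem_right i) (hq.mul_eq_one i), one_mul]
  have habs' : ∀ i j, absNorm ℓ F (q.out.2 i)
      = ‖Algebra.norm ℚ_[ℓ] (idemPow (ℓ : LocField ℓ F) (ε i * ε j))‖ * D i j := fun i j => by
    rw [habs, idemPow_eq_mul (hq.idem i) (hq.idem j), map_mul, norm_mul]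
  have hquot : ∀ i j, absNorm ℓ F (q.out.2 i) * (absNorm ℓ F (q.out.2 j))⁻¹ = D i j * (D j i)⁻¹ := fun i j => by
    have h1 := absNorm_pos ℓ F (q.out.2 i)
    rw [habs' i j] at h1
    have h2 : ‖Algebra.norm ℚ_[ℓ] (idemPow (ℓ : LocField ℓ F) (ε i * ε j))‖ ≠ 0 := fun h => by
      rw [h, zero_mul] at h1; exact lt_irrefl _ h1
    rw [habs' i j, habs' j i, mul_comm (ε j) (ε i)]
    have := (hDpos j i).ne'
    field_simp
  have hprodD : ∏ p : UpperPairs n, D p.1.1 p.1.2 * D p.1.2 p.1.1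
      = ((ℓ : ℝ) ^ (Module.finrank ℚ F * (r * (n - r))))⁻¹ := by
    rw [← prod_prod_eq_prod_upperPairs D hDii]
    have h1 := IsUnramifiedOrder.prod_idemPow (isUnramifiedOrder_locInt ℓ F hℓ) hr hq.mem hq.idem hx hy hxy hprod
    have h2 := congrArg (fun z => ‖Algebra.norm ℚ_[ℓ] z‖) h1
    simp only [map_prod, norm_prod, map_pow, norm_pow, norm_natCast_prime] at h2
    rw [pow_mul, ← inv_pow]
    exact h2
  rw [← Real.sqrt_sq (Nat.cast_nonneg (α := ℝ) S.ncard), ← Real.sqrt_mul (GPlusModulus_pos ℓ n F 𝒦 _).le]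
  refine Real.sqrt_le_sqrt ?_
  have hcount' : (S.ncard : ℝ) ≤ ∏ p : UpperPairs n, (D p.1.1 p.1.2)⁻¹ := by
    refine (Nat.cast_le.2 hcount).trans (le_of_eq ?_)
    rw [Nat.cast_prod]
    exact Finset.prod_congr rfl fun p _ => by rw [hD, inv_inv, Nat.cast_pow]
  -- The bound for the count is squared against the modulus: for i < j, (D_ij / D_ji) · D_ij⁻² =
  -- (D_ij D_ji)⁻¹, which is symmetric in i and j. The total therefore no longer depends on the
  -- class `q`.
  calc GPlusModulus ℓ n F 𝒦 q.out * (S.ncard : ℝ) ^ 2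
      ≤ (∏ p : UpperPairs n, D p.1.1 p.1.2 * (D p.1.2 p.1.1)⁻¹)
        * (∏ p : UpperPairs n, (D p.1.1 p.1.2)⁻¹) ^ 2 := by
        rw [GPlusModulus_eq, Finset.prod_congr rfl fun p _ => hquot p.1.1 p.1.2]
        gcongr
    _ = (∏ p : UpperPairs n, D p.1.1 p.1.2 * D p.1.2 p.1.1)⁻¹ := by
        rw [← Finset.prod_pow, ← Finset.prod_mul_distrib, ← Finset.prod_inv_distrib]
        refine Finset.prod_congr rfl fun p _ => ?_
        have h1 := (hDpos p.1.1 p.1.2).ne'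
        have h2 := (hDpos p.1.2 p.1.1).ne'
        field_simp
    _ = _ := by rw [hprodD, inv_inv]

/-- The coefficients of the Satake transform of the Hecke operators of `G⁺`. -/
theorem coeffNorm_satakePlus_le (hc : ¬ ℓ ∣ c) (hr : r ≤ n) :
    coeffNorm (satakePlus ℓ n F 𝒦 (heckePlus ℓ n F 𝒦 r (ℓ * c)))
      ≤ ((2 : ℝ) ^ Module.finrank ℚ F) ^ n * Real.sqrt ((ℓ : ℝ) ^ (Module.finrank ℚ F * (r * (n - r)))) := by
  classical
  have hc0 : ℓ * c ≠ 0 := mul_ne_zero (Fact.out : ℓ.Prime).ne_zero (by rintro rfl; exact hc (dvd_zero _))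
  have hm : IsUnit ((ℓ * c : ℕ) : LocField ℓ F) := isUnit_natCast_locField ℓ F hc0
  have hred := isReduced_locField ℓ F hℓ
  obtain ⟨hfin, hcard⟩ := finite_card_idempotents_le ℚ_[ℓ] (LocField ℓ F)
  rw [finrank_locField] at hcard
  rw [heckePlus_eq ℓ n F 𝒦 hm]
  set P := satakePlus ℓ n F 𝒦 (charDoubleCoset (GPlusInt ℓ n F 𝒦)
      (1, diagUnits n (LocField ℓ F) (firstEntries n r hm.unit))) with hP
  have hIw := isIwasawa_GPlus ℓ n F hℓ 𝒦
  have hcoeff : ∀ q, P.coeff q = _ := fun q => (hIw.satake_coeff _ _ q).trans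
    (hIw.satakeCoeff_charDoubleCoset (GPlusModulus ℓ n F 𝒦) _ q)
  have hex : ∀ q, P.coeff q ≠ 0 → ∃ ε w v : Fin n → LocField ℓ F, IsIdemClass ℓ n F 𝒦 q ε w v ∧
      ∃ x ∈ locInt ℓ F, ∃ y ∈ locInt ℓ F, x * y = 1 ∧
        ∏ i, idemPow (ℓ : LocField ℓ F) (ε i) = x * (ℓ : LocField ℓ F) ^ r := fun q hq => by
    rw [hcoeff] at hq
    have h1 := right_ne_zero_of_mul hq
    have h2 : {u | iwasawaMap (GPlusInt ℓ n F 𝒦) (GPlusUnip ℓ n F 𝒦)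
      (GPlusDiag ℓ n F 𝒦) (q, u) ∈ doubleCosetSet (GPlusInt ℓ n F 𝒦)
        (1, diagUnits n (LocField ℓ F) (firstEntries n r hm.unit))}.ncard ≠ 0 := by exact_mod_cast h1
    obtain ⟨u, hu⟩ := Set.nonempty_of_ncard_ne_zero h2
    exact exists_isIdemClass ℓ n F 𝒦 hℓ hm hc hr hu
  -- A class in the support is determined by its n idempotents, and F_ℓ has at most 2 ^ d of them.
  have hsupp : P.coeff.support.card ≤ (2 ^ Module.finrank ℚ F) ^ n := by
    have hex' : ∀ q : P.coeff.support, ∃ ε : Fin n → {e : LocField ℓ F // e * e = e},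
        ∃ w v, IsIdemClass ℓ n F 𝒦 q.1 (fun i => (ε i : LocField ℓ F)) w v := fun q => by
      obtain ⟨ε, w, v, h, -⟩ := hex q.1 (Finsupp.mem_support_iff.1 q.2)
      exact ⟨fun i => ⟨ε i, h.idem i⟩, w, v, h⟩
    choose ε w v hε using hex'
    have hinj : Function.Injective ε := fun q q' h => by
      have h1 := hε q
      rw [h] at h1
      exact Subtype.ext (h1.unique (hε q'))
    have h1 := Nat.card_le_card_of_injective ε hinj
    rw [Nat.card_fun, Nat.card_eq_fintype_card, Fintype.card_coe, Nat.card_fin] at h1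
    exact h1.trans (Nat.pow_le_pow_left hcard n)
  have hB := Real.sqrt_nonneg ((ℓ : ℝ) ^ (Module.finrank ℚ F * (r * (n - r))))
  refine (coeffNorm_le P (s := P.coeff.support) hB (fun q hq => Finsupp.mem_support_iff.2 hq)
    fun q => ?_).trans (mul_le_mul_of_nonneg_right (by exact_mod_cast hsupp) hB)
  by_cases hq : P.coeff q = 0
  · rw [hq, norm_zero]; exact hB
  · obtain ⟨ε, w, v, h, x, hx, y, hy, hxy, hprod⟩ := hex q hq
    rw [hcoeff, norm_mul, Complex.norm_real, Complex.norm_natCast, Real.norm_of_nonneg (Real.sqrt_nonneg _)]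
    exact sqrt_modulus_mul_ncard_le ℓ n F 𝒦 hℓ hm hc hr h hx hy hxy hprod

end SatakePlus

/-! ### The local Hecke operators -/

section HeckeLocal

variable (ℓ : ℕ) [Fact ℓ.Prime] (n : ℕ)
variable (F : Type*) [Field F] [NumberField F] [IsCMField F]
variable (𝒦 : Type*) [Field 𝒦] [NumberField 𝒦] [Algebra 𝒦 F]
variable [IsTotallyComplex 𝒦] [Algebra.IsQuadraticExtension ℚ 𝒦]

/-- Both branches in the definition of `baseChange` send the unit to the unit. This makes the adelic
products finite. -/
theorem heckeLocal_eq_heckeUnit {m : ℕ} (hm : ¬ ℓ ∣ m) (r : ℕ) :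
    heckeLocal ℓ n F 𝒦 r m = heckeUnit _ := by
  classical
  rw [heckeLocal, heckePlus_eq_heckeUnit ℓ n F 𝒦 hm, baseChange]
  split_ifs with h
  · exact h.choose_spec.map_unit
  · change (heckeUnit (GPlusInt ℓ n F 𝒦)).1 1 • heckeUnit (GUint ℓ n F) = _
    rw [heckeUnit_apply, if_pos (Subgroup.one_mem _), one_smul]

-- Otherwise the double coset would be a single left coset, against the lower bound ℓ^(d r(n-r)),
-- whose exponent is positive for 0 < r < n.
omit [IsCMField F] [Algebra 𝒦 F] [IsTotallyComplex 𝒦] [Algebra.IsQuadraticExtension ℚ 𝒦] in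
lemma diagUnits_firstEntries_notMem (hℓ : Squarefree (Ideal.span {(ℓ : 𝓞 F)})) {m r : ℕ}
    (hm : IsUnit (m : LocField ℓ F)) (hdvd : ℓ ∣ m) (hr : 1 ≤ r) (hr' : r < n) :
    ((1, diagUnits n (LocField ℓ F) (firstEntries n r hm.unit)) : GPlus ℓ n F 𝒦) ∉ GPlusInt ℓ n F 𝒦 := by
  intro h
  have h1 := le_ncard_doubleCosetSet ℓ n F 𝒦 hℓ hm hdvd hr'.le
  have h2 : doubleCosetSet (GPlusInt ℓ n F 𝒦)
      (1, diagUnits n (LocField ℓ F) (firstEntries n r hm.unit)) ⊆ {((1 : GPlus ℓ n F 𝒦) : GPlus ℓ n F 𝒦 ⧸ GPlusInt ℓ n F 𝒦)} := by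
    rintro q ⟨k, hk, rfl⟩
    refine (QuotientGroup.eq.2 ?_).symm
    rw [inv_one, one_mul]
    exact Subgroup.mul_mem _ hk h
  have h3 := (h1.trans (Set.ncard_le_ncard h2 (Set.finite_singleton _))).trans_eq (Set.ncard_singleton _)
  have h4 : Module.finrank ℚ F * (r * (n - r)) ≠ 0 :=
    mul_ne_zero Module.finrank_pos.ne' (mul_ne_zero (by omega) (by omega))
  exact absurd h3 (not_le.2 (one_lt_pow₀ (Fact.out : ℓ.Prime).one_lt h4))

/-- The bound for the ratio of norm and degree of a local Hecke operator. -/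
theorem coeffNorm_satakeGU_heckeLocal_le (hℓ : Squarefree (Ideal.span {(ℓ : 𝓞 F)})) {c r : ℕ}
    (hc : ¬ ℓ ∣ c) (hr : 1 ≤ r) (hr' : r < n) :
    coeffNorm (satakeGU ℓ n F (heckeLocal ℓ n F 𝒦 r (ℓ * c)))
      ≤ ((2 : ℝ) ^ Module.finrank ℚ F) ^ n
        * (Real.sqrt ((ℓ : ℝ) ^ (Module.finrank ℚ F * (r * (n - r)))))⁻¹
        * ‖heckeDegree (GUint ℓ n F) (heckeLocal ℓ n F 𝒦 r (ℓ * c)).1‖ := by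
  classical
  have hc0 : ℓ * c ≠ 0 := mul_ne_zero (Fact.out : ℓ.Prime).ne_zero (by rintro rfl; exact hc (dvd_zero _))
  have hm : IsUnit ((ℓ * c : ℕ) : LocField ℓ F) := isUnit_natCast_locField ℓ F hc0
  have hℓpos : (0 : ℝ) < ℓ := by exact_mod_cast (Fact.out : ℓ.Prime).pos
  set X : ℝ := (ℓ : ℝ) ^ (Module.finrank ℚ F * (r * (n - r))) with hX
  have hXpos : 0 < X := by positivity
  rw [heckeLocal, baseChange]
  split_ifs with h
  -- With X = ℓ^(d r(n-r)), the norm is at most 2^(dn) √X on `GPlus` and the degree is at least X,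
  -- and √X = X / √X.
  · have hB := h.choose_spec
    rw [hB.heckeDegree_eq ℓ n F hℓ 𝒦, heckePlus_eq ℓ n F 𝒦 hm,
      heckeDegree_charDoubleCoset ((isIwasawa_GPlus ℓ n F hℓ 𝒦).finite _), ← heckePlus_eq ℓ n F 𝒦 hm,
      hB.satake_eq, Complex.norm_natCast]
    have h1 := le_ncard_doubleCosetSet ℓ n F 𝒦 hℓ hm (dvd_mul_right ℓ c) hr'.le
    have h2 : X ≤ ((doubleCosetSet (GPlusInt ℓ n F 𝒦)
      (1, diagUnits n (LocField ℓ F) (firstEntries n r hm.unit))).ncard : ℝ) := by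
      rw [hX]; exact_mod_cast h1
    refine (coeffNorm_mapDomain_le _ _).trans ((coeffNorm_satakePlus_le ℓ n F 𝒦 hℓ hc hr'.le).trans ?_)
    rw [mul_assoc]
    refine mul_le_mul_of_nonneg_left ?_ (by positivity)
    rw [← hX]
    calc Real.sqrt X = (Real.sqrt X)⁻¹ * X := by
          conv_rhs => rw [← Real.mul_self_sqrt hXpos.le]
          rw [Real.sqrt_mul_self (Real.sqrt_nonneg X), ← mul_assoc,
            inv_mul_cancel₀ (Real.sqrt_pos.2 hXpos).ne', one_mul]
      _ ≤ _ := mul_le_mul_of_nonneg_left h2 (inv_nonneg.2 (Real.sqrt_nonneg X))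
  -- In the default branch the operator is zero, because the double coset does not contain 1, and so
  -- is its norm. Hence the existence of a base change map need not be proved.
  · have h0 : (heckePlus ℓ n F 𝒦 r (ℓ * c)).1 1 = 0 := by
      rw [heckePlus_eq ℓ n F 𝒦 hm]
      refine if_neg ?_
      rintro ⟨k₁, hk₁, k₂, hk₂, hk⟩
      refine diagUnits_firstEntries_notMem ℓ n F 𝒦 hℓ hm (dvd_mul_right ℓ c) hr hr' ?_
      have e : ((1, diagUnits n (LocField ℓ F) (firstEntries n r hm.unit)) : GPlus ℓ n F 𝒦) = k₁⁻¹ * k₂⁻¹ := by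
        rw [← mul_left_inj k₂, inv_mul_cancel_right, ← mul_right_inj k₁, mul_inv_cancel, ← mul_assoc, ← hk]
      rw [e]
      exact Subgroup.mul_mem _ (Subgroup.inv_mem _ hk₁) (Subgroup.inv_mem _ hk₂)
    have h1 : trivialChange ℓ n F 𝒦 (heckePlus ℓ n F 𝒦 r (ℓ * c)) = 0 := by
      change (heckePlus ℓ n F 𝒦 r (ℓ * c)).1 1 • heckeUnit (GUint ℓ n F) = 0
      rw [h0, zero_smul]
    have h2 : satakeGU ℓ n F (0 : heckeAlgebra (GUint ℓ n F)) = 0 := by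
      refine MonoidAlgebra.ext (Finsupp.ext fun q => ?_)
      rw [satakeGU, (isIwasawa_GU ℓ n F hℓ).satake_coeff]
      exact mul_eq_zero_of_right _ (finsum_eq_zero_of_forall_eq_zero fun _ => rfl)
    rw [h1, h2, coeffNorm_zero]
    positivity

end HeckeLocal

/-! ### Degree and norm of the adelic Hecke operators -/

lemma finsum_prod_eq_prod_finsum {ι : Type*} [Fintype ι] {κ : ι → Type*} (f : ∀ i, κ i → ℂ)
    (hf : ∀ i, (Function.support (f i)).Finite) : ∑ᶠ x : ∀ i, κ i, ∏ i, f i (x i) = ∏ i, ∑ᶠ y, f i y := by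
  classical
  have h1 : ∀ i, ∑ᶠ y, f i y = ∑ y ∈ (hf i).toFinset, f i y := fun i => finsum_eq_sum _ (hf i)
  rw [Finset.prod_congr rfl fun i _ => h1 i, Finset.prod_univ_sum]
  refine finsum_eq_sum_of_support_subset _ fun x hx => ?_
  rw [Finset.mem_coe, Fintype.mem_piFinset]
  intro i
  rw [Set.Finite.mem_toFinset]
  exact Finset.prod_ne_zero_iff.1 hx i (Finset.mem_univ i)

namespace LevelDatum

variable {F : Type*} [Field F] [NumberField F] [IsCMField F]
variable {D : Type*} [Ring D] [Algebra F D] [Algebra ℚ D] [StarRing D]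
variable {n : ℕ} (L : LevelDatum F D n)

lemma toGU_surjective (ℓ : Nat.Primes) (hℓ : ℓ ∉ L.S) : Function.Surjective (L.toGU ℓ hℓ) := by
  rintro ⟨g, c, hc⟩
  let x : (LocAlg (ℓ : ℕ) D)ˣ := Units.map (L.e ℓ hℓ).symm.toRingEquiv.toRingHom.toMonoidHom g
  have hx : L.e ℓ hℓ (x : LocAlg (ℓ : ℕ) D) = g := (L.e ℓ hℓ).apply_symm_apply _
  refine ⟨⟨x, c, ?_⟩, ?_⟩
  · apply (L.e ℓ hℓ).injective
    rw [map_mul, L.e_star, AlgEquiv.commutes, hx, hc]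
  · exact Subtype.ext (Units.ext hx)

/-- The bijection `G(ℚ_ℓ) / K_ℓ → GU / GUint`. -/
lemma bijective_quotient (ℓ : Nat.Primes) (hℓ : ℓ ∉ L.S) :
    Function.Bijective fun y : GLoc (ℓ : ℕ) D ⧸ L.KLoc ℓ hℓ =>
      ((L.toGU ℓ hℓ y.out : GU (ℓ : ℕ) n F) : GU (ℓ : ℕ) n F ⧸ GUint (ℓ : ℕ) n F) := by
  constructor
  · intro y y' h
    have h1 := QuotientGroup.eq.1 h
    rw [← map_inv, ← map_mul] at h1
    rw [← y.out_eq', ← y'.out_eq']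
    exact QuotientGroup.eq.2 h1
  · intro z
    obtain ⟨g, hg⟩ := L.toGU_surjective ℓ hℓ z.out
    refine ⟨(g : GLoc (ℓ : ℕ) D ⧸ L.KLoc ℓ hℓ), ?_⟩
    obtain ⟨k, hk⟩ := QuotientGroup.mk_out_eq_mul (L.KLoc ℓ hℓ) g
    change ((L.toGU ℓ hℓ (g : GLoc (ℓ : ℕ) D ⧸ L.KLoc ℓ hℓ).out : GU (ℓ : ℕ) n F) :
      GU (ℓ : ℕ) n F ⧸ GUint (ℓ : ℕ) n F) = z
    rw [hk, map_mul, hg]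
    conv_rhs => rw [← z.out_eq']
    exact QuotientGroup.mk_mul_of_mem _ k.2

lemma apply_bijective_quotient (ℓ : Nat.Primes) (hℓ : ℓ ∉ L.S) (f : heckeAlgebra (GUint (ℓ : ℕ) n F))
    (y : GLoc (ℓ : ℕ) D ⧸ L.KLoc ℓ hℓ) : f.1 (L.toGU ℓ hℓ y.out)
      = f.1 ((L.toGU ℓ hℓ y.out : GU (ℓ : ℕ) n F) : GU (ℓ : ℕ) n F ⧸ GUint (ℓ : ℕ) n F).out :=
  (heckeAlgebra.apply_out f _).symm

lemma finsum_toGU (ℓ : Nat.Primes) (hℓ : ℓ ∉ L.S) (f : heckeAlgebra (GUint (ℓ : ℕ) n F)) :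
    ∑ᶠ y : GLoc (ℓ : ℕ) D ⧸ L.KLoc ℓ hℓ, f.1 (L.toGU ℓ hℓ y.out)
      = heckeDegree (GUint (ℓ : ℕ) n F) f.1 :=
  finsum_eq_of_bijective _ (L.bijective_quotient ℓ hℓ) (L.apply_bijective_quotient ℓ hℓ f)

lemma finite_support_toGU (ℓ : Nat.Primes) (hℓ : ℓ ∉ L.S) (f : heckeAlgebra (GUint (ℓ : ℕ) n F)) :
    (Function.support fun y : GLoc (ℓ : ℕ) D ⧸ L.KLoc ℓ hℓ => f.1 (L.toGU ℓ hℓ y.out)).Finite := by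
  refine ((heckeAlgebra.finite_support (isIwasawa_GU (ℓ : ℕ) n F (L.unramified ℓ hℓ)).finite f).preimage
    (L.bijective_quotient ℓ hℓ).injective.injOn).subset fun y hy => ?_
  rw [Set.mem_preimage, Function.mem_support, ← L.apply_bijective_quotient]
  exact hy

open scoped RestrictedProduct in
/-- An open subgroup of the form `K_S K^S` contains almost all of the `GLocInt ℓ`. -/
lemma finite_notMem_KLoc (hopen : IsOpen (L.K : Set (GAdelic D))) (g : GAdelic D) :
    {ℓ : {ℓ : Nat.Primes // ℓ ∉ L.S} | g ℓ.1 ∉ L.KLoc ℓ.1 ℓ.2}.Finite := by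
  classical
  let σ := RestrictedProduct.structureMap (fun ℓ : Nat.Primes => GLoc (ℓ : ℕ) D)
    (fun ℓ : Nat.Primes => (GLocInt (ℓ : ℕ) D : Set (GLoc (ℓ : ℕ) D))) Filter.cofinite
  have hσ : Continuous σ := RestrictedProduct.isEmbedding_structureMap.continuous
  have h1 : IsOpen (σ ⁻¹' (L.K : Set (GAdelic D))) := hopen.preimage hσ
  -- A basic open neighbourhood of 1 in the product of the `GLocInt` restricts only the finitely
  -- many components in `I`. An element that is 1 away from a single ℓ ∉ I is thus in `L.K`, and
  -- `L.K` is a product at primes outside `L.S`.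
  obtain ⟨I, U, hU, hIU⟩ := isOpen_pi_iff.1 h1 (fun ℓ => ⟨1, (GLocInt (ℓ : ℕ) D).one_mem⟩)
    (show σ _ ∈ L.K from L.K.one_mem)
  have h2 : ∀ (ℓ : Nat.Primes) (hℓ : ℓ ∉ L.S), ℓ ∉ I → GLocInt (ℓ : ℕ) D ≤ L.KLoc ℓ hℓ := by
    intro ℓ hℓ hI x hx
    have h3 := hIU (a := Function.update (fun ℓ : Nat.Primes => (⟨1, (GLocInt (ℓ : ℕ) D).one_mem⟩ :
      (GLocInt (ℓ : ℕ) D : Set (GLoc (ℓ : ℕ) D)))) ℓ ⟨x, hx⟩) (fun ℓ' hℓ' => by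
        have hne : ℓ' ≠ ℓ := by rintro rfl; exact hI hℓ'
        rw [Function.update_of_ne hne]
        exact (hU ℓ' hℓ').2)
    have h4 : σ _ ∈ L.K := h3
    have h5 := h4.2 ℓ hℓ
    simp only [σ, RestrictedProduct.structureMap_apply, Function.update_self] at h5
    exact h5
  have h3 : {ℓ : Nat.Primes | ¬ g ℓ ∈ GLocInt (ℓ : ℕ) D}.Finite := g.2
  refine ((h3.union I.finite_toSet).preimage Subtype.val_injective.injOn).subset fun ℓ hℓ => ?_
  by_contra h
  rw [Set.mem_preimage, Set.mem_union, not_or] at h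
  exact hℓ (h2 ℓ.1 ℓ.2 h.2 (not_not.1 h.1))

variable (𝒦 : Type*) [Field 𝒦] [NumberField 𝒦] [Algebra 𝒦 F] [IsTotallyComplex 𝒦]
  [Algebra.IsQuadraticExtension ℚ 𝒦]

/-- The primes outside of `S` that divide `m`. -/
def badPrimes {m : ℕ} (hm : m ≠ 0) : Finset {ℓ : Nat.Primes // ℓ ∉ L.S} :=
  Set.Finite.toFinset (s := {ℓ : {ℓ : Nat.Primes // ℓ ∉ L.S} | (ℓ.1 : ℕ) ∣ m})
    (((Nat.divisors m).finite_toSet.preimage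
      (f := fun ℓ : {ℓ : Nat.Primes // ℓ ∉ L.S} => (ℓ.1 : ℕ))
      (fun a _ b _ h => Subtype.ext (Subtype.ext h))).subset
      fun ℓ hℓ => by
        rw [Set.mem_preimage, Finset.mem_coe, Nat.mem_divisors]
        exact ⟨hℓ, hm⟩)

variable {L} in
lemma mem_badPrimes {m : ℕ} (hm : m ≠ 0) {ℓ : {ℓ : Nat.Primes // ℓ ∉ L.S}} :
    ℓ ∈ L.badPrimes hm ↔ (ℓ.1 : ℕ) ∣ m := by
  rw [badPrimes, Set.Finite.mem_toFinset]; rfl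

lemma norm_eq {m : ℕ} (hm : m ≠ 0) (r : ℕ) : L.norm 𝒦 r m = ∏ ℓ ∈ L.badPrimes hm,
    coeffNorm (satakeGU (ℓ.1 : ℕ) n F (heckeLocal (ℓ.1 : ℕ) n F 𝒦 r m)) := by
  refine finprod_eq_prod_of_mulSupport_subset _ fun ℓ hℓ => ?_
  rw [Finset.mem_coe, mem_badPrimes]
  by_contra h
  refine hℓ ?_
  change coeffNorm (satakeGU (ℓ.1 : ℕ) n F (heckeLocal (ℓ.1 : ℕ) n F 𝒦 r m)) = 1
  rw [heckeLocal_eq_heckeUnit _ _ _ _ h, coeffNorm_satakeGU_heckeUnit _ _ _ (L.unramified ℓ.1 ℓ.2)]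

lemma heckeLocal_apply_of_notMem {m : ℕ} (hm : m ≠ 0) (r : ℕ) {ℓ : {ℓ : Nat.Primes // ℓ ∉ L.S}}
    (hℓ : ℓ ∉ L.badPrimes hm) (g : GLoc (ℓ.1 : ℕ) D) [Decidable (g ∈ L.KLoc ℓ.1 ℓ.2)] :
    (heckeLocal (ℓ.1 : ℕ) n F 𝒦 r m).1 (L.toGU ℓ.1 ℓ.2 g) = if g ∈ L.KLoc ℓ.1 ℓ.2 then 1 else 0 := by
  classical
  rw [heckeLocal_eq_heckeUnit _ _ _ _ (fun h => hℓ ((mem_badPrimes hm).2 h)), heckeUnit_apply]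
  exact if_congr Iff.rfl rfl rfl

lemma hecke_mul (r m : ℕ) (g : GAdelic D) {k : GAdelic D} (hk : k ∈ L.K) :
    L.hecke 𝒦 r m (g * k) = L.hecke 𝒦 r m g := by
  classical
  have h1 : (fun ℓ : L.S => (g * k) ℓ.1) ∈ L.KS ↔ (fun ℓ : L.S => g ℓ.1) ∈ L.KS :=
    L.KS.mul_mem_cancel_right hk.1
  rw [hecke, hecke]
  simp only [h1]
  congr 1
  refine finprod_congr fun ℓ => ?_
  rw [RestrictedProduct.mul_apply, map_mul]
  exact heckeAlgebra.apply_mul _ _ (hk.2 ℓ.1 ℓ.2)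

lemma hecke_apply_out (r m : ℕ) (g : GAdelic D) :
    L.hecke 𝒦 r m (g : GAdelic D ⧸ L.K).out = L.hecke 𝒦 r m g := by
  obtain ⟨k, hk⟩ := QuotientGroup.mk_out_eq_mul L.K g
  rw [hk, L.hecke_mul 𝒦 r m g k.2]

open scoped Classical RestrictedProduct in
/-- The adelic point with given components at finitely many primes, and with all others one. -/
def extendOne (P : Finset {ℓ : Nat.Primes // ℓ ∉ L.S}) (x : ∀ ℓ : P, GLoc (ℓ.1.1 : ℕ) D) : GAdelic D :=
  ⟨fun ℓ => if h : ∃ hℓ : ℓ ∉ L.S, (⟨ℓ, hℓ⟩ : {ℓ : Nat.Primes // ℓ ∉ L.S}) ∈ P then x ⟨⟨ℓ, h.1⟩, h.2⟩ else 1, by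
    refine (P.finite_toSet.image Subtype.val).subset fun ℓ hℓ => ?_
    by_contra h
    have h' : ¬ ∃ hℓ : ℓ ∉ L.S, (⟨ℓ, hℓ⟩ : {ℓ : Nat.Primes // ℓ ∉ L.S}) ∈ P :=
      fun h' => h ⟨⟨ℓ, h'.1⟩, h'.2, rfl⟩
    refine hℓ ?_
    have h1 := (GLocInt (ℓ : ℕ) D).one_mem
    rw [← dif_neg (t := fun h => x ⟨⟨ℓ, h.1⟩, h.2⟩) (e := fun _ => (1 : GLoc (ℓ : ℕ) D)) h'] at h1
    exact h1⟩

lemma extendOne_apply_mem (P : Finset {ℓ : Nat.Primes // ℓ ∉ L.S}) (x : ∀ ℓ : P, GLoc (ℓ.1.1 : ℕ) D) (ℓ : P) :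
    L.extendOne P x ℓ.1.1 = x ℓ :=
  dif_pos (⟨ℓ.1.2, ℓ.2⟩ : ∃ hℓ : ℓ.1.1 ∉ L.S, (⟨ℓ.1.1, hℓ⟩ : {ℓ : Nat.Primes // ℓ ∉ L.S}) ∈ P)

lemma extendOne_apply_notMem (P : Finset {ℓ : Nat.Primes // ℓ ∉ L.S}) (x : ∀ ℓ : P, GLoc (ℓ.1.1 : ℕ) D)
    {ℓ : Nat.Primes} (h : ∀ hℓ : ℓ ∉ L.S, (⟨ℓ, hℓ⟩ : {ℓ : Nat.Primes // ℓ ∉ L.S}) ∉ P) :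
    L.extendOne P x ℓ = 1 :=
  dif_neg (show ¬ ∃ hℓ : ℓ ∉ L.S, (⟨ℓ, hℓ⟩ : {ℓ : Nat.Primes // ℓ ∉ L.S}) ∈ P from fun h' => h h'.1 h'.2)

lemma hecke_extendOne {m : ℕ} (hm : m ≠ 0) (r : ℕ) (x : ∀ ℓ : L.badPrimes hm, GLoc (ℓ.1.1 : ℕ) D) :
    L.hecke 𝒦 r m (L.extendOne _ x)
      = ∏ ℓ : L.badPrimes hm, (heckeLocal (ℓ.1.1 : ℕ) n F 𝒦 r m).1 (L.toGU ℓ.1.1 ℓ.1.2 (x ℓ)) := by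
  classical
  have h1 : (fun ℓ : L.S => L.extendOne _ x ℓ.1) = 1 := by
    funext ℓ
    exact L.extendOne_apply_notMem _ x fun h => absurd ℓ.2 h
  rw [hecke, h1, if_pos L.KS.one_mem, one_mul,
    finprod_eq_prod_of_mulSupport_subset (s := L.badPrimes hm), ← Finset.prod_coe_sort]
  · refine Finset.prod_congr rfl fun ℓ _ => ?_
    rw [L.extendOne_apply_mem]
  · intro ℓ hℓ
    by_contra h
    refine hℓ ?_
    change (heckeLocal (ℓ.1 : ℕ) n F 𝒦 r m).1 (L.toGU ℓ.1 ℓ.2 (L.extendOne _ x ℓ.1)) = 1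
    rw [L.heckeLocal_apply_of_notMem 𝒦 hm r h, if_pos]
    rw [L.extendOne_apply_notMem _ x fun _ => h]
    exact Subgroup.one_mem _

/-- A `finprod` with infinite multiplicative support is one by convention, so a vanishing factor is
not enough to make it zero. Openness of `L.K` makes all but finitely many factors equal to one, and
then it is. -/
lemma mem_KLoc_of_hecke_ne_zero (hopen : IsOpen (L.K : Set (GAdelic D))) {m : ℕ} (hm : m ≠ 0) (r : ℕ)
    {g : GAdelic D} (hg : L.hecke 𝒦 r m g ≠ 0) : (fun ℓ : L.S => g ℓ.1) ∈ L.KS ∧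
      ∀ ℓ : {ℓ : Nat.Primes // ℓ ∉ L.S}, ℓ ∉ L.badPrimes hm → g ℓ.1 ∈ L.KLoc ℓ.1 ℓ.2 := by
  classical
  have h1 := left_ne_zero_of_mul hg
  have h2 := right_ne_zero_of_mul hg
  refine ⟨by_contra fun h => h1 (if_neg h), fun ℓ hℓ => ?_⟩
  have h3 : (Function.mulSupport fun ℓ : {ℓ : Nat.Primes // ℓ ∉ L.S} =>
      (heckeLocal (ℓ.1 : ℕ) n F 𝒦 r m).1 (L.toGU ℓ.1 ℓ.2 (g ℓ.1))).Finite := by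
    refine ((L.finite_notMem_KLoc hopen g).union (L.badPrimes hm).finite_toSet).subset fun ℓ hℓ => ?_
    by_contra h
    rw [Set.mem_union, not_or] at h
    refine hℓ ?_
    change (heckeLocal (ℓ.1 : ℕ) n F 𝒦 r m).1 (L.toGU ℓ.1 ℓ.2 (g ℓ.1)) = 1
    rw [L.heckeLocal_apply_of_notMem 𝒦 hm r h.2, if_pos (not_not.1 h.1)]
  by_contra h
  refine h2 ?_
  have h4 : (heckeLocal (ℓ.1 : ℕ) n F 𝒦 r m).1 (L.toGU ℓ.1 ℓ.2 (g ℓ.1)) = 0 := by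
    rw [L.heckeLocal_apply_of_notMem 𝒦 hm r hℓ, if_neg h]
  exact finprod_eq_zero _ ℓ h4 h3

/-- The degree of `T_{r,m}` is the product of the degrees of its local components. -/
theorem deg_eq (hopen : IsOpen (L.K : Set (GAdelic D))) {m : ℕ} (hm : m ≠ 0) (r : ℕ) :
    L.deg 𝒦 r m = ∏ ℓ ∈ L.badPrimes hm,
      heckeDegree (GUint (ℓ.1 : ℕ) n F) (heckeLocal (ℓ.1 : ℕ) n F 𝒦 r m).1 := by
  classical
  -- The cosets that can carry a nonzero value are those with representatives equal to 1 away from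
  -- the primes of `badPrimes`, so the sum over G(𝔸_f) / K becomes a sum over a finite product of
  -- local coset spaces.
  let j : (∀ ℓ : L.badPrimes hm, GLoc (ℓ.1.1 : ℕ) D ⧸ L.KLoc ℓ.1.1 ℓ.1.2) → GAdelic D ⧸ L.K :=
    fun x => (L.extendOne _ fun ℓ => (x ℓ).out : GAdelic D)
  have hj : Function.Injective j := by
    intro x x' h
    have h1 := QuotientGroup.eq.1 h
    funext ℓ
    have h2 := h1.2 ℓ.1.1 ℓ.1.2
    rw [RestrictedProduct.mul_apply, RestrictedProduct.inv_apply, L.extendOne_apply_mem,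
      L.extendOne_apply_mem] at h2
    rw [← (x ℓ).out_eq', ← (x' ℓ).out_eq']
    exact QuotientGroup.eq.2 h2
  have hval : ∀ x, L.hecke 𝒦 r m (j x).out
      = ∏ ℓ : L.badPrimes hm, (heckeLocal (ℓ.1.1 : ℕ) n F 𝒦 r m).1 (L.toGU ℓ.1.1 ℓ.1.2 (x ℓ).out) := fun x => by
    rw [L.hecke_apply_out 𝒦, L.hecke_extendOne 𝒦 hm]
  have hsupp : (Function.support fun q : GAdelic D ⧸ L.K => L.hecke 𝒦 r m q.out) ⊆ Set.range j := by
    intro q hq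
    obtain ⟨h1, h2⟩ := L.mem_KLoc_of_hecke_ne_zero 𝒦 hopen hm r hq
    refine ⟨fun ℓ => (q.out ℓ.1.1 : GLoc (ℓ.1.1 : ℕ) D), ?_⟩
    conv_rhs => rw [← q.out_eq']
    refine QuotientGroup.eq.2 ⟨?_, fun ℓ hℓ => ?_⟩
    · have h3 : (fun ℓ : L.S => ((L.extendOne (L.badPrimes hm) fun ℓ =>
          (q.out ℓ.1.1 : GLoc (ℓ.1.1 : ℕ) D ⧸ L.KLoc ℓ.1.1 ℓ.1.2).out)⁻¹ * q.out : GAdelic D) ℓ.1)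
          = fun ℓ : L.S => q.out ℓ.1 := by
        funext ℓ
        rw [RestrictedProduct.mul_apply, RestrictedProduct.inv_apply,
          L.extendOne_apply_notMem _ _ fun h => absurd ℓ.2 h, inv_one, one_mul]
      rw [h3]
      exact h1
    · rw [RestrictedProduct.mul_apply, RestrictedProduct.inv_apply]
      by_cases h : (⟨ℓ, hℓ⟩ : {ℓ : Nat.Primes // ℓ ∉ L.S}) ∈ L.badPrimes hm
      · have h4 := L.extendOne_apply_mem (L.badPrimes hm) (fun ℓ =>
          (q.out ℓ.1.1 : GLoc (ℓ.1.1 : ℕ) D ⧸ L.KLoc ℓ.1.1 ℓ.1.2).out) ⟨⟨ℓ, hℓ⟩, h⟩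
        rw [h4]
        exact QuotientGroup.eq.1 (Quotient.out_eq' _)
      · rw [L.extendOne_apply_notMem _ _ fun _ => h, inv_one, one_mul]
        exact h2 ⟨ℓ, hℓ⟩ h
  calc L.deg 𝒦 r m = ∑ᶠ q ∈ Set.univ, L.hecke 𝒦 r m (q : GAdelic D ⧸ L.K).out := (finsum_mem_univ _).symm
    _ = ∑ᶠ q ∈ Set.range j, L.hecke 𝒦 r m q.out := by
        refine finsum_mem_inter_support_eq _ _ _ ?_
        rw [Set.univ_inter, Set.inter_eq_right.2 hsupp]
    _ = ∑ᶠ x, L.hecke 𝒦 r m (j x).out := finsum_mem_range hj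
    _ = ∑ᶠ x : ∀ ℓ : L.badPrimes hm, GLoc (ℓ.1.1 : ℕ) D ⧸ L.KLoc ℓ.1.1 ℓ.1.2,
          ∏ ℓ : L.badPrimes hm, (heckeLocal (ℓ.1.1 : ℕ) n F 𝒦 r m).1 (L.toGU ℓ.1.1 ℓ.1.2 (x ℓ).out) :=
        finsum_congr hval
    _ = ∏ ℓ : L.badPrimes hm, heckeDegree (GUint (ℓ.1.1 : ℕ) n F) (heckeLocal (ℓ.1.1 : ℕ) n F 𝒦 r m).1 := by
        rw [finsum_prod_eq_prod_finsum (fun (ℓ : L.badPrimes hm) (y : GLoc (ℓ.1.1 : ℕ) D ⧸ L.KLoc ℓ.1.1 ℓ.1.2) =>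
          (heckeLocal (ℓ.1.1 : ℕ) n F 𝒦 r m).1 (L.toGU ℓ.1.1 ℓ.1.2 y.out))
          fun ℓ => L.finite_support_toGU _ _ _]
        exact Finset.prod_congr rfl fun ℓ _ => L.finsum_toGU _ _ _
    _ = _ := Finset.prod_coe_sort (L.badPrimes hm) fun ℓ =>
        heckeDegree (GUint (ℓ.1 : ℕ) n F) (heckeLocal (ℓ.1 : ℕ) n F 𝒦 r m).1

end LevelDatum

/-! ### Estimates for square-free integers -/

/-- `A ^ ω(m) = O(m ^ ε)` for square-free `m`. -/
lemma exists_pow_card_primeFactors_le {A : ℝ} (hA : 1 ≤ A) {ε : ℝ} (hε : 0 < ε) :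
    ∃ M : ℕ, 0 < M ∧ ∀ m : ℕ, M < m → Squarefree m → A ^ m.primeFactors.card ≤ (m : ℝ) ^ ε := by
  have hε2 : 0 < ε / 2 := by positivity
  -- Primes p ≥ T satisfy A ≤ p^(ε/2), and their contribution is at most m^(ε/2). The fewer than or
  -- exactly T smaller primes contribute at most A ^ T, which is again at most m^(ε/2) for large m.
  obtain ⟨T, hT⟩ := Filter.eventually_atTop.1 (((tendsto_rpow_atTop hε2).comp
    tendsto_natCast_atTop_atTop).eventually_ge_atTop A)
  obtain ⟨M, hM⟩ := Filter.eventually_atTop.1 (((tendsto_rpow_atTop hε2).comp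
    tendsto_natCast_atTop_atTop).eventually_ge_atTop (A ^ T))
  refine ⟨M + 1, Nat.succ_pos M, fun m hm hsq => ?_⟩
  have hm1 : A ^ T ≤ (m : ℝ) ^ (ε / 2) := hM m (by omega)
  have hm0 : (0 : ℝ) < m := by exact_mod_cast (by omega : 0 < m)
  have h1 : ∀ p ∈ m.primeFactors, A ≤ (if p < T then A else 1) * (p : ℝ) ^ (ε / 2) := fun p hp => by
    have hp1 : (1 : ℝ) ≤ p := by exact_mod_cast (Nat.prime_of_mem_primeFactors hp).one_lt.le
    split_ifs with h
    · exact le_mul_of_one_le_right (by linarith) (Real.one_le_rpow hp1 hε2.le)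
    · rw [one_mul]; exact hT p (not_lt.1 h)
  calc A ^ m.primeFactors.card = ∏ _p ∈ m.primeFactors, A := (Finset.prod_const A).symm
    _ ≤ ∏ p ∈ m.primeFactors, (if p < T then A else 1) * (p : ℝ) ^ (ε / 2) :=
        Finset.prod_le_prod (fun _ _ => by linarith) h1
    _ = A ^ (m.primeFactors.filter (· < T)).card * (m : ℝ) ^ (ε / 2) := by
        rw [Finset.prod_mul_distrib, Finset.prod_ite, Finset.prod_const, Finset.prod_const_one, mul_one,
          Real.finsetProd_rpow _ _ fun p _ => Nat.cast_nonneg p, ← Nat.cast_prod,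
          Nat.prod_primeFactors_of_squarefree hsq]
    _ ≤ A ^ T * (m : ℝ) ^ (ε / 2) := by
        gcongr
        calc (m.primeFactors.filter (· < T)).card ≤ (Finset.range T).card :=
              Finset.card_le_card fun p hp => Finset.mem_range.2 (Finset.mem_filter.1 hp).2
          _ = T := Finset.card_range T
    _ ≤ (m : ℝ) ^ (ε / 2) * (m : ℝ) ^ (ε / 2) := by gcongr
    _ = (m : ℝ) ^ ε := by rw [← Real.rpow_add hm0, add_halves]

/-! ### The part of `m` prime to `S`, and the product of the local bounds. -/

namespace LevelDatum

variable {F : Type*} [Field F] [NumberField F] [IsCMField F]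
variable {D : Type*} [Ring D] [Algebra F D] [Algebra ℚ D] [StarRing D]
variable {n : ℕ} (L : LevelDatum F D n)

variable {L} in
lemma card_badPrimes_le {m : ℕ} (hm : m ≠ 0) : (L.badPrimes hm).card ≤ m.primeFactors.card := by
  refine Finset.card_le_card_of_injOn (fun ℓ => (ℓ.1 : ℕ)) (fun ℓ hℓ => ?_)
    fun a _ b _ h => Subtype.ext (Subtype.ext h)
  exact Nat.mem_primeFactors.2 ⟨ℓ.1.2, (mem_badPrimes hm).1 hℓ, hm⟩

-- A square-free integer contains each prime of `S` at most once, so dropping these primes loses at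
-- most their product.
variable {L} in
lemma le_prod_badPrimes {m : ℕ} (hm : m ≠ 0) (hsq : Squarefree m) :
    m ≤ (∏ ℓ ∈ L.S, (ℓ : ℕ)) * ∏ ℓ ∈ L.badPrimes hm, (ℓ.1 : ℕ) := by
  classical
  have h1 : m.primeFactors ⊆ L.S.image (fun ℓ : Nat.Primes => (ℓ : ℕ)) ∪ (L.badPrimes hm).image fun ℓ : {ℓ : Nat.Primes // ℓ ∉ L.S} => (ℓ.1 : ℕ) := by
    intro p hp
    obtain ⟨hp1, hp2, -⟩ := Nat.mem_primeFactors.1 hp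
    rw [Finset.mem_union, Finset.mem_image, Finset.mem_image]
    by_cases h : (⟨p, hp1⟩ : Nat.Primes) ∈ L.S
    · exact Or.inl ⟨⟨p, hp1⟩, h, rfl⟩
    · exact Or.inr ⟨⟨⟨p, hp1⟩, h⟩, (mem_badPrimes hm).2 hp2, rfl⟩
  have hpos : ∀ p ∈ L.S.image (fun ℓ : Nat.Primes => (ℓ : ℕ)) ∪ (L.badPrimes hm).image (fun ℓ : {ℓ : Nat.Primes // ℓ ∉ L.S} => (ℓ.1 : ℕ)), 1 ≤ p := by
    intro p hp
    rw [Finset.mem_union, Finset.mem_image, Finset.mem_image] at hp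
    rcases hp with ⟨ℓ, -, rfl⟩ | ⟨ℓ, -, rfl⟩
    · exact ℓ.2.one_lt.le
    · exact ℓ.1.2.one_lt.le
  calc m = ∏ p ∈ m.primeFactors, p := (Nat.prod_primeFactors_of_squarefree hsq).symm
    _ ≤ ∏ p ∈ L.S.image (fun ℓ : Nat.Primes => (ℓ : ℕ)) ∪ (L.badPrimes hm).image (fun ℓ : {ℓ : Nat.Primes // ℓ ∉ L.S} => (ℓ.1 : ℕ)), p :=
        Finset.prod_le_prod_of_subset_of_one_le' h1 fun p hp _ => hpos p hp
    _ ≤ (∏ p ∈ L.S.image (fun ℓ : Nat.Primes => (ℓ : ℕ)), p) * ∏ p ∈ (L.badPrimes hm).image (fun ℓ : {ℓ : Nat.Primes // ℓ ∉ L.S} => (ℓ.1 : ℕ)), p := by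
        rw [← Finset.prod_union_inter]
        refine Nat.le_mul_of_pos_right _ (Finset.prod_pos fun p hp => ?_)
        exact hpos p (Finset.mem_union_left _ (Finset.mem_inter.1 hp).1)
    _ = _ := by
        congr 1
        · exact Finset.prod_image fun a _ b _ h => Nat.Primes.coe_nat_injective h
        · exact Finset.prod_image fun a _ b _ h => Subtype.ext (Nat.Primes.coe_nat_injective h)

variable (𝒦 : Type*) [Field 𝒦] [NumberField 𝒦] [Algebra 𝒦 F] [IsTotallyComplex 𝒦]
  [Algebra.IsQuadraticExtension ℚ 𝒦]

lemma norm_div_deg_le (hopen : IsOpen (L.K : Set (GAdelic D))) {m : ℕ} (hm : m ≠ 0) (hsq : Squarefree m)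
    {r : ℕ} (hr : 1 ≤ r) (hr' : r < n) : ‖(L.norm 𝒦 r m : ℂ) / L.deg 𝒦 r m‖
      ≤ (((2 : ℝ) ^ Module.finrank ℚ F) ^ n) ^ (L.badPrimes hm).card
        * (Real.sqrt ((∏ ℓ ∈ L.badPrimes hm, ((ℓ.1 : ℕ) : ℝ)) ^ (Module.finrank ℚ F * (r * (n - r)))))⁻¹ := by
  rw [L.deg_eq 𝒦 hopen hm, L.norm_eq 𝒦 hm, norm_div, Complex.norm_real, norm_prod, norm_prod,
    ← Finset.prod_div_distrib, ← Finset.prod_const, ← Finset.prod_pow,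
    Real.sqrt_eq_rpow, ← Real.finsetProd_rpow _ _ (fun ℓ _ => by positivity), ← Finset.prod_inv_distrib,
    ← Finset.prod_mul_distrib]
  refine Finset.prod_le_prod (fun ℓ _ => by positivity) fun ℓ hℓ => ?_
  obtain ⟨c, hc⟩ := (mem_badPrimes hm).1 hℓ
  -- Square-freeness of `m` is what makes the local component the minuscule operator attached to ℓ,
  -- up to a unit.
  have hcℓ : ¬ (ℓ.1 : ℕ) ∣ c := by
    rintro ⟨d, rfl⟩
    have := hsq (ℓ.1 : ℕ) ⟨d, by rw [hc, mul_assoc]⟩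
    exact ℓ.1.2.one_lt.ne' (Nat.isUnit_iff.1 this)
  have h1 := coeffNorm_satakeGU_heckeLocal_le (ℓ.1 : ℕ) n F 𝒦 (L.unramified ℓ.1 ℓ.2) hcℓ hr hr'
  rw [← hc] at h1
  rw [Real.norm_of_nonneg (coeffNorm_nonneg _), ← Real.sqrt_eq_rpow]
  -- This also covers a vanishing degree, for which the quotient is zero.
  exact div_le_of_le_mul₀ (norm_nonneg _) (by positivity) h1

end LevelDatum

end Equidist

/-! ### The global estimate. -/

theorem mainTheorem7 {F 𝒦 D : Type*} [Field F] [NumberField F] [IsCMField F]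
    [Field 𝒦] [NumberField 𝒦] [IsTotallyComplex 𝒦] [Algebra.IsQuadraticExtension ℚ 𝒦] [Algebra 𝒦 F]
    [Ring D] [Algebra F D] [Algebra ℚ D] [IsSimpleRing D] [Algebra.IsCentral F D]
    [FiniteDimensional F D] [StarRing D]
    (hstar : ∀ x : F, star (algebraMap F D x) = algebraMap F D (IsCMField.complexConj F x))
    (n : ℕ) (hn : Module.finrank F D = n ^ 2)
    (L : Equidist.LevelDatum F D n)
    (hopen : IsOpen (L.K : Set (Equidist.GAdelic D)))
    (hcompact : IsCompact (L.K : Set (Equidist.GAdelic D))) :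
    ∃ C : ℝ, 0 < C ∧ ∀ ε : ℝ, 0 < ε → ∃ M : ℕ, 0 < M ∧
      ∀ m : ℕ, M < m → Squarefree m → ∀ r : ℕ, 1 ≤ r → r ≤ n - 1 →
        ‖(L.norm 𝒦 r m : ℂ) / L.deg 𝒦 r m‖
          < C * (m : ℝ) ^ (ε - (Module.finrank ℚ F : ℝ) * ((r : ℝ) * ((n : ℝ) - r) / 2)) := by
  set d := Module.finrank ℚ F with hd
  set Q : ℝ := ∏ ℓ ∈ L.S, ((ℓ : ℕ) : ℝ) with hQ
  have hQ1 : 1 ≤ Q :=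
    Finset.one_le_prod fun ℓ _ => by exact_mod_cast ℓ.2.one_lt.le
  have hA : (1 : ℝ) ≤ ((2 : ℝ) ^ d) ^ n := one_le_pow₀ (one_le_pow₀ one_le_two)
  -- The power of `Q` pays for the primes of `S` dividing m; its exponent bounds d r (n - r) for all
  -- r, so that C depends on neither r nor ε. The factor 2 makes the inequality strict.
  refine ⟨2 * Q ^ (d * (n * n)), by positivity, fun ε hε => ?_⟩
  obtain ⟨M, hM0, hM⟩ := Equidist.exists_pow_card_primeFactors_le hA hε
  refine ⟨M, hM0, fun m hm hsq r hr hr' => ?_⟩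
  have hm0 : m ≠ 0 := by omega
  have hmpos : (0 : ℝ) < m := by exact_mod_cast Nat.pos_of_ne_zero hm0
  have hrn : r < n := by omega
  set N := d * (r * (n - r)) with hN
  set P : ℝ := ∏ ℓ ∈ L.badPrimes hm0, ((ℓ.1 : ℕ) : ℝ) with hP
  have hPpos : 0 < P := Finset.prod_pos fun ℓ _ => by exact_mod_cast ℓ.1.2.pos
  have hmP : (m : ℝ) ≤ Q * P := by
    have := Equidist.LevelDatum.le_prod_badPrimes (L := L) hm0 hsq
    rw [hQ, hP]
    exact_mod_cast this
  have hexp : (d : ℝ) * ((r : ℝ) * ((n : ℝ) - r) / 2) = (N : ℝ) / 2 := by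
    rw [hN]
    push_cast [Nat.cast_sub hrn.le]
    ring
  -- From m ≤ Q P. The square root of Q ^ N is bounded crudely by Q ^ N, which is at least one.
  have hsqrt : (Real.sqrt (P ^ N))⁻¹ ≤ Q ^ (d * (n * n)) * (m : ℝ) ^ (-((N : ℝ) / 2)) := by
    have h1 : Real.sqrt ((m : ℝ) ^ N) ≤ Q ^ N * Real.sqrt (P ^ N) := by
      have hQN : (1 : ℝ) ≤ Q ^ N := one_le_pow₀ hQ1
      calc Real.sqrt ((m : ℝ) ^ N) ≤ Real.sqrt (Q ^ N * P ^ N) := by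
            rw [← mul_pow]
            exact Real.sqrt_le_sqrt (by gcongr)
        _ = Real.sqrt (Q ^ N) * Real.sqrt (P ^ N) := Real.sqrt_mul (by positivity) _
        _ ≤ Q ^ N * Real.sqrt (P ^ N) := by
            refine mul_le_mul_of_nonneg_right ?_ (Real.sqrt_nonneg _)
            exact (Real.sqrt_le_sqrt (le_self_pow₀ hQN two_ne_zero)).trans_eq (Real.sqrt_sq (by positivity))
    have h2 : (m : ℝ) ^ (-((N : ℝ) / 2)) = (Real.sqrt ((m : ℝ) ^ N))⁻¹ := by
      rw [Real.rpow_neg hmpos.le, Real.sqrt_eq_rpow, ← Real.rpow_natCast, ← Real.rpow_mul hmpos.le]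
      congr 2
      ring
    have h3 : 0 < Real.sqrt (P ^ N) := Real.sqrt_pos.2 (by positivity)
    have h4 : 0 < Real.sqrt ((m : ℝ) ^ N) := Real.sqrt_pos.2 (by positivity)
    have h5 : Q ^ N ≤ Q ^ (d * (n * n)) := by
      refine pow_le_pow_right₀ hQ1 ?_
      rw [hN]
      gcongr
      omega
    rw [h2, inv_le_iff_one_le_mul₀ h3, mul_assoc, mul_comm (Real.sqrt ((m : ℝ) ^ N))⁻¹, ← mul_assoc,
      ← div_eq_mul_inv, one_le_div h4]
    exact h1.trans (mul_le_mul_of_nonneg_right h5 h3.le)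
  have hkey : ‖(L.norm 𝒦 r m : ℂ) / L.deg 𝒦 r m‖
      ≤ (m : ℝ) ^ ε * (Q ^ (d * (n * n)) * (m : ℝ) ^ (-((N : ℝ) / 2))) := by
    refine (L.norm_div_deg_le 𝒦 hopen hm0 hsq hr hrn).trans (mul_le_mul ?_ hsqrt (by positivity) (by positivity))
    exact (pow_le_pow_right₀ hA (Equidist.LevelDatum.card_badPrimes_le hm0)).trans (hM m hm hsq)
  rw [hexp, sub_eq_add_neg, Real.rpow_add hmpos]
  refine hkey.trans_lt ?_
  have hpos : 0 < Q ^ (d * (n * n)) * ((m : ℝ) ^ ε * (m : ℝ) ^ (-((N : ℝ) / 2))) := by positivity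
  linarith
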